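/- Let $\mathbb T^2=\mathbb R^2/\mathbb Z^2$ with Lebesgue probability measure $\mu$, and let $\phi^t(x_1,x_2)=(x_1+t,x_2)$. For $\rho>0$ put $\Omega_\rho=\{z\in\mathbb C^2:|\mathrm{Im}\,z_1|<\rho,\ |\mathrm{Im}\,z_2|<\rho\}$ and $\|f\|_\rho=\sup_{\Omega_\rho}|f|$. Let $\mathrm{Diff}^\omega_\rho(\mathbb T^2,\mu)$ be the set of $\mu$-preserving real-analytic diffeomorphisms of $\mathbb T^2$ that are homotopic to the identity and have a lift $(x_1+f_1(x),x_2+f_2(x))$ whose $\mathbb Z^2$-periodic functions $f_1,f_2$ extend holomorphically to $\Omega_\rho$ with $\|f_i\|_\rho<\infty$. It carries the metric $d_\rho(F,G)=\max_{i}\inf_{m\in\mathbb Z}\|f_i-g_i+m\|_\rho$. *Step functions.* For integers $k,N\ge1$, reals $a_0,\dots,a_{k-1}$ and $\varepsilon,\delta>0$, we say that $s$ is an $(\varepsilon,\delta)$-approximation of the step function $\tilde s=\sum_{i=0}^{kN-1}a_{i\bmod k}\,\chi_{[\frac i{kN},\frac{i+1}{kN})}$ if $s$ is an entire $\frac1N$-periodic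 function, real on $\mathbb R$, and $\sup|s-\tilde s|<\varepsilon$ over the set of those $x\in[0,1)$ whose distance to every point $\frac i{kN}$, $0\le i\le kN$, is larger than $\frac{\delta}{2kN}$. *Construction.* Start with integers $0\le p_0<q_0$ and $H_0=\mathrm{id}$. Given $p_n,q_n$ and $H_n$, choose successively: (a) an integer $l_n>2^n\|DH_n\|_0$, where $\|DH_n\|_0$ is the maximum over $i,j$ of the supremum over $\mathbb R^2$ of $|\partial (H_n)_i/\partial x_j|$ for the lift of $H_n$; (b) with $\delta_n=3\varepsilon_n=\dfrac1{2^{l_n^2q_n}\,l_n^2q_n}$, functions $\psi_{1,n+1},\psi_{2,n+1},\psi_{3,n+1}$ that are $(\varepsilon_n,\delta_n)$-approximations of the step functions with $k=l_n$ and, respectively, - $N=1$, $a_0=0$ and $a_i=\frac{l_n-i}{l_n^2q_n}$ for $1\le i<l_n$; - $N=l_nq_n$, $a_i=\frac i{l_n}$; - $N=1$, $a_i=\frac{i}{l_n^2q_n}$; (c) an integer $k_n$. Put $h_{n+1}=h_{4,n+1}\circ h_{3,n+1}\circ h_{2,n+1}\circ h_{1,n+1}$ with $$h_{1,n+1}(x_1,x_2)=(x_1+\psi_{1,n+1}(x_2),x_2),\qquad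 h_{2,n+1}(x_1,x_2)=(x_1,x_2+\psi_{2,n+1}(x_1)),$$ $$h_{3,n+1}(x_1,x_2)=(x_1-\psi_{3,n+1}(x_2),x_2),\qquad h_{4,n+1}(x_1,x_2)=(x_1,x_2+q_nx_1)$$ (all modulo $1$), and $$H_{n+1}=h_{n+1}\circ H_n,\quad q_{n+1}=k_nl_n^2q_n,\quad p_{n+1}=k_nl_n^2p_n+1,\quad \alpha_n=\frac{p_n}{q_n},\quad T_n=H_n^{-1}\circ\phi^{\alpha_n}\circ H_n .$$ **Proposition.** If the integers $k_n$ are chosen large enough, the limit $T$ of the $T_n$ is uniquely ergodic. Precisely: there is a rule that assigns to the data chosen before $k_n$ (that is, to $p_0$, $q_0$, $n$, all choices of the earlier stages, $l_n$ and $\psi_{1,n+1},\psi_{2,n+1},\psi_{3,n+1}$) a lower bound for $k_n$ such that, for all $0\le p_0<q_0$, constructions in which every $k_n$ satisfies this bound exist, and for every such construction there is a homeomorphism $T$ of $\mathbb T^2$ such that, for every $\rho>0$, $T\in\mathrm{Diff}^\omega_\rho(\mathbb T^2,\mu)$ and $d_\rho(T_n,T)\to0$, and such that $T$ is uniquely ergodic,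 i.e. $T$ has exactly one invariant Borel probability measure. -/

import Mathlib

open MeasureTheory Filter Topology
open scoped ENNReal

noncomputable section

namespace AbC

/-! ### The torus and its real-analytic diffeomorphisms -/

/-- The torus `ℝ² / ℤ²`; its `volume` is the normalised Lebesgue measure. -/
abbrev T2 : Type := UnitAddCircle × UnitAddCircle

/-- The projection `ℝ² → ℝ² / ℤ²`. -/
def proj (x : ℝ × ℝ) : T2 := ((x.1 : UnitAddCircle), (x.2 : UnitAddCircle))

/-- The inclusion `ℝ² ⊆ ℂ²`. -/
def incl (x : ℝ × ℝ) : ℂ × ℂ := ((x.1 : ℂ), (x.2 : ℂ))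

/-- The strip `Ω_ρ = {(z₁, z₂) : |Im z₁| < ρ, |Im z₂| < ρ}`. -/
def strip (ρ : ℝ) : Set (ℂ × ℂ) := {z | |z.1.im| < ρ ∧ |z.2.im| < ρ}

/-- `‖f‖_ρ`, the supremum of `|f|` over `Ω_ρ`. -/
def normRho (ρ : ℝ) (f : ℂ × ℂ → ℂ) : ℝ≥0∞ := ⨆ z ∈ strip ρ, ‖f z‖ₑ

/-- `f` represents an element of `C^ω_ρ(𝕋²)` by its holomorphic extension: it is holomorphic and
bounded on `Ω_ρ`, `ℤ²`-periodic, and real on `ℝ²`. -/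
structure IsAnalyticRho (ρ : ℝ) (f : ℂ × ℂ → ℂ) : Prop where
  holomorphic : DifferentiableOn ℂ f (strip ρ)
  bounded : normRho ρ f < ⊤
  periodic₁ : ∀ z ∈ strip ρ, f (z.1 + 1, z.2) = f z
  periodic₂ : ∀ z ∈ strip ρ, f (z.1, z.2 + 1) = f z
  real : ∀ x : ℝ × ℝ, (f (incl x)).im = 0

/-- The map `F` of the torus has the lift
`(x₁, x₂) ↦ (x₁ + f₁ (x₁, x₂), x₂ + f₂ (x₁, x₂))` with `f₁, f₂ ∈ C^ω_ρ(𝕋²)`. -/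
structure IsLift (ρ : ℝ) (F : T2 → T2) (f₁ f₂ : ℂ × ℂ → ℂ) : Prop where
  analytic₁ : IsAnalyticRho ρ f₁
  analytic₂ : IsAnalyticRho ρ f₂
  lift : ∀ x : ℝ × ℝ,
    F (proj x) = proj (x.1 + (f₁ (incl x)).re, x.2 + (f₂ (incl x)).re)

/-- Membership in `Diff^ω_ρ(𝕋², μ)`: a Lebesgue measure preserving real-analytic diffeomorphism
homotopic to the identity, whose displacement functions lie in `C^ω_ρ(𝕋²)`. The homotopy to the
identity is the periodicity of the displacement functions. -/
structure IsDiffRho (ρ : ℝ) (F : T2 ≃ₜ T2) : Prop where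
  measurePreserving : MeasurePreserving F volume volume
  exists_lift : ∃ f₁ f₂ : ℂ × ℂ → ℂ, IsLift ρ F f₁ f₂
  analytic_symm : ∃ g : ℝ × ℝ → ℝ × ℝ, AnalyticOnNhd ℝ g Set.univ ∧
    ∀ x : ℝ × ℝ, F.symm (proj x) = proj (g x)

/-- `d_ρ(F, G) = max_i inf_{n ∈ ℤ} ‖f_i - g_i + n‖_ρ`. The value does not depend on the lifts;
it is `⊤` if `F` or `G` has no lift with displacement functions in `C^ω_ρ(𝕋²)`. -/
def distRho (ρ : ℝ) (F G : T2 → T2) : ℝ≥0∞ :=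
  ⨅ (f₁ : ℂ × ℂ → ℂ) (f₂ : ℂ × ℂ → ℂ) (g₁ : ℂ × ℂ → ℂ) (g₂ : ℂ × ℂ → ℂ)
    (_ : IsLift ρ F f₁ f₂) (_ : IsLift ρ G g₁ g₂),
    max (⨅ n : ℤ, normRho ρ fun z => f₁ z - g₁ z + n)
      (⨅ n : ℤ, normRho ρ fun z => f₂ z - g₂ z + n)

/-- Unique ergodicity: there is exactly one invariant Borel probability measure. -/
def UniquelyErgodic {X : Type*} [MeasurableSpace X] (T : X → X) : Prop :=
  ∃! ν : Measure X, IsProbabilityMeasure ν ∧ MeasurePreserving T ν ν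

/-! ### Step functions and their entire approximations -/

/-- The step function with value `a (i mod k)` on `[i/(kN), (i+1)/(kN))` for `0 ≤ i < kN`. -/
def stepFn (k N : ℕ) (a : ℕ → ℝ) (x : ℝ) : ℝ :=
  ∑ i ∈ Finset.range (k * N),
    (Set.Ico ((i : ℝ) / (k * N : ℝ)) (((i : ℝ) + 1) / (k * N : ℝ))).indicator
      (fun _ => a (i % k)) x

/-- The exceptional set: the points of `[0,1)` within distance `δ/(2kN)` of one of the points
`i/(kN)`, `0 ≤ i ≤ kN`. -/
def exceptional (k N : ℕ) (δ : ℝ) : Set ℝ :=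
  {x | x ∈ Set.Ico (0 : ℝ) 1 ∧
    ∃ i : ℕ, i ≤ k * N ∧ |x - (i : ℝ) / (k * N : ℝ)| ≤ δ / (2 * (k * N : ℝ))}

/-- `s` is an entire `1/N`-periodic function, real on the real line, whose supremum distance on
`[0,1)` minus the exceptional set from the step function is smaller than `ε`. -/
structure ApproxStep (k N : ℕ) (a : ℕ → ℝ) (ε δ : ℝ) (s : ℂ → ℂ) : Prop where
  entire : Differentiable ℂ s
  real : ∀ x : ℝ, (s x).im = 0
  periodic : ∀ z : ℂ, s (z + 1 / (N : ℂ)) = s z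
  near : ∃ η < ε, ∀ x ∈ Set.Ico (0 : ℝ) 1 \ exceptional k N δ,
    |(s x).re - stepFn k N a x| ≤ η

/-- The function `ℝ → ℝ` given by an entire function that is real on the real line. -/
def onReal (s : ℂ → ℂ) (x : ℝ) : ℝ := (s x).re

/-- The circle map `x ↦ s x mod 1`, for `s` entire, `1`-periodic and real on the real line
(evaluated at the representative in `[0,1)`). -/
def onCircle (s : ℂ → ℂ) (x : UnitAddCircle) : UnitAddCircle :=
  ((onReal s (AddCircle.equivIco (1 : ℝ) 0 x : ℝ) : ℝ) : UnitAddCircle)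

/-! ### Conjugating maps

These are written over any commutative group `A`: the torus is `A = ℝ/ℤ`, the lifts to the plane
are `A = ℝ`. -/

section Conj

variable {A : Type*} [AddCommGroup A]

/-- `(x₁, x₂) ↦ (x₁ + f x₂, x₂)`. -/
def shearFst (f : A → A) : Equiv.Perm (A × A) where
  toFun x := (x.1 + f x.2, x.2)
  invFun x := (x.1 - f x.2, x.2)
  left_inv x := by simp
  right_inv x := by simp

/-- `(x₁, x₂) ↦ (x₁, x₂ + f x₁)`. -/
def shearSnd (f : A → A) : Equiv.Perm (A × A) where
  toFun x := (x.1, x.2 + f x.1)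
  invFun x := (x.1, x.2 - f x.1)
  left_inv x := by simp
  right_inv x := by simp

/-- The translation `φ^t (x₁, x₂) = (x₁ + t, x₂)`. -/
def phi (t : A) : Equiv.Perm (A × A) := shearFst fun _ => t

/-- `h = h₄ ∘ h₃ ∘ h₂ ∘ h₁` with `h₁ (x₁, x₂) = (x₁ + ψ₁ x₂, x₂)`,
`h₂ (x₁, x₂) = (x₁, x₂ + ψ₂ x₁)`, `h₃ (x₁, x₂) = (x₁ - ψ₃ x₂, x₂)` and
`h₄ (x₁, x₂) = (x₁, x₂ + q x₁)`. -/
def hMap (ψ₁ ψ₂ ψ₃ : A → A) (q : ℕ) : Equiv.Perm (A × A) :=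
  shearSnd (fun x => q • x) * shearFst (fun x => -ψ₃ x) * shearSnd ψ₂ * shearFst ψ₁

end Conj

/-! ### The inductive construction -/

/-- What is chosen at stage `n + 1`: the integers `l_n` and `k_n` and the entire functions
`ψ_{1,n+1}, ψ_{2,n+1}, ψ_{3,n+1}`. -/
structure Choice where
  l : ℕ
  ψ₁ : ℂ → ℂ
  ψ₂ : ℂ → ℂ
  ψ₃ : ℂ → ℂ
  k : ℕ

/-- `q_{n+1} = k_n l_n² q_n`. -/
def q (q₀ : ℕ) (c : ℕ → Choice) : ℕ → ℕ
  | 0 => q₀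
  | n + 1 => (c n).k * (c n).l ^ 2 * q q₀ c n

/-- `p_{n+1} = k_n l_n² p_n + 1`. -/
def p (p₀ : ℕ) (c : ℕ → Choice) : ℕ → ℕ
  | 0 => p₀
  | n + 1 => (c n).k * (c n).l ^ 2 * p p₀ c n + 1

/-- `α_n = p_n / q_n`. -/
def alpha (p₀ q₀ : ℕ) (c : ℕ → Choice) (n : ℕ) : ℝ := (p p₀ c n : ℝ) / (q q₀ c n : ℝ)

/-- `H_0 = id` and `H_{n+1} = h_{n+1} ∘ H_n`, as maps of the torus. -/
def HTorus (q₀ : ℕ) (c : ℕ → Choice) : ℕ → Equiv.Perm T2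
  | 0 => 1
  | n + 1 =>
      hMap (onCircle (c n).ψ₁) (onCircle (c n).ψ₂) (onCircle (c n).ψ₃) (q q₀ c n) * HTorus q₀ c n

/-- The lift of `H_n` to the plane. -/
def HPlane (q₀ : ℕ) (c : ℕ → Choice) : ℕ → Equiv.Perm (ℝ × ℝ)
  | 0 => 1
  | n + 1 =>
      hMap (onReal (c n).ψ₁) (onReal (c n).ψ₂) (onReal (c n).ψ₃) (q q₀ c n) * HPlane q₀ c n

/-- `T_n = H_n⁻¹ ∘ φ^{α_n} ∘ H_n`. -/
def Tn (p₀ q₀ : ℕ) (c : ℕ → Choice) (n : ℕ) : Equiv.Perm T2 :=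
  (HTorus q₀ c n)⁻¹ * phi ((alpha p₀ q₀ c n : ℝ) : UnitAddCircle) * HTorus q₀ c n

/-- `‖DF‖_0 = max_{i,j} sup_{ℝ²} |∂F_i/∂x_j|` (the norm on `ℝ × ℝ` is the maximum norm). -/
def derivNorm (F : ℝ × ℝ → ℝ × ℝ) : ℝ≥0∞ :=
  ⨆ x : ℝ × ℝ, max ‖fderiv ℝ F x (1, 0)‖ₑ ‖fderiv ℝ F x (0, 1)‖ₑ

/-- The precision `δ = 1 / (2^{l²q} l² q)`; the uniform error is `ε = δ / 3`. -/
def precision (l q : ℕ) : ℝ := 1 / (2 ^ (l ^ 2 * q) * ((l : ℝ) ^ 2 * (q : ℝ)))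

/-- The requirements on `l_n` and on `ψ_{1,n+1}, ψ_{2,n+1}, ψ_{3,n+1}` at every stage. -/
structure Admissible (q₀ : ℕ) (c : ℕ → Choice) : Prop where
  l_large : ∀ n, 2 ^ n * derivNorm (HPlane q₀ c n) < ((c n).l : ℝ≥0∞)
  approx₁ : ∀ n, ApproxStep (c n).l 1
    (fun i => if i = 0 then 0 else
      (((c n).l : ℝ) - i) / (((c n).l : ℝ) ^ 2 * (q q₀ c n : ℝ)))
    (precision (c n).l (q q₀ c n) / 3) (precision (c n).l (q q₀ c n)) (c n).ψ₁
  approx₂ : ∀ n, ApproxStep (c n).l ((c n).l * q q₀ c n)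
    (fun i => (i : ℝ) / ((c n).l : ℝ))
    (precision (c n).l (q q₀ c n) / 3) (precision (c n).l (q q₀ c n)) (c n).ψ₂
  approx₃ : ∀ n, ApproxStep (c n).l 1
    (fun i => (i : ℝ) / (((c n).l : ℝ) ^ 2 * (q q₀ c n : ℝ)))
    (precision (c n).l (q q₀ c n) / 3) (precision (c n).l (q q₀ c n)) (c n).ψ₃

/-- A lower bound for `k_n` that may depend on everything chosen before `k_n`: on `p₀`, `q₀`, `n`,
the choices at the earlier stages, `l_n` and `ψ_{1,n+1}, ψ_{2,n+1}, ψ_{3,n+1}`. -/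
abbrev Threshold : Type :=
  (p₀ q₀ n : ℕ) → (Fin n → Choice) → (l : ℕ) → (ψ₁ ψ₂ ψ₃ : ℂ → ℂ) → ℕ

/-- Every `k_n` is at least the threshold determined by what was chosen before it. -/
def LargeK (κ : Threshold) (p₀ q₀ : ℕ) (c : ℕ → Choice) : Prop :=
  ∀ n, κ p₀ q₀ n (fun i => c i) (c n).l (c n).ψ₁ (c n).ψ₂ (c n).ψ₃ ≤ (c n).k

end AbC

end

/-! The mechanism is approximation by conjugation. Write `S_n^t = H_n⁻¹ ∘ φ^t ∘ H_n`, so that `T_n`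
is the time-`α_n` map of `S_n`. Since `ψ₂` is `1/q_n`-periodic and `h₄` shears by an integer
multiple, `h_{n+1}` commutes with `φ^{1/q_n}` modulo `ℤ²` (`hMap_add_rational`), so `S_n` and
`S_{n+1}` agree on the torus at all multiples of `1/q_n` (`ST_succ`). As `α_{n+1} = α_n +
1/q_{n+1}`, passing from `T_n` to `T_{n+1}` costs a time at most `1/k_n` of the flow `S_{n+1}`, and
this flow is known before `k_n` is chosen. Its uniform continuity on `|Im z_i| ≤ n`
(`exists_shift_bound`) supplies the lower bound for `k_n`, with error `2^{-n}`. Suitable lifts of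
`T_n` and `T_n⁻¹` then converge on every strip to mutually inverse entire maps. The same bound
covers all iterates up to `q_n`, so `T^i` stays within `2/2^n` of `T_n^i` for `i ≤ q_n`
(`dist_iterate_le`).

Unique ergodicity rests on the shape of the curves `h_{n+1}⁻¹(·, y)`, parametrised by `t = y/q_n -
s` (`hMap_symm_near_grid`). While `s` crosses an interval of length `1/(l_n q_n)`, the first
coordinate hardly moves and the second spends equal times near the multiples of `1/l_n`, up to a
very small exceptional set. The integral of a function along the curve is therefore nearly an
integral of vertical grid averages, which does not involve `y` (`abs_integral_curve_sub_le`). This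
is applied to `f ∘ H_n⁻¹`: the derivative of `H_n` has determinant one, so `H_n⁻¹` has Lipschitz
constant at most `2‖DH_n‖`, and `l_n > 2^n‖DH_n‖` makes `f ∘ H_n⁻¹` almost constant at scale
`1/l_n`. Hence along every orbit of `S_{n+1}` the integral of `f` is close to `∫ f dμ`
(`abs_integral_HTorus_symm_sub_le`).

Finally `q_n α_{n+1} = p_n + 1/M` with `M = k_n l_n²`, so the points `T^{q_n j} x`, `j < M`, follow
`M` equidistant points of such an orbit, and the averages of `f` over them are uniformly close to `∫
f dμ` (`abs_average_iterate_sub_le`). Integrating against an invariant probability `ν` gives `∫ f dν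
= ∫ f dμ`. -/

noncomputable section

namespace AbC

/-! ### Lifts of the conjugating maps -/

/-- The inclusion `ℤ² ⊆ ℂ²`. -/
def intIncl (e : ℤ × ℤ) : ℂ × ℂ := ((e.1 : ℂ), (e.2 : ℂ))

@[simp] lemma intIncl_fst (e : ℤ × ℤ) : (intIncl e).1 = (e.1 : ℂ) := rfl
@[simp] lemma intIncl_snd (e : ℤ × ℤ) : (intIncl e).2 = (e.2 : ℂ) := rfl

section Shear

variable {A : Type*} [AddCommGroup A]

@[simp] lemma shearFst_apply (f : A → A) (x : A × A) : shearFst f x = (x.1 + f x.2, x.2) := rfl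
@[simp] lemma shearSnd_apply (f : A → A) (x : A × A) : shearSnd f x = (x.1, x.2 + f x.1) := rfl
@[simp] lemma shearFst_symm_apply (f : A → A) (x : A × A) :
    (shearFst f).symm x = (x.1 - f x.2, x.2) := rfl
@[simp] lemma shearSnd_symm_apply (f : A → A) (x : A × A) :
    (shearSnd f).symm x = (x.1, x.2 - f x.1) := rfl
@[simp] lemma phi_apply (t : A) (x : A × A) : phi t x = (x.1 + t, x.2) := rfl

lemma phi_add (s t : A) : phi (s + t) = phi s * phi t := by
  ext x <;> simp [add_assoc, add_comm s t]

lemma phi_zero : phi (0 : A) = 1 := by ext x <;> simp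

lemma hMap_apply (ψ₁ ψ₂ ψ₃ : A → A) (q : ℕ) (x : A × A) :
    hMap ψ₁ ψ₂ ψ₃ q x = shearSnd (fun x => q • x)
      (shearFst (fun x => -ψ₃ x) (shearSnd ψ₂ (shearFst ψ₁ x))) := rfl

lemma hMap_symm_apply (ψ₁ ψ₂ ψ₃ : A → A) (q : ℕ) (x : A × A) :
    (hMap ψ₁ ψ₂ ψ₃ q).symm x = (shearFst ψ₁).symm ((shearSnd ψ₂).symm
      ((shearFst (fun x => -ψ₃ x)).symm ((shearSnd (fun x => q • x)).symm x))) := rfl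

end Shear

/-- The lift of `H_n` to `ℂ²`. -/
def HC (q₀ : ℕ) (c : ℕ → Choice) : ℕ → Equiv.Perm (ℂ × ℂ)
  | 0 => 1
  | n + 1 => hMap (c n).ψ₁ (c n).ψ₂ (c n).ψ₃ (q q₀ c n) * HC q₀ c n

/-- The action of `H_n` on `ℤ²`. -/
def HInt (q₀ : ℕ) (c : ℕ → Choice) : ℕ → Equiv.Perm (ℤ × ℤ)
  | 0 => 1
  | n + 1 => hMap 0 0 0 (q q₀ c n) * HInt q₀ c n

/-- The properties of the choice at stage `n` that do not involve step functions. -/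
structure TameAt (q₀ : ℕ) (c : ℕ → Choice) (n : ℕ) : Prop where
  entire₁ : Differentiable ℂ (c n).ψ₁
  entire₂ : Differentiable ℂ (c n).ψ₂
  entire₃ : Differentiable ℂ (c n).ψ₃
  real₁ : ∀ x : ℝ, ((c n).ψ₁ x).im = 0
  real₂ : ∀ x : ℝ, ((c n).ψ₂ x).im = 0
  real₃ : ∀ x : ℝ, ((c n).ψ₃ x).im = 0
  periodic₁ : ∀ z, (c n).ψ₁ (z + 1) = (c n).ψ₁ z
  periodic₂ : ∀ z, (c n).ψ₂ (z + 1) = (c n).ψ₂ z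
  periodic₃ : ∀ z, (c n).ψ₃ (z + 1) = (c n).ψ₃ z
  periodic_q : ∀ z, (c n).ψ₂ (z + 1 / (q q₀ c n : ℂ)) = (c n).ψ₂ z
  q_pos : 0 < q q₀ c n

lemma periodic_int {E : Type*} {f : ℂ → E} (h : ∀ z, f (z + 1) = f z) (z : ℂ) (m : ℤ) :
    f (z + m) = f z := by
  have := (show Function.Periodic f 1 from h).int_mul m z
  simpa using this

section Invariants

variable {q₀ : ℕ} {c : ℕ → Choice} {n : ℕ}

/-- By periodicity the first three shears commute with integer translations, while `h₄` acts on `ℤ²`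
by a nontrivial shear. This is why an automorphism of `ℤ²` has to be carried along with `H_n`. -/
lemma hMap_add_int (h : TameAt q₀ c n) (z : ℂ × ℂ) (e : ℤ × ℤ) :
    hMap (c n).ψ₁ (c n).ψ₂ (c n).ψ₃ (q q₀ c n) (z + intIncl e)
      = hMap (c n).ψ₁ (c n).ψ₂ (c n).ψ₃ (q q₀ c n) z + intIncl (hMap 0 0 0 (q q₀ c n) e) := by
  have h1 := fun z m => periodic_int h.periodic₁ z m
  have h2 := fun z m => periodic_int h.periodic₂ z m
  have h3 := fun z m => periodic_int h.periodic₃ z m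
  have e1 : z.1 + e.1 + (c n).ψ₁ z.2 = z.1 + (c n).ψ₁ z.2 + e.1 := by ring
  have e2 : ∀ y, z.2 + e.2 + y = z.2 + y + e.2 := fun y => by ring
  ext
  · simp only [hMap_apply, shearFst_apply, shearSnd_apply, Prod.fst_add, Prod.snd_add,
      intIncl_fst, intIncl_snd, h1, h2, h3, e1, e2, Pi.zero_apply, neg_zero, add_zero]
    ring
  · simp only [hMap_apply, shearFst_apply, shearSnd_apply, Prod.fst_add, Prod.snd_add,
      intIncl_fst, intIncl_snd, h1, h2, h3, e1, e2, Pi.zero_apply, neg_zero, add_zero]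
    simp only [nsmul_eq_mul]
    push_cast
    ring

lemma HC_add_int (h : ∀ i < n, TameAt q₀ c i) (z : ℂ × ℂ) (e : ℤ × ℤ) :
    HC q₀ c n (z + intIncl e) = HC q₀ c n z + intIncl (HInt q₀ c n e) := by
  induction n with
  | zero => rfl
  | succ n ih =>
    have := ih fun i hi => h i (by omega)
    simp only [HC, HInt, Equiv.Perm.mul_apply, this, hMap_add_int (h n (by omega))]

lemma HC_symm_add_int (h : ∀ i < n, TameAt q₀ c i) (z : ℂ × ℂ) (e : ℤ × ℤ) :
    (HC q₀ c n).symm (z + intIncl e)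
      = (HC q₀ c n).symm z + intIncl ((HInt q₀ c n).symm e) := by
  rw [Equiv.symm_apply_eq, HC_add_int h]; simp

/-- Lets a vertical integer translation pass through the conjugation by `H_n` unchanged in
`SC_succ`. -/
lemma HInt_snd (n : ℕ) (m : ℤ) : HInt q₀ c n (0, m) = (0, m) := by
  induction n with
  | zero => rfl
  | succ n ih => simp [HInt, ih, hMap_apply]

lemma ofReal_onReal {s : ℂ → ℂ} (h : ∀ x : ℝ, (s x).im = 0) (x : ℝ) : s x = (onReal s x : ℂ) := by
  apply Complex.ext <;> simp [onReal, h]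

lemma HC_incl (h : ∀ i < n, TameAt q₀ c i) (x : ℝ × ℝ) :
    HC q₀ c n (incl x) = incl (HPlane q₀ c n x) := by
  induction n with
  | zero => rfl
  | succ n ih =>
    have ht := h n (by omega)
    simp only [HC, HPlane, Equiv.Perm.mul_apply, ih fun i hi => h i (by omega)]
    generalize HPlane q₀ c n x = y
    have h1 := ofReal_onReal ht.real₁ y.2
    have h2 := ofReal_onReal ht.real₂ (y.1 + onReal (c n).ψ₁ y.2)
    have h3 := ofReal_onReal ht.real₃ (y.2 + onReal (c n).ψ₂ (y.1 + onReal (c n).ψ₁ y.2))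
    push_cast at h2 h3
    simp only [hMap_apply, shearFst_apply, shearSnd_apply, incl, nsmul_eq_mul, h1, h2, h3,
      Complex.ofReal_add, Complex.ofReal_neg, Complex.ofReal_mul, Complex.ofReal_natCast]

lemma HC_symm_incl (h : ∀ i < n, TameAt q₀ c i) (x : ℝ × ℝ) :
    (HC q₀ c n).symm (incl x) = incl ((HPlane q₀ c n).symm x) := by
  rw [Equiv.symm_apply_eq, HC_incl h]; simp

lemma onReal_periodic {s : ℂ → ℂ} (h : ∀ z, s (z + 1) = s z) : Function.Periodic (onReal s) 1 :=
  fun x => by simp [onReal, h]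

lemma onCircle_coe {s : ℂ → ℂ} (h : ∀ z, s (z + 1) = s z) (x : ℝ) :
    onCircle s (x : UnitAddCircle) = (onReal s x : UnitAddCircle) := by
  have h1 : (AddCircle.equivIco (1 : ℝ) 0 (x : UnitAddCircle) : ℝ) = Int.fract x := by
    rw [AddCircle.coe_equivIco_mk_apply, div_one, mul_one]
  have h2 : onReal s (Int.fract x) = onReal s x := by
    have := (onReal_periodic h).sub_int_mul_eq (x := x) ⌊x⌋
    rwa [mul_one] at this
  rw [onCircle, h1, h2]

lemma HTorus_proj (h : ∀ i < n, TameAt q₀ c i) (x : ℝ × ℝ) :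
    HTorus q₀ c n (proj x) = proj (HPlane q₀ c n x) := by
  induction n with
  | zero => rfl
  | succ n ih =>
    have ht := h n (by omega)
    simp only [HTorus, HPlane, Equiv.Perm.mul_apply, ih fun i hi => h i (by omega)]
    generalize HPlane q₀ c n x = y
    simp only [hMap_apply, shearFst_apply, shearSnd_apply, proj, onCircle_coe ht.periodic₁,
      ← AddCircle.coe_add, onCircle_coe ht.periodic₂, onCircle_coe ht.periodic₃,
      ← AddCircle.coe_neg, ← AddCircle.coe_nsmul]

lemma HTorus_symm_proj (h : ∀ i < n, TameAt q₀ c i) (x : ℝ × ℝ) :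
    (HTorus q₀ c n).symm (proj x) = proj ((HPlane q₀ c n).symm x) := by
  rw [Equiv.symm_apply_eq, HTorus_proj h]; simp

lemma hMap_differentiable (h : TameAt q₀ c n) :
    Differentiable ℂ (hMap (c n).ψ₁ (c n).ψ₂ (c n).ψ₃ (q q₀ c n)) ∧
    Differentiable ℂ (hMap (c n).ψ₁ (c n).ψ₂ (c n).ψ₃ (q q₀ c n)).symm := by
  have h1 := h.entire₁
  have h2 := h.entire₂
  have h3 := h.entire₃
  constructor
  · show Differentiable ℂ (fun x => hMap (c n).ψ₁ (c n).ψ₂ (c n).ψ₃ (q q₀ c n) x)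
    simp only [hMap_apply, shearFst_apply, shearSnd_apply, nsmul_eq_mul]
    fun_prop
  · show Differentiable ℂ (fun x => (hMap (c n).ψ₁ (c n).ψ₂ (c n).ψ₃ (q q₀ c n)).symm x)
    simp only [hMap_symm_apply, shearFst_symm_apply, shearSnd_symm_apply, nsmul_eq_mul]
    fun_prop

lemma HC_differentiable (h : ∀ i < n, TameAt q₀ c i) :
    Differentiable ℂ (HC q₀ c n) ∧ Differentiable ℂ (HC q₀ c n).symm := by
  induction n with
  | zero => exact ⟨differentiable_id, differentiable_id⟩
  | succ n ih =>
    have h1 := ih fun i hi => h i (by omega)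
    have h2 := hMap_differentiable (h n (by omega))
    exact ⟨h2.1.comp h1.1, h1.2.comp h2.2⟩

end Invariants

/-! ### The conjugated flow -/

/-- The closed strip `{|Im z₁| ≤ ρ, |Im z₂| ≤ ρ}`. -/
def closedStrip (ρ : ℝ) : Set (ℂ × ℂ) := {z | |z.1.im| ≤ ρ ∧ |z.2.im| ≤ ρ}

/-- The part of the closed strip over the unit square. -/
def stripBox (ρ : ℝ) : Set (ℂ × ℂ) :=
  (Set.Icc 0 1 ×ℂ Set.Icc (-ρ) ρ) ×ˢ (Set.Icc 0 1 ×ℂ Set.Icc (-ρ) ρ)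

lemma isCompact_stripBox (ρ : ℝ) : IsCompact (stripBox ρ) :=
  (isCompact_Icc.reProdIm isCompact_Icc).prod (isCompact_Icc.reProdIm isCompact_Icc)

lemma exists_stripBox_add {ρ : ℝ} {z : ℂ × ℂ} (hz : z ∈ closedStrip ρ) :
    ∃ w ∈ stripBox ρ, ∃ e : ℤ × ℤ, z = w + intIncl e := by
  refine ⟨(z.1 - (⌊z.1.re⌋ : ℂ), z.2 - (⌊z.2.re⌋ : ℂ)), ?_, (⌊z.1.re⌋, ⌊z.2.re⌋), ?_⟩
  · have h1 := Int.floor_le z.1.re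
    have h2 := Int.lt_floor_add_one z.1.re
    have h3 := Int.floor_le z.2.re
    have h4 := Int.lt_floor_add_one z.2.re
    have h5 := abs_le.1 hz.1
    have h6 := abs_le.1 hz.2
    simp only [stripBox, Set.mem_prod, Complex.mem_reProdIm, Set.mem_Icc, Complex.sub_re,
      Complex.intCast_re, Complex.sub_im, Complex.intCast_im, sub_zero]
    refine ⟨⟨⟨?_, ?_⟩, h5⟩, ⟨⟨?_, ?_⟩, h6⟩⟩ <;> linarith
  · ext <;> simp

lemma exists_bound_of_periodic {f : ℂ × ℂ → ℂ × ℂ} (hf : Continuous f)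
    (hp : ∀ z e, f (z + intIncl e) = f z) (ρ : ℝ) : ∃ C, ∀ z ∈ closedStrip ρ, ‖f z‖ ≤ C := by
  obtain ⟨C, hC⟩ := (isCompact_stripBox ρ).exists_bound_of_continuousOn hf.continuousOn
  refine ⟨C, fun z hz => ?_⟩
  obtain ⟨w, hw, e, rfl⟩ := exists_stripBox_add hz
  rw [hp]; exact hC w hw

/-- Integer translations in time and space change `Φ` by a constant, so its increments are periodic
and uniform continuity on a compact set gives a modulus valid for all times and on the whole strip.
-/
lemma exists_modulus {Φ : ℝ × (ℂ × ℂ) → ℂ × ℂ} (hΦ : Continuous Φ)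
    (hp : ∀ (m : ℤ) e, ∃ d, ∀ t z, Φ (t + m, z + intIncl e) = Φ (t, z) + d)
    (ρ : ℝ) {ε : ℝ} (hε : 0 < ε) :
    ∃ δ > 0, ∀ t s : ℝ, |s| ≤ δ → ∀ z ∈ closedStrip ρ, ‖Φ (t + s, z) - Φ (t, z)‖ ≤ ε := by
  -- With `t` reduced to `[0,1)` and `|s| ≤ 1`, both `t` and `t + s` lie in `[-1,2]`.
  have hK : IsCompact (Set.Icc (-1 : ℝ) 2 ×ˢ stripBox ρ) := isCompact_Icc.prod (isCompact_stripBox ρ)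
  have hu := hK.uniformContinuousOn_of_continuous hΦ.continuousOn
  rw [Metric.uniformContinuousOn_iff] at hu
  obtain ⟨δ, hδ, h⟩ := hu ε hε
  refine ⟨min (δ / 2) 1, by positivity, fun t s hs z hz => ?_⟩
  obtain ⟨w, hw, e, rfl⟩ := exists_stripBox_add hz
  obtain ⟨d, hd⟩ := hp ⌊t⌋ e
  have e1 : t = Int.fract t + ⌊t⌋ := (Int.fract_add_floor t).symm
  have e2 : t + s = (Int.fract t + s) + ⌊t⌋ := by rw [add_right_comm, ← e1]
  rw [e2, hd]
  nth_rewrite 2 [e1]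
  rw [hd, add_sub_add_right_eq_sub, ← dist_eq_norm]
  have h0 := Int.fract_nonneg t
  have h1 := Int.fract_lt_one t
  have h2 := abs_le.1 (hs.trans (min_le_right _ _))
  refine (h _ ⟨⟨by linarith, by linarith⟩, hw⟩ _ ⟨⟨by linarith, by linarith⟩, hw⟩ ?_).le
  rw [Prod.dist_eq, dist_self, Real.dist_eq]
  have : |Int.fract t + s - Int.fract t| ≤ δ / 2 := by
    rw [add_sub_cancel_left]; exact hs.trans (min_le_left _ _)
  exact max_lt (by linarith) hδ

/-- The flow `H_n⁻¹ ∘ φ^t ∘ H_n` on `ℂ²`. -/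
def SC (q₀ : ℕ) (c : ℕ → Choice) (n : ℕ) (t : ℝ) : Equiv.Perm (ℂ × ℂ) :=
  (HC q₀ c n)⁻¹ * phi (t : ℂ) * HC q₀ c n

/-- The flow `H_n⁻¹ ∘ φ^t ∘ H_n` on `ℝ²`. -/
def SP (q₀ : ℕ) (c : ℕ → Choice) (n : ℕ) (t : ℝ) : Equiv.Perm (ℝ × ℝ) :=
  (HPlane q₀ c n)⁻¹ * phi t * HPlane q₀ c n

/-- The flow `H_n⁻¹ ∘ φ^t ∘ H_n` on the torus. -/
def ST (q₀ : ℕ) (c : ℕ → Choice) (n : ℕ) (t : ℝ) : Equiv.Perm T2 :=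
  (HTorus q₀ c n)⁻¹ * phi (t : UnitAddCircle) * HTorus q₀ c n

lemma proj_surjective : Function.Surjective proj := by
  rintro ⟨a, b⟩
  obtain ⟨x, rfl⟩ := QuotientAddGroup.mk_surjective a
  obtain ⟨y, rfl⟩ := QuotientAddGroup.mk_surjective b
  exact ⟨(x, y), rfl⟩

lemma proj_add_int (x : ℝ × ℝ) (a b : ℤ) : proj (x.1 + a, x.2 + b) = proj x := by
  have h : ∀ m : ℤ, ((m : ℝ) : UnitAddCircle) = 0 := fun m => by
    rw [AddCircle.coe_eq_zero_iff]; exact ⟨m, by simp⟩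
  simp only [proj, AddCircle.coe_add, h, add_zero]

section Flow

variable {q₀ : ℕ} {c : ℕ → Choice} {n : ℕ}

lemma SC_apply (t : ℝ) (z : ℂ × ℂ) :
    SC q₀ c n t z = (HC q₀ c n).symm ((HC q₀ c n z).1 + t, (HC q₀ c n z).2) := rfl

lemma ST_apply (t : ℝ) (z : T2) :
    ST q₀ c n t z = (HTorus q₀ c n).symm ((HTorus q₀ c n z).1 + t, (HTorus q₀ c n z).2) := rfl

lemma Tn_eq (p₀ : ℕ) : Tn p₀ q₀ c n = ST q₀ c n (alpha p₀ q₀ c n) := rfl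

lemma ST_add (s t : ℝ) : ST q₀ c n (s + t) = ST q₀ c n s * ST q₀ c n t := by
  simp only [ST, AddCircle.coe_add, phi_add]; group

lemma SC_add (s t : ℝ) : SC q₀ c n (s + t) = SC q₀ c n s * SC q₀ c n t := by
  simp only [SC, Complex.ofReal_add, phi_add]; group

lemma ST_zero : ST q₀ c n 0 = 1 := by
  simp only [ST, AddCircle.coe_zero, phi_zero]; group

lemma SC_zero : SC q₀ c n 0 = 1 := by
  simp only [SC, Complex.ofReal_zero, phi_zero]; group

lemma ST_pow (t : ℝ) (i : ℕ) : ST q₀ c n t ^ i = ST q₀ c n (i * t) := by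
  induction i with
  | zero => simp [ST_zero]
  | succ i ih => rw [pow_succ, ih, ← ST_add]; congr 1; push_cast; ring

lemma SC_incl (h : ∀ i < n, TameAt q₀ c i) (t : ℝ) (x : ℝ × ℝ) :
    SC q₀ c n t (incl x) = incl (SP q₀ c n t x) := by
  rw [SC_apply, HC_incl h]
  refine Eq.trans ?_ (HC_symm_incl h (phi t (HPlane q₀ c n x)))
  simp [incl]

lemma ST_proj (h : ∀ i < n, TameAt q₀ c i) (t : ℝ) (x : ℝ × ℝ) :
    ST q₀ c n t (proj x) = proj (SP q₀ c n t x) := by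
  rw [ST_apply, HTorus_proj h]
  exact HTorus_symm_proj h (phi t (HPlane q₀ c n x))

/-- The automorphism of `ℤ²` produced by `H_n` is undone by `H_n⁻¹`, since the map between them is a
translation. -/
lemma SC_add_int (h : ∀ i < n, TameAt q₀ c i) (t : ℝ) (z : ℂ × ℂ) (e : ℤ × ℤ) :
    SC q₀ c n t (z + intIncl e) = SC q₀ c n t z + intIncl e := by
  rw [SC_apply, SC_apply, HC_add_int h]
  have := HC_symm_add_int h ((HC q₀ c n z).1 + t, (HC q₀ c n z).2) (HInt q₀ c n e)
  rw [Equiv.symm_apply_apply] at this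
  rw [← this]
  congr 1
  ext <;> simp only [Prod.fst_add, Prod.snd_add]
  ring

lemma SC_time_add_int (h : ∀ i < n, TameAt q₀ c i) (t : ℝ) (z : ℂ × ℂ) (m : ℤ) :
    SC q₀ c n (t + m) z = SC q₀ c n t z + intIncl ((HInt q₀ c n).symm (m, 0)) := by
  rw [SC_apply, SC_apply, ← HC_symm_add_int h]
  congr 1
  ext
  · simp; ring
  · simp

lemma SC_continuous (h : ∀ i < n, TameAt q₀ c i) :
    Continuous fun x : ℝ × (ℂ × ℂ) => SC q₀ c n x.1 x.2 := by
  have h1 := (HC_differentiable h).1.continuous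
  have h2 := (HC_differentiable h).2.continuous
  simp only [SC_apply]
  fun_prop

lemma SC_differentiable (h : ∀ i < n, TameAt q₀ c i) (t : ℝ) :
    Differentiable ℂ (SC q₀ c n t) := by
  have h1 := (HC_differentiable h).1
  have h2 := (HC_differentiable h).2
  show Differentiable ℂ fun z => SC q₀ c n t z
  simp only [SC_apply]
  fun_prop

/-- The commutation on which the construction rests, in a form without reduction modulo 1: `ψ₂` is
`1/q`-periodic, `ψ₁` and `ψ₃` do not see the integer `m`, and the increment `q · (m/q) = m` of `h₄`
is cancelled by the `-m` in the second coordinate. -/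
lemma hMap_add_rational (h : TameAt q₀ c n) (z : ℂ × ℂ) (m : ℤ) :
    hMap (c n).ψ₁ (c n).ψ₂ (c n).ψ₃ (q q₀ c n) (z.1 + m / (q q₀ c n : ℂ), z.2 - m)
      = ((hMap (c n).ψ₁ (c n).ψ₂ (c n).ψ₃ (q q₀ c n) z).1 + m / (q q₀ c n : ℂ),
        (hMap (c n).ψ₁ (c n).ψ₂ (c n).ψ₃ (q q₀ c n) z).2) := by
  have hq : (q q₀ c n : ℂ) ≠ 0 := by exact_mod_cast h.q_pos.ne'
  have h1 : ∀ x, (c n).ψ₁ (x - m) = (c n).ψ₁ x := fun x => by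
    simpa [sub_eq_add_neg] using periodic_int h.periodic₁ x (-m)
  have h3 : ∀ x, (c n).ψ₃ (x - m) = (c n).ψ₃ x := fun x => by
    simpa [sub_eq_add_neg] using periodic_int h.periodic₃ x (-m)
  have h2 : ∀ x, (c n).ψ₂ (x + m / (q q₀ c n : ℂ)) = (c n).ψ₂ x := fun x => by
    have := (show Function.Periodic (c n).ψ₂ (1 / (q q₀ c n : ℂ)) from h.periodic_q).int_mul m x
    rwa [mul_one_div] at this
  have e1 : z.1 + m / (q q₀ c n : ℂ) + (c n).ψ₁ z.2
      = z.1 + (c n).ψ₁ z.2 + m / (q q₀ c n : ℂ) := by ring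
  have e2 : ∀ y, z.2 - m + y = z.2 + y - m := fun y => by ring
  simp only [hMap_apply, shearFst_apply, shearSnd_apply, h1, e1, h2, e2, h3, nsmul_eq_mul,
    Prod.mk.injEq]
  constructor
  · ring
  · field_simp
    ring

/-- On the torus the vertical integer disappears and gives `ST_succ`. On the plane these integers
accumulate from stage to stage, which is why `liftT` and `liftTInv` contain a sum of the `p_j`. -/
lemma SC_succ (h : ∀ i < n + 1, TameAt q₀ c i) (m : ℤ) (z : ℂ × ℂ) :
    SC q₀ c (n + 1) (m / (q q₀ c n : ℝ)) z
      = SC q₀ c n (m / (q q₀ c n : ℝ)) z - (0, (m : ℂ)) := by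
  have ht : ∀ i < n, TameAt q₀ c i := fun i hi => h i (by omega)
  have h1 : ∀ z, HC q₀ c (n + 1) z
    = hMap (c n).ψ₁ (c n).ψ₂ (c n).ψ₃ (q q₀ c n) (HC q₀ c n z) := fun _ => rfl
  rw [SC_apply, SC_apply, Equiv.symm_apply_eq, h1, h1]
  have h2 := HC_add_int ht ((HC q₀ c n).symm
    ((HC q₀ c n z).1 + (m / (q q₀ c n : ℝ) : ℝ), (HC q₀ c n z).2)) (0, -m)
  rw [HInt_snd, Equiv.apply_symm_apply] at h2
  have h3 : ∀ w : ℂ × ℂ, w - (0, (m : ℂ)) = w + intIncl (0, -m) := fun w => by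
    ext <;> simp [sub_eq_add_neg]
  rw [h3, h2]
  have := hMap_add_rational (h n (by omega)) (HC q₀ c n z) m
  push_cast
  rw [← this]
  congr 1
  ext <;> simp [sub_eq_add_neg]

lemma exists_shift_bound (h : ∀ i < n, TameAt q₀ c i) (ρ : ℝ) {ε : ℝ} (hε : 0 < ε) :
    ∃ K : ℕ, ∀ t s : ℝ, |s| * K ≤ 1 → ∀ z ∈ closedStrip ρ,
      ‖SC q₀ c n (t + s) z - SC q₀ c n t z‖ ≤ ε := by
  obtain ⟨δ, hδ, H⟩ := exists_modulus (SC_continuous h) (fun m e =>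
    ⟨intIncl e + intIncl ((HInt q₀ c n).symm (m, 0)), fun t z => by
      simp only [SC_time_add_int h, SC_add_int h, add_assoc]⟩) ρ hε
  obtain ⟨K, hK⟩ := exists_nat_gt (1 / δ)
  refine ⟨K, fun t s hs => H t s ?_⟩
  have h1 : 1 < K * δ := by rwa [div_lt_iff₀ hδ] at hK
  by_contra! hlt
  have : 0 < (K : ℝ) := lt_trans (by positivity) hK
  nlinarith

/-- The commutation of `h_{n+1}` with `φ^{1/q_n}` on the torus. -/
lemma ST_succ (h : ∀ i < n + 1, TameAt q₀ c i) (m : ℤ) :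
    ST q₀ c (n + 1) (m / (q q₀ c n : ℝ)) = ST q₀ c n (m / (q q₀ c n : ℝ)) := by
  ext1 x
  obtain ⟨x, rfl⟩ := proj_surjective x
  rw [ST_proj h, ST_proj fun i hi => h i (by omega)]
  have := SC_succ h m (incl x)
  rw [SC_incl h, SC_incl fun i hi => h i (by omega)] at this
  have h2 : SP q₀ c (n + 1) (m / (q q₀ c n : ℝ)) x
      = ((SP q₀ c n (m / (q q₀ c n : ℝ)) x).1 + (0 : ℤ),
        (SP q₀ c n (m / (q q₀ c n : ℝ)) x).2 + (-m : ℤ)) := by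
    simp only [incl, Prod.ext_iff, Prod.fst_sub, Prod.snd_sub, sub_zero, Complex.ofReal_inj] at this
    ext
    · simpa using this.1
    · have h3 := this.2
      have h4 := congrArg Complex.re h3
      simpa [sub_eq_add_neg] using h4
  rw [h2, proj_add_int]

end Flow

/-! ### Separately holomorphic continuous functions on `ℂ²` are analytic -/

/-- A continuous family of holomorphic functions is an analytic function with values in the space
of continuous functions. -/
lemma analyticAt_of_eval {X : Type*} [TopologicalSpace X] [CompactSpace X] {Φ : ℂ → C(X, ℂ)}
    (hc : Continuous Φ) (hd : ∀ x, Differentiable ℂ fun z => Φ z x) (a : ℂ) :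
    AnalyticAt ℂ Φ a := by
  have hi : CircleIntegrable Φ a ((1 : NNReal) : ℝ) := hc.continuousOn.circleIntegrable (by simp)
  -- The Cauchy integral, taken in the Banach space `C(X, ℂ)`, has a power series. Evaluation at
  -- each point commutes with the integral and identifies it with `Φ` by the scalar Cauchy formula.
  have hs := hasFPowerSeriesOn_cauchy_integral hi one_pos
  refine hs.analyticAt.congr ?_
  filter_upwards [Metric.ball_mem_nhds a one_pos] with w hw
  ext x
  have h1 := (hd x).diffContOnCl (s := Metric.ball a 1) |>.two_pi_i_inv_smul_circleIntegral_sub_inv_smul hw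
  rw [← h1, ContinuousMap.smul_apply]
  congr 1
  have hw' : ∀ θ, circleMap a 1 θ ≠ w := fun θ h => by
    have := circleMap_mem_sphere a zero_le_one θ
    rw [h] at this
    simp only [Metric.mem_sphere] at this
    simp only [Metric.mem_ball] at hw
    linarith
  have hcont : Continuous fun θ => deriv (circleMap a 1) θ •
      (circleMap a 1 θ - w)⁻¹ • Φ (circleMap a 1 θ) := by
    have c1 : Continuous fun θ => (circleMap a 1 θ - w)⁻¹ :=
      ((continuous_circleMap a 1).sub continuous_const).inv₀ fun θ => sub_ne_zero.2 (hw' θ)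
    have c2 : Continuous fun θ => deriv (circleMap a 1) θ := by
      simp only [deriv_circleMap]; fun_prop
    exact c2.smul (c1.smul (hc.comp (continuous_circleMap a 1)))
  have := (ContinuousMap.evalCLM ℂ x : C(X, ℂ) →L[ℂ] ℂ).intervalIntegral_comp_comm
    (hcont.intervalIntegrable (μ := volume) 0 (2 * Real.pi))
  simpa [circleIntegral] using this.symm

/-- Integration over a compact space as a continuous linear functional. -/
def integralCLM (X : Type*) [TopologicalSpace X] [CompactSpace X] [MeasurableSpace X]
    [BorelSpace X] (μ : Measure X) [IsFiniteMeasure μ] : C(X, ℂ) →L[ℂ] ℂ :=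
  LinearMap.mkContinuous
    { toFun := fun f => ∫ x, f x ∂μ
      map_add' := fun f g => integral_add
        (f.continuous.integrable_of_hasCompactSupport (HasCompactSupport.of_compactSpace _))
        (g.continuous.integrable_of_hasCompactSupport (HasCompactSupport.of_compactSpace _))
      map_smul' := fun r f => integral_const_mul r _ }
    (μ.real Set.univ) fun f => by
      have := norm_integral_le_of_norm_le_const (μ := μ)
        (Eventually.of_forall fun x => f.norm_coe_le_norm x)
      rw [mul_comm]; exact this

lemma integralCLM_apply {X : Type*} [TopologicalSpace X] [CompactSpace X] [MeasurableSpace X]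
    [BorelSpace X] (μ : Measure X) [IsFiniteMeasure μ] (f : C(X, ℂ)) :
    integralCLM X μ f = ∫ x, f x ∂μ := rfl

/-- Osgood's lemma in two variables. -/
lemma analyticAt_of_separately {f : ℂ × ℂ → ℂ} (hc : Continuous f)
    (h1 : ∀ w, Differentiable ℂ fun z => f (z, w)) (h2 : ∀ z, Differentiable ℂ fun w => f (z, w))
    (a : ℂ × ℂ) : AnalyticAt ℂ f a := by
  -- Cauchy's formula in the second variable writes `f (z, w)` as the integral over `I` of the
  -- kernel `v / (u - w)` times `f (z, ·)` on the circle. Both factors are analytic with values in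
  -- `C(I, ℂ)`, the kernel as an inverse in a Banach algebra, and integration is a continuous linear
  -- functional.
  let I := Set.Icc (0 : ℝ) (2 * Real.pi)
  let μ : Measure I := Measure.comap Subtype.val volume
  have : IsFiniteMeasure μ := ⟨by
    rw [comap_subtype_coe_apply measurableSet_Icc, Set.image_univ, Subtype.range_coe]
    exact measure_Icc_lt_top⟩
  let F : C(ℂ, C(I, ℂ)) :=
    ContinuousMap.curry ⟨fun x => f (x.1, circleMap a.2 1 x.2), by fun_prop⟩
  have hF : ∀ z (θ : I), F z θ = f (z, circleMap a.2 1 θ) := fun _ _ => rfl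
  have hFa : AnalyticAt ℂ F a.1 :=
    analyticAt_of_eval F.continuous (fun θ => h1 (circleMap a.2 1 θ)) a.1
  let u : C(I, ℂ) := ⟨fun θ => circleMap a.2 1 θ, by fun_prop⟩
  let v : C(I, ℂ) := ⟨fun θ => deriv (circleMap a.2 1) θ, by
    simp only [deriv_circleMap]; fun_prop⟩
  have hne : ∀ w ∈ Metric.ball a.2 1, ∀ θ : ℝ, circleMap a.2 1 θ - w ≠ 0 := fun w hw θ h => by
    have := circleMap_mem_sphere a.2 zero_le_one θ
    rw [sub_eq_zero.1 h] at this
    simp only [Metric.mem_sphere] at this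
    simp only [Metric.mem_ball] at hw
    linarith
  have hinv : ∀ w ∈ Metric.ball a.2 1, ∃ U : (C(I, ℂ))ˣ,
      (U : C(I, ℂ)) = u - algebraMap ℂ C(I, ℂ) w ∧
      ∀ θ : I, (Ring.inverse (u - algebraMap ℂ C(I, ℂ) w)) θ = (circleMap a.2 1 θ - w)⁻¹ := by
    intro w hw
    let g : C(I, ℂ) := ⟨fun θ => (circleMap a.2 1 θ - w)⁻¹,
      Continuous.inv₀ (by fun_prop) fun θ => hne w hw θ⟩
    have hg : (u - algebraMap ℂ C(I, ℂ) w) * g = 1 := by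
      ext θ; exact mul_inv_cancel₀ (hne w hw θ)
    let U : (C(I, ℂ))ˣ := ⟨u - algebraMap ℂ C(I, ℂ) w, g, hg, by rw [mul_comm, hg]⟩
    refine ⟨U, rfl, fun θ => ?_⟩
    rw [show u - algebraMap ℂ C(I, ℂ) w = (U : C(I, ℂ)) from rfl, Ring.inverse_unit]
    rfl
  have hK : AnalyticAt ℂ (fun w => v * Ring.inverse (u - algebraMap ℂ C(I, ℂ) w)) a.2 := by
    obtain ⟨U, hU, -⟩ := hinv a.2 (Metric.mem_ball_self one_pos)
    have hin := analyticAt_inverse (𝕜 := ℂ) U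
    rw [hU] at hin
    have hsub : AnalyticAt ℂ (fun w : ℂ => u - algebraMap ℂ C(I, ℂ) w) a.2 :=
      analyticAt_const.sub ((Algebra.linearMap ℂ C(I, ℂ)).toContinuousLinearMap.analyticAt a.2)
    exact analyticAt_const.mul (AnalyticAt.comp (g := Ring.inverse) hin hsub)
  have htot : AnalyticAt ℂ (fun z : ℂ × ℂ => (2 * Real.pi * Complex.I : ℂ)⁻¹ *
      integralCLM I μ (v * Ring.inverse (u - algebraMap ℂ C(I, ℂ) z.2) * F z.1)) a := by
    refine analyticAt_const.mul (((integralCLM I μ).analyticAt _).comp ?_)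
    exact (hK.comp (f := fun z : ℂ × ℂ => z.2) analyticAt_snd).mul
      (hFa.comp (f := fun z : ℂ × ℂ => z.1) analyticAt_fst)
  refine htot.congr ?_
  have hnear : ∀ᶠ z : ℂ × ℂ in 𝓝 a, z.2 ∈ Metric.ball a.2 1 :=
    continuous_snd.continuousAt.eventually (Metric.ball_mem_nhds a.2 one_pos)
  filter_upwards [hnear] with z hz
  have hcau := (h2 z.1).diffContOnCl (s := Metric.ball a.2 1)
    |>.two_pi_i_inv_smul_circleIntegral_sub_inv_smul hz
  obtain ⟨-, -, hi⟩ := hinv z.2 hz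
  rw [show f z = f (z.1, z.2) from rfl, ← hcau, integralCLM_apply, smul_eq_mul, circleIntegral,
    intervalIntegral.integral_of_le (by positivity), ← integral_Icc_eq_integral_Ioc,
    ← integral_subtype_comap measurableSet_Icc]
  congr 1
  refine integral_congr_ae (Eventually.of_forall fun θ => ?_)
  simp only [ContinuousMap.mul_apply, hi, hF, smul_eq_mul, mul_assoc]
  rfl

/-! ### Limits of entire maps converging on all strips -/

lemma closedStrip_mono {a b : ℝ} (h : a ≤ b) : closedStrip a ⊆ closedStrip b :=
  fun _ hz => ⟨hz.1.trans h, hz.2.trans h⟩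

lemma isOpen_strip (ρ : ℝ) : IsOpen (strip ρ) :=
  (isOpen_lt (Complex.continuous_im.comp continuous_fst).abs continuous_const).inter
    (isOpen_lt (Complex.continuous_im.comp continuous_snd).abs continuous_const)

lemma strip_subset_closedStrip {a b : ℝ} (h : a ≤ b) : strip a ⊆ closedStrip b :=
  fun _ hz => ⟨(hz.1.trans_le h).le, (hz.2.trans_le h).le⟩

lemma incl_mem_closedStrip (n : ℕ) (x : ℝ × ℝ) : incl x ∈ closedStrip n := by
  simp [closedStrip, incl]

lemma exists_mem_strip (z : ℂ × ℂ) : ∃ N : ℕ, z ∈ strip N := by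
  obtain ⟨N, hN⟩ := exists_nat_gt (max |z.1.im| |z.2.im|)
  exact ⟨N, (le_max_left _ _).trans_lt hN, (le_max_right _ _).trans_lt hN⟩

lemma tendsto_two_div_pow : Tendsto (fun n : ℕ => (2 : ℝ) / 2 ^ n) atTop (𝓝 0) :=
  tendsto_const_nhds.div_atTop (tendsto_pow_atTop_atTop_of_one_lt one_lt_two)

lemma exists_lim_of_geometric {E : Type*} [MetricSpace E] [CompleteSpace E] {u : ℕ → E} {N : ℕ}
    (hu : ∀ n ≥ N, dist (u n) (u (n + 1)) ≤ 1 / 2 ^ n) : ∃ a, Tendsto u atTop (𝓝 a) := by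
  have h : ∀ m, dist (u (m + N)) (u (m + 1 + N)) ≤ (2 / 2 ^ N) / 2 / 2 ^ m := fun m => by
    have := hu (m + N) (by omega)
    rw [show m + 1 + N = m + N + 1 by ring]
    refine this.trans (le_of_eq ?_)
    rw [pow_add]; field_simp
  obtain ⟨a, ha⟩ := cauchySeq_tendsto_of_complete (cauchySeq_of_le_geometric_two h)
  exact ⟨a, (tendsto_add_atTop_iff_nat N).1 ha⟩

lemma dist_lim_of_geometric {E : Type*} [MetricSpace E] {u : ℕ → E} {N : ℕ} {a : E}
    (hu : ∀ n ≥ N, dist (u n) (u (n + 1)) ≤ 1 / 2 ^ n) (ha : Tendsto u atTop (𝓝 a)) :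
    dist (u N) a ≤ 2 / 2 ^ N := by
  have h : ∀ m, dist (u (m + N)) (u (m + 1 + N)) ≤ (2 / 2 ^ N) / 2 / 2 ^ m := fun m => by
    have := hu (m + N) (by omega)
    rw [show m + 1 + N = m + N + 1 by ring]
    refine this.trans (le_of_eq ?_)
    rw [pow_add]; field_simp
  have := dist_le_of_le_geometric_two_of_tendsto₀ h ((tendsto_add_atTop_iff_nat N).2 ha)
  simpa using this

/-- The strips exhaust `ℂ²`, so the geometric bounds give locally uniform convergence. Holomorphy on
complex lines passes to the limit, and Osgood's lemma makes the limit jointly analytic. Analyticity,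
not only differentiability, is used for the inverse of `T`. -/
lemma exists_entire_limit {F : ℕ → ℂ × ℂ → ℂ × ℂ} (hd : ∀ n, Differentiable ℂ (F n))
    (hF : ∀ n : ℕ, ∀ z ∈ closedStrip n, ‖F (n + 1) z - F n z‖ ≤ 1 / 2 ^ n) :
    ∃ L : ℂ × ℂ → ℂ × ℂ, (∀ a, AnalyticAt ℂ L a) ∧ (∀ z, Tendsto (F · z) atTop (𝓝 (L z))) ∧
      ∀ n : ℕ, ∀ z ∈ closedStrip n, ‖F n z - L z‖ ≤ 2 / 2 ^ n := by
  have hF' : ∀ N : ℕ, ∀ z ∈ closedStrip N, ∀ n ≥ N,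
      dist (F n z) (F (n + 1) z) ≤ 1 / 2 ^ n := fun N z hz n hn => by
    rw [dist_comm, dist_eq_norm]
    exact hF n z (closedStrip_mono (by exact_mod_cast hn) hz)
  have hex : ∀ z, ∃ a, Tendsto (F · z) atTop (𝓝 a) := fun z => by
    obtain ⟨N, hN⟩ := exists_mem_strip z
    exact exists_lim_of_geometric (hF' N z (strip_subset_closedStrip le_rfl hN))
  choose L hL using hex
  have hdist : ∀ n : ℕ, ∀ z ∈ closedStrip n, ‖F n z - L z‖ ≤ 2 / 2 ^ n := fun n z hz => by
    rw [← dist_eq_norm]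
    exact dist_lim_of_geometric (hF' n z hz) (hL z)
  have hunif : TendstoLocallyUniformly F L atTop := by
    rw [Metric.tendstoLocallyUniformly_iff]
    intro ε hε z
    obtain ⟨N, hN⟩ := exists_mem_strip z
    refine ⟨strip N, (isOpen_strip N).mem_nhds hN, ?_⟩
    filter_upwards [tendsto_two_div_pow.eventually (gt_mem_nhds hε), eventually_ge_atTop N]
      with n hn hNn y hy
    rw [dist_comm, dist_eq_norm]
    exact (hdist n y (strip_subset_closedStrip (by exact_mod_cast hNn) hy)).trans_lt hn
  have hcont : Continuous L :=
    hunif.continuous (Frequently.of_forall fun n => (hd n).continuous)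
  have hcomp : ∀ g : ℂ → ℂ × ℂ, Differentiable ℂ g → Differentiable ℂ fun z => L (g z) := by
    intro g hg
    have h1 : TendstoLocallyUniformlyOn (fun n z => F n (g z)) (fun z => L (g z)) atTop
        Set.univ := by
      rw [tendstoLocallyUniformlyOn_univ]
      exact hunif.comp g hg.continuous
    have := h1.differentiableOn (Eventually.of_forall fun n => ((hd n).comp hg).differentiableOn)
      isOpen_univ
    exact differentiableOn_univ.1 this
  have hz : ∀ w : ℂ, Differentiable ℂ fun z => L (z, w) := fun w => hcomp _ (by fun_prop)
  have hw : ∀ z : ℂ, Differentiable ℂ fun w => L (z, w) := fun z => hcomp _ (by fun_prop)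
  refine ⟨L, fun a => ?_, hL, hdist⟩
  have e1 := analyticAt_of_separately (f := fun z => (L z).1) (by fun_prop)
    (fun w => (hz w).fst) (fun z => (hw z).fst) a
  have e2 := analyticAt_of_separately (f := fun z => (L z).2) (by fun_prop)
    (fun w => (hz w).snd) (fun z => (hw z).snd) a
  exact e1.prod e2

/-! ### The lower bound for `k_n` -/

/-- The construction has the properties used for the convergence: translations by at most `1 / k_n`
are changed little by the conjugation with `H_{n+1}`. -/
structure Controlled (q₀ : ℕ) (c : ℕ → Choice) : Prop where
  tame : ∀ n, TameAt q₀ c n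
  l_pos : ∀ n, 0 < (c n).l
  k_two : ∀ n, 2 ≤ (c n).k
  shift : ∀ n : ℕ, ∀ t s : ℝ, |s| * (c n).k ≤ 1 → ∀ z ∈ closedStrip n,
    ‖SC q₀ c (n + 1) (t + s) z - SC q₀ c (n + 1) t z‖ ≤ 1 / 2 ^ n

/-- The sequence of choices beginning with the given ones. -/
def extend (n : ℕ) (prior : Fin n → Choice) (d : Choice) (i : ℕ) : Choice :=
  if h : i < n then prior ⟨i, h⟩ else d

/-- This and the next two lemmas express that stage `n` depends only on earlier choices, so that a
threshold may refer to it and the construction may proceed by recursion. -/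
lemma q_congr {q₀ : ℕ} {c c' : ℕ → Choice} {n : ℕ} (h : ∀ i < n, c i = c' i) :
    q q₀ c n = q q₀ c' n := by
  induction n with
  | zero => rfl
  | succ n ih => simp only [q, h n (by omega), ih fun i hi => h i (by omega)]

lemma HC_congr {q₀ : ℕ} {c c' : ℕ → Choice} {n : ℕ} (h : ∀ i < n, c i = c' i) :
    HC q₀ c n = HC q₀ c' n := by
  induction n with
  | zero => rfl
  | succ n ih =>
    have h' : ∀ i < n, c i = c' i := fun i hi => h i (by omega)
    simp only [HC, h n (by omega), ih h', q_congr h']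

lemma HPlane_congr {q₀ : ℕ} {c c' : ℕ → Choice} {n : ℕ} (h : ∀ i < n, c i = c' i) :
    HPlane q₀ c n = HPlane q₀ c' n := by
  induction n with
  | zero => rfl
  | succ n ih =>
    have h' : ∀ i < n, c i = c' i := fun i hi => h i (by omega)
    simp only [HPlane, h n (by omega), ih h', q_congr h']

/-- `K` is large enough for the conclusion of `exists_shift_bound` at stage `n`. -/
def ShiftBound (q₀ : ℕ) (c : ℕ → Choice) (n K : ℕ) : Prop :=
  ∀ t s : ℝ, |s| * K ≤ 1 → ∀ z ∈ closedStrip n,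
    ‖SC q₀ c (n + 1) (t + s) z - SC q₀ c (n + 1) t z‖ ≤ 1 / 2 ^ n

open Classical in
/-- The lower bound for `k_n`. -/
def kappa : Threshold := fun _ q₀ n prior l ψ₁ ψ₂ ψ₃ =>
  max 2 (if h : ∃ K, ShiftBound q₀ (extend n prior ⟨l, ψ₁, ψ₂, ψ₃, 0⟩) n K then h.choose else 0)

lemma ShiftBound.mono {q₀ : ℕ} {c : ℕ → Choice} {n K K' : ℕ} (h : ShiftBound q₀ c n K)
    (hK : K ≤ K') : ShiftBound q₀ c n K' := fun t s hs =>
  h t s ((mul_le_mul_of_nonneg_left (by exact_mod_cast hK) (abs_nonneg s)).trans hs)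

lemma ShiftBound_iff_extend {q₀ : ℕ} {c : ℕ → Choice} {n K : ℕ} :
    ShiftBound q₀ (extend n (fun i => c i) ⟨(c n).l, (c n).ψ₁, (c n).ψ₂, (c n).ψ₃, 0⟩) n K
      ↔ ShiftBound q₀ c n K := by
  have h : ∀ i < n,
      extend n (fun i => c i) ⟨(c n).l, (c n).ψ₁, (c n).ψ₂, (c n).ψ₃, 0⟩ i = c i :=
    fun i hi => by simp [extend, hi]
  have hHC : HC q₀ (extend n (fun i => c i) ⟨(c n).l, (c n).ψ₁, (c n).ψ₂, (c n).ψ₃, 0⟩) (n + 1)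
      = HC q₀ c (n + 1) := by
    simp only [HC, HC_congr h, q_congr h]
    simp [extend]
  simp only [ShiftBound, SC_apply, hHC]

lemma shiftBound_of_largeK {p₀ q₀ : ℕ} {c : ℕ → Choice} (hk : LargeK kappa p₀ q₀ c)
    (ht : ∀ n, TameAt q₀ c n) (n : ℕ) : ShiftBound q₀ c n (c n).k := by
  obtain ⟨K, hK⟩ := exists_shift_bound (n := n + 1) (fun i _ => ht i) (n : ℝ)
    (show (0 : ℝ) < 1 / 2 ^ n by positivity)
  have hex : ∃ K, ShiftBound q₀ (extend n (fun i => c i)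
      ⟨(c n).l, (c n).ψ₁, (c n).ψ₂, (c n).ψ₃, 0⟩) n K := ⟨K, ShiftBound_iff_extend.2 hK⟩
  have h := hk n
  simp only [kappa, dif_pos hex] at h
  exact (ShiftBound_iff_extend.1 hex.choose_spec).mono ((le_max_right _ _).trans h)

lemma two_le_k {p₀ q₀ : ℕ} {c : ℕ → Choice} (hk : LargeK kappa p₀ q₀ c) (n : ℕ) :
    2 ≤ (c n).k := (le_max_left _ _).trans (hk n)

lemma Admissible.l_pos {q₀ : ℕ} {c : ℕ → Choice} (h : Admissible q₀ c) (n : ℕ) : 0 < (c n).l := by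
  have := h.l_large n
  rcases Nat.eq_zero_or_pos (c n).l with h0 | h0
  · simp [h0] at this
  · exact h0

lemma q_pos_of {q₀ : ℕ} {c : ℕ → Choice} (h0 : 0 < q₀) {n : ℕ} (hl : ∀ i < n, 0 < (c i).l)
    (hk : ∀ i < n, 0 < (c i).k) : 0 < q q₀ c n := by
  induction n with
  | zero => exact h0
  | succ n ih =>
    have h1 := ih (fun i hi => hl i (by omega)) (fun i hi => hk i (by omega))
    have h2 := hl n (by omega)
    have h3 := hk n (by omega)
    simp only [q]; positivity

lemma periodic_one_of {s : ℂ → ℂ} {N : ℕ} (hN : 0 < N) (h : ∀ z, s (z + 1 / (N : ℂ)) = s z)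
    {M : ℕ} (hM : M ∣ N) (z : ℂ) : s (z + 1 / (M : ℂ)) = s z := by
  obtain ⟨d, rfl⟩ := hM
  have hM : (M : ℂ) ≠ 0 := by
    rintro h; simp only [Nat.cast_eq_zero] at h; simp [h] at hN
  have hd : (d : ℂ) ≠ 0 := by
    rintro h; simp only [Nat.cast_eq_zero] at h; simp [h] at hN
  have := (show Function.Periodic s (1 / ((M * d : ℕ) : ℂ)) from h).nat_mul d z
  convert this using 3
  push_cast; field_simp

/-- The choice at stage `n` satisfies the requirements on the step functions. -/
structure StepAt (l q : ℕ) (ψ₁ ψ₂ ψ₃ : ℂ → ℂ) : Prop where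
  approx₁ : ApproxStep l 1
    (fun i => if i = 0 then 0 else ((l : ℝ) - i) / ((l : ℝ) ^ 2 * (q : ℝ)))
    (precision l q / 3) (precision l q) ψ₁
  approx₂ : ApproxStep l (l * q) (fun i => (i : ℝ) / (l : ℝ))
    (precision l q / 3) (precision l q) ψ₂
  approx₃ : ApproxStep l 1 (fun i => (i : ℝ) / ((l : ℝ) ^ 2 * (q : ℝ)))
    (precision l q / 3) (precision l q) ψ₃

lemma StepAt.tameAt {q₀ : ℕ} {c : ℕ → Choice} {n : ℕ}
    (h : StepAt (c n).l (q q₀ c n) (c n).ψ₁ (c n).ψ₂ (c n).ψ₃)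
    (hl : 0 < (c n).l) (hq : 0 < q q₀ c n) : TameAt q₀ c n where
  entire₁ := h.approx₁.entire
  entire₂ := h.approx₂.entire
  entire₃ := h.approx₃.entire
  real₁ := h.approx₁.real
  real₂ := h.approx₂.real
  real₃ := h.approx₃.real
  periodic₁ z := by simpa using h.approx₁.periodic z
  periodic₂ z := by
    simpa using periodic_one_of (Nat.mul_pos hl hq) h.approx₂.periodic (one_dvd _) z
  periodic₃ z := by simpa using h.approx₃.periodic z
  periodic_q := periodic_one_of (Nat.mul_pos hl hq) h.approx₂.periodic (dvd_mul_left _ _)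
  q_pos := hq

lemma Admissible.stepAt {q₀ : ℕ} {c : ℕ → Choice} (h : Admissible q₀ c) (n : ℕ) :
    StepAt (c n).l (q q₀ c n) (c n).ψ₁ (c n).ψ₂ (c n).ψ₃ :=
  ⟨h.approx₁ n, h.approx₂ n, h.approx₃ n⟩

lemma Admissible.controlled {p₀ q₀ : ℕ} {c : ℕ → Choice} (h : Admissible q₀ c) (h0 : 0 < q₀)
    (hk : LargeK kappa p₀ q₀ c) : Controlled q₀ c := by
  have ht : ∀ n, TameAt q₀ c n := fun n => (h.stepAt n).tameAt (h.l_pos n)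
    (q_pos_of h0 (fun i _ => h.l_pos i) fun i _ => by have := two_le_k hk i; omega)
  exact ⟨ht, h.l_pos, two_le_k hk, shiftBound_of_largeK hk ht⟩

/-! ### Maps of the torus and their lifts -/

lemma isOpenQuotientMap_proj : IsOpenQuotientMap proj := by
  have h : IsOpenQuotientMap ((↑) : ℝ → UnitAddCircle) := QuotientAddGroup.isOpenQuotientMap_mk
  exact h.prodMap h

lemma continuous_proj : Continuous proj := isOpenQuotientMap_proj.continuous

lemma continuous_incl : Continuous incl := by unfold incl; fun_prop

lemma coe_circle_eq_iff {x y : ℝ} :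
    (x : UnitAddCircle) = y ↔ ∃ m : ℤ, x = y + m := by
  rw [← sub_eq_zero, ← AddCircle.coe_sub, AddCircle.coe_eq_zero_iff]
  simp only [zsmul_eq_mul, mul_one]
  exact exists_congr fun m => ⟨fun h => by linarith, fun h => by linarith⟩

lemma exists_incl_add_of_proj_eq {x y : ℝ × ℝ} (h : proj x = proj y) :
    ∃ e : ℤ × ℤ, incl x = incl y + intIncl e := by
  obtain ⟨a, ha⟩ := coe_circle_eq_iff.1 (Prod.ext_iff.1 h).1
  obtain ⟨b, hb⟩ := coe_circle_eq_iff.1 (Prod.ext_iff.1 h).2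
  refine ⟨(a, b), ?_⟩
  ext <;> simp [incl, ha, hb]

lemma norm_coe_circle_le (x : ℝ) : ‖(x : UnitAddCircle)‖ ≤ |x| := by
  rw [UnitAddCircle.norm_eq]
  simpa using round_le x 0

lemma dist_proj_le (x y : ℝ × ℝ) : dist (proj x) (proj y) ≤ dist x y := by
  have h : ∀ a b : ℝ, dist (a : UnitAddCircle) b ≤ dist a b := fun a b => by
    rw [dist_eq_norm, ← AddCircle.coe_sub, Real.dist_eq]; exact norm_coe_circle_le _
  exact max_le_max (h _ _) (h _ _)

/-- The real part of a map of `ℂ²`, on `ℝ²`. -/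
def rePart (L : ℂ × ℂ → ℂ × ℂ) (x : ℝ × ℝ) : ℝ × ℝ := ((L (incl x)).1.re, (L (incl x)).2.re)

/-- `L` is an entire map of `ℂ²` that commutes with integer translations and preserves `ℝ²`. -/
structure IsEntireLift (L : ℂ × ℂ → ℂ × ℂ) : Prop where
  differentiable : Differentiable ℂ L
  add_int : ∀ z e, L (z + intIncl e) = L z + intIncl e
  real : ∀ x, L (incl x) = incl (rePart L x)

lemma rePart_incl {L : ℂ × ℂ → ℂ × ℂ} {x y : ℝ × ℝ} (h : L (incl x) = incl y) :
    rePart L x = y := by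
  rw [rePart, h]; simp [incl]

lemma dist_rePart_le (L M : ℂ × ℂ → ℂ × ℂ) (x : ℝ × ℝ) :
    dist (rePart L x) (rePart M x) ≤ ‖L (incl x) - M (incl x)‖ := by
  refine max_le_max ?_ ?_
  · rw [Real.dist_eq, rePart, rePart, ← Complex.sub_re]; exact Complex.abs_re_le_norm _
  · rw [Real.dist_eq, rePart, rePart, ← Complex.sub_re]; exact Complex.abs_re_le_norm _

namespace IsEntireLift

variable {L M : ℂ × ℂ → ℂ × ℂ} (hL : IsEntireLift L)
include hL

lemma continuous_rePart : Continuous (rePart L) := by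
  have h := hL.differentiable.continuous.comp continuous_incl
  exact (Complex.continuous_re.comp (continuous_fst.comp h)).prodMk
    (Complex.continuous_re.comp (continuous_snd.comp h))

lemma proj_rePart_congr {x y : ℝ × ℝ} (h : proj x = proj y) :
    proj (rePart L x) = proj (rePart L y) := by
  obtain ⟨e, he⟩ := exists_incl_add_of_proj_eq h
  have : rePart L x = ((rePart L y).1 + e.1, (rePart L y).2 + e.2) := by
    apply rePart_incl
    rw [he, hL.add_int, hL.real]
    ext <;> simp [incl]
  rw [this, proj_add_int]

lemma exists_bound (ρ : ℝ) : ∃ C, ∀ z ∈ closedStrip ρ, ‖L z - z‖ ≤ C :=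
  exists_bound_of_periodic (f := fun z => L z - z)
    (hL.differentiable.continuous.sub continuous_id)
    (fun z e => by simp only [hL.add_int, add_sub_add_right_eq_sub]) ρ

lemma isAnalyticRho (ρ : ℝ) :
    IsAnalyticRho ρ (fun z => (L z).1 - z.1) ∧ IsAnalyticRho ρ (fun z => (L z).2 - z.2) := by
  obtain ⟨C, hC⟩ := hL.exists_bound ρ
  have hb : ∀ f : ℂ × ℂ → ℂ, (∀ z, ‖f z‖ ≤ ‖L z - z‖) → normRho ρ f < ⊤ := fun f hf => by
    refine lt_of_le_of_lt (iSup₂_le fun z hz => ?_) (ENNReal.ofReal_lt_top (r := C))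
    rw [← ofReal_norm]
    exact ENNReal.ofReal_le_ofReal ((hf z).trans (hC z (strip_subset_closedStrip le_rfl hz)))
  have h1 : ∀ z : ℂ × ℂ, (z.1 + 1, z.2) = z + intIncl (1, 0) := fun z => by ext <;> simp
  have h2 : ∀ z : ℂ × ℂ, (z.1, z.2 + 1) = z + intIncl (0, 1) := fun z => by ext <;> simp
  have hd := hL.differentiable
  refine ⟨⟨?_, hb _ fun z => norm_fst_le (L z - z), ?_, ?_, ?_⟩,
    ⟨?_, hb _ fun z => norm_snd_le (L z - z), ?_, ?_, ?_⟩⟩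
  · exact (hd.fst.sub differentiable_fst).differentiableOn
  · intro z _
    simp only [h1, hL.add_int]
    simp
  · intro z _
    simp only [h2, hL.add_int]
    simp
  · intro x
    simp only [hL.real]
    simp [incl]
  · exact (hd.snd.sub differentiable_snd).differentiableOn
  · intro z _
    simp only [h1, hL.add_int]
    simp
  · intro z _
    simp only [h2, hL.add_int]
    simp
  · intro x
    simp only [hL.real]
    simp [incl]

lemma isLift {F : T2 → T2} (hF : ∀ x, F (proj x) = proj (rePart L x)) (ρ : ℝ) :
    IsLift ρ F (fun z => (L z).1 - z.1) (fun z => (L z).2 - z.2) := by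
  refine ⟨(hL.isAnalyticRho ρ).1, (hL.isAnalyticRho ρ).2, fun x => ?_⟩
  rw [hF]
  simp [rePart, incl]

/-- The distance is an infimum over lifts and integers, so one pair of lifts and the integer `0`
suffice. -/
lemma distRho_le (hM : IsEntireLift M) {F G : T2 → T2} (hF : ∀ x, F (proj x) = proj (rePart L x))
    (hG : ∀ x, G (proj x) = proj (rePart M x)) {ρ C : ℝ}
    (hC : ∀ z ∈ closedStrip ρ, ‖L z - M z‖ ≤ C) : distRho ρ F G ≤ ENNReal.ofReal C := by
  refine iInf_le_of_le (fun z => (L z).1 - z.1) <| iInf_le_of_le (fun z => (L z).2 - z.2) <|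
    iInf_le_of_le (fun z => (M z).1 - z.1) <| iInf_le_of_le (fun z => (M z).2 - z.2) <|
    iInf_le_of_le (hL.isLift hF ρ) <| iInf_le_of_le (hM.isLift hG ρ) ?_
  refine max_le (iInf_le_of_le 0 <| iSup₂_le fun z hz => ?_)
    (iInf_le_of_le 0 <| iSup₂_le fun z hz => ?_)
  · rw [← ofReal_norm]
    refine ENNReal.ofReal_le_ofReal (le_trans ?_ (hC z (strip_subset_closedStrip le_rfl hz)))
    simpa using norm_fst_le (L z - M z)
  · rw [← ofReal_norm]
    refine ENNReal.ofReal_le_ofReal (le_trans ?_ (hC z (strip_subset_closedStrip le_rfl hz)))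
    simpa using norm_snd_le (L z - M z)

/-- Mutually inverse entire lifts descend to a homeomorphism of the torus. -/
lemma exists_homeomorph (hM : IsEntireLift M) (hLM : ∀ z, L (M z) = z) (hML : ∀ z, M (L z) = z) :
    ∃ T : T2 ≃ₜ T2, (∀ x, T (proj x) = proj (rePart L x)) ∧
      ∀ x, T.symm (proj x) = proj (rePart M x) := by
  -- The map is defined through an arbitrary section of `proj`. Equivariance shows that the section
  -- does not matter, and continuity is then tested on the plane because `proj` is a quotient map.
  let σ := Function.surjInv proj_surjective
  have hσ : ∀ x, proj (σ x) = x := Function.surjInv_eq proj_surjective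
  have h1 : ∀ x, proj (rePart L (σ (proj x))) = proj (rePart L x) := fun x =>
    hL.proj_rePart_congr (hσ _)
  have h2 : ∀ x, proj (rePart M (σ (proj x))) = proj (rePart M x) := fun x =>
    hM.proj_rePart_congr (hσ _)
  have h3 : ∀ x, rePart L (rePart M x) = x := fun x =>
    rePart_incl (by rw [← hM.real, hLM])
  have h4 : ∀ x, rePart M (rePart L x) = x := fun x =>
    rePart_incl (by rw [← hL.real, hML])
  refine ⟨⟨⟨fun x => proj (rePart L (σ x)), fun x => proj (rePart M (σ x)), fun x => ?_,
    fun x => ?_⟩, ?_, ?_⟩, h1, h2⟩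
  · simp only [h2, h4, hσ]
  · simp only [h1, h3, hσ]
  · refine isOpenQuotientMap_proj.isQuotientMap.continuous_iff.2 ?_
    exact (continuous_proj.comp hL.continuous_rePart).congr fun x => (h1 x).symm
  · refine isOpenQuotientMap_proj.isQuotientMap.continuous_iff.2 ?_
    exact (continuous_proj.comp hM.continuous_rePart).congr fun x => (h2 x).symm

end IsEntireLift

lemma analyticOnNhd_rePart {L : ℂ × ℂ → ℂ × ℂ} (h : ∀ a, AnalyticAt ℂ L a) :
    AnalyticOnNhd ℝ (rePart L) Set.univ := by
  intro x _
  let J : ℝ × ℝ →L[ℝ] ℂ × ℂ := Complex.ofRealCLM.prodMap Complex.ofRealCLM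
  let R : ℂ × ℂ →L[ℝ] ℝ × ℝ := Complex.reCLM.prodMap Complex.reCLM
  have h1 : AnalyticAt ℝ L (J x) := (h (J x)).restrictScalars
  exact (R.analyticAt _).comp (h1.comp (J.analyticAt x))

/-- Limits of mutually inverse maps that converge on all strips are mutually inverse. -/
lemma limit_comp_limit {F G : ℕ → ℂ × ℂ → ℂ × ℂ} {L M : ℂ × ℂ → ℂ × ℂ} (hLc : Continuous L)
    (hL : ∀ n : ℕ, ∀ z ∈ closedStrip n, ‖F n z - L z‖ ≤ 2 / 2 ^ n)
    (hM : ∀ z, Tendsto (G · z) atTop (𝓝 (M z))) (hFG : ∀ n z, F n (G n z) = z) (z : ℂ × ℂ) :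
    L (M z) = z := by
  have h1 : Tendsto (fun n => L (G n z)) atTop (𝓝 (L (M z))) :=
    (hLc.tendsto _).comp (hM z)
  obtain ⟨N, hN⟩ := exists_mem_strip (M z)
  -- The points `G n z` eventually lie in a fixed strip around `M z`; there `F n` is within `2 / 2 ^
  -- n` of `L`, and `F n (G n z) = z`.
  have h2 : Tendsto (fun n => z - L (G n z)) atTop (𝓝 0) := by
    rw [tendsto_zero_iff_norm_tendsto_zero]
    refine squeeze_zero' (Eventually.of_forall fun _ => norm_nonneg _) ?_ tendsto_two_div_pow
    filter_upwards [(hM z).eventually ((isOpen_strip N).mem_nhds hN), eventually_ge_atTop N]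
      with n hn hNn
    have := hL n (G n z) (strip_subset_closedStrip (by exact_mod_cast hNn) hn)
    rwa [hFG] at this
  have h3 := h2.add h1
  simp only [sub_add_cancel, zero_add] at h3
  exact tendsto_nhds_unique h3 tendsto_const_nhds

/-! ### Convergence of the construction -/

section Convergence

variable {q₀ : ℕ} {c : ℕ → Choice}

/-- Splits off a multiple of `1 / q_n`, at which consecutive flows agree; the cast through `ℤ`
matches the time in `SC_succ`. -/
lemma alpha_succ (h : Controlled q₀ c) (p₀ n : ℕ) :
    alpha p₀ q₀ c (n + 1)
      = ((p p₀ c n : ℤ) : ℝ) / (q q₀ c n : ℝ) + 1 / (q q₀ c (n + 1) : ℝ) := by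
  have h1 : (q q₀ c n : ℝ) ≠ 0 := by exact_mod_cast (h.tame n).q_pos.ne'
  have h2 : ((c n).k : ℝ) ≠ 0 := by have := h.k_two n; exact_mod_cast (by omega)
  have h3 : ((c n).l : ℝ) ≠ 0 := by exact_mod_cast (h.l_pos n).ne'
  simp only [alpha, p, q]
  push_cast
  field_simp

/-- The iterates up to `q_n` change the time by at most `1 / k_n`. -/
lemma time_le (h : Controlled q₀ c) (n : ℕ) {i : ℕ} (hi : i ≤ q q₀ c n) :
    |(i : ℝ) / (q q₀ c (n + 1) : ℝ)| * (c n).k ≤ 1 := by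
  have h1 : (0 : ℝ) < q q₀ c n := by exact_mod_cast (h.tame n).q_pos
  have h2 : (0 : ℝ) < (c n).k := by have := h.k_two n; exact_mod_cast (by omega)
  have h3 : (1 : ℝ) ≤ (c n).l := by exact_mod_cast h.l_pos n
  have hi' : (i : ℝ) ≤ q q₀ c n := by exact_mod_cast hi
  simp only [q]
  push_cast
  rw [abs_of_nonneg (by positivity), div_mul_eq_mul_div, div_le_one (by positivity)]
  have h4 : (1 : ℝ) ≤ (c n).l ^ 2 := one_le_pow₀ h3
  nlinarith [mul_pos h2 h1]

/-- The lifts of `T_n` that converge. -/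
def liftT (p₀ q₀ : ℕ) (c : ℕ → Choice) (n : ℕ) (z : ℂ × ℂ) : ℂ × ℂ :=
  SC q₀ c n (alpha p₀ q₀ c n) z + intIncl (0, ∑ j ∈ Finset.range n, (p p₀ c j : ℤ))

/-- The lifts of `T_n⁻¹` that converge. -/
def liftTInv (p₀ q₀ : ℕ) (c : ℕ → Choice) (n : ℕ) (z : ℂ × ℂ) : ℂ × ℂ :=
  SC q₀ c n (-alpha p₀ q₀ c n) z + intIncl (0, -∑ j ∈ Finset.range n, (p p₀ c j : ℤ))

lemma isEntireLift_SC (h : Controlled q₀ c) (n : ℕ) (t : ℝ) (m : ℤ) :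
    IsEntireLift fun z => SC q₀ c n t z + intIncl (0, m) := by
  refine ⟨(SC_differentiable (fun i _ => h.tame i) t).add_const _, fun z e => ?_, fun x => ?_⟩
  · rw [SC_add_int fun i _ => h.tame i]; abel
  · simp only [rePart, SC_incl (fun i _ => h.tame i)]
    ext <;> simp [incl]

lemma proj_rePart_SC (h : Controlled q₀ c) (n : ℕ) (t : ℝ) (m : ℤ) (x : ℝ × ℝ) :
    ST q₀ c n t (proj x) = proj (rePart (fun z => SC q₀ c n t z + intIncl (0, m)) x) := by
  have : rePart (fun z => SC q₀ c n t z + intIncl (0, m)) x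
      = ((SP q₀ c n t x).1 + (0 : ℤ), (SP q₀ c n t x).2 + m) := by
    apply rePart_incl
    rw [SC_incl (fun i _ => h.tame i)]
    ext <;> simp [incl]
  rw [this, proj_add_int, ST_proj fun i _ => h.tame i]

/-- The new summand `p_n` of the lift cancels the vertical translation of `SC_succ` at time `p_n /
q_n`; the remaining time `1 / q_{n+1}` is at most `1 / k_n` and falls under the shift bound. -/
lemma liftT_sub (h : Controlled q₀ c) (p₀ n : ℕ) (z : ℂ × ℂ) (hz : z ∈ closedStrip n) :
    ‖liftT p₀ q₀ c (n + 1) z - liftT p₀ q₀ c n z‖ ≤ 1 / 2 ^ n := by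
  have ht : ∀ i < n + 1, TameAt q₀ c i := fun i _ => h.tame i
  have h1 := SC_succ ht (p p₀ c n) z
  have h2 := h.shift n (((p p₀ c n : ℤ) : ℝ) / (q q₀ c n : ℝ)) (1 / (q q₀ c (n + 1) : ℝ))
    (by simpa using time_le h n (i := 1) (h.tame n).q_pos) z hz
  rw [← alpha_succ h, h1] at h2
  convert h2 using 2
  simp only [liftT, Finset.sum_range_succ]
  ext
  · simp [alpha]
  · simp [alpha]; ring

lemma liftTInv_sub (h : Controlled q₀ c) (p₀ n : ℕ) (z : ℂ × ℂ) (hz : z ∈ closedStrip n) :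
    ‖liftTInv p₀ q₀ c (n + 1) z - liftTInv p₀ q₀ c n z‖ ≤ 1 / 2 ^ n := by
  have ht : ∀ i < n + 1, TameAt q₀ c i := fun i _ => h.tame i
  have h1 := SC_succ ht (-(p p₀ c n : ℤ)) z
  have h2 := h.shift n (((-(p p₀ c n : ℤ) : ℤ) : ℝ) / (q q₀ c n : ℝ))
    (-(1 / (q q₀ c (n + 1) : ℝ)))
    (by rw [abs_neg]; simpa using time_le h n (i := 1) (h.tame n).q_pos) z hz
  have h3 : ((-(p p₀ c n : ℤ) : ℤ) : ℝ) / (q q₀ c n : ℝ) + -(1 / (q q₀ c (n + 1) : ℝ))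
      = -alpha p₀ q₀ c (n + 1) := by
    rw [alpha_succ h]; push_cast; ring
  rw [h3, h1] at h2
  convert h2 using 2
  simp only [liftTInv, Finset.sum_range_succ]
  ext
  · simp [alpha, neg_div]
  · simp [alpha, neg_div]; ring

lemma liftT_liftTInv (h : Controlled q₀ c) (p₀ n : ℕ) (z : ℂ × ℂ) :
    liftT p₀ q₀ c n (liftTInv p₀ q₀ c n z) = z := by
  have h1 := SC_add (q₀ := q₀) (c := c) (n := n) (alpha p₀ q₀ c n) (-alpha p₀ q₀ c n)
  rw [add_neg_cancel, SC_zero] at h1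
  simp only [liftT, liftTInv]
  rw [SC_add_int fun i _ => h.tame i, ← Equiv.Perm.mul_apply, ← h1]
  ext <;> simp

lemma liftTInv_liftT (h : Controlled q₀ c) (p₀ n : ℕ) (z : ℂ × ℂ) :
    liftTInv p₀ q₀ c n (liftT p₀ q₀ c n z) = z := by
  have h1 := SC_add (q₀ := q₀) (c := c) (n := n) (-alpha p₀ q₀ c n) (alpha p₀ q₀ c n)
  rw [neg_add_cancel, SC_zero] at h1
  simp only [liftT, liftTInv]
  rw [SC_add_int fun i _ => h.tame i, ← Equiv.Perm.mul_apply, ← h1]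
  ext <;> simp

lemma isEntireLift_limit {F : ℕ → ℂ × ℂ → ℂ × ℂ} {L : ℂ × ℂ → ℂ × ℂ}
    (hF : ∀ n, IsEntireLift (F n)) (hd : Differentiable ℂ L)
    (hL : ∀ z, Tendsto (F · z) atTop (𝓝 (L z))) : IsEntireLift L := by
  refine ⟨hd, fun z e => ?_, fun x => ?_⟩
  · refine tendsto_nhds_unique (hL _) (((hL z).add_const (intIncl e)).congr fun n => ?_)
    rw [(hF n).add_int]
  · have h1 : Tendsto (fun n => incl (rePart (F n) x)) atTop (𝓝 (incl (rePart L x))) := by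
      refine (continuous_incl.tendsto _).comp ?_
      have h2 : Continuous fun w : ℂ × ℂ => (w.1.re, w.2.re) := by fun_prop
      exact (h2.tendsto _).comp (hL (incl x))
    exact tendsto_nhds_unique (hL _) (h1.congr fun n => ((hF n).real x).symm)

/-- The limit of the `T_n` as a homeomorphism of the torus. -/
lemma exists_limit (h : Controlled q₀ c) (p₀ : ℕ) :
    ∃ T : T2 ≃ₜ T2,
      (∀ ρ : ℝ, ∃ f₁ f₂, IsLift ρ T f₁ f₂) ∧
      (∃ g : ℝ × ℝ → ℝ × ℝ, AnalyticOnNhd ℝ g Set.univ ∧ ∀ x, T.symm (proj x) = proj (g x)) ∧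
      (∀ ρ : ℝ, Tendsto (fun n => distRho ρ (Tn p₀ q₀ c n) T) atTop (𝓝 0)) ∧
      ∀ x, Tendsto (fun n => Tn p₀ q₀ c n x) atTop (𝓝 (T x)) := by
  have hF : ∀ n, IsEntireLift (liftT p₀ q₀ c n) := fun n => isEntireLift_SC h n _ _
  have hG : ∀ n, IsEntireLift (liftTInv p₀ q₀ c n) := fun n => isEntireLift_SC h n _ _
  obtain ⟨L, hLa, hL, hLd⟩ := exists_entire_limit (fun n => (hF n).differentiable)
    (liftT_sub h p₀)
  obtain ⟨M, hMa, hM, hMd⟩ := exists_entire_limit (fun n => (hG n).differentiable)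
    (liftTInv_sub h p₀)
  have hL' := isEntireLift_limit hF (fun a => (hLa a).differentiableAt) hL
  have hM' := isEntireLift_limit hG (fun a => (hMa a).differentiableAt) hM
  obtain ⟨T, hT, hTs⟩ := hL'.exists_homeomorph hM'
    (limit_comp_limit hL'.differentiable.continuous hLd hM (liftT_liftTInv h p₀))
    (limit_comp_limit hM'.differentiable.continuous hMd hL (liftTInv_liftT h p₀))
  have hTn : ∀ n x, Tn p₀ q₀ c n (proj x) = proj (rePart (liftT p₀ q₀ c n) x) := fun n x =>
    proj_rePart_SC h n _ _ x
  refine ⟨T, fun ρ => ⟨_, _, hL'.isLift hT ρ⟩, ⟨_, analyticOnNhd_rePart hMa, hTs⟩, fun ρ => ?_,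
    fun x => ?_⟩
  · have h0 : Tendsto (fun n : ℕ => ENNReal.ofReal (2 / 2 ^ n)) atTop (𝓝 0) := by
      simpa using ENNReal.tendsto_ofReal tendsto_two_div_pow
    obtain ⟨N, hN⟩ := exists_nat_ge ρ
    refine tendsto_of_tendsto_of_tendsto_of_le_of_le' tendsto_const_nhds h0
      (Eventually.of_forall fun _ => zero_le) ?_
    filter_upwards [eventually_ge_atTop N] with n hn
    exact (hF n).distRho_le hL' (hTn n) hT fun z hz =>
      hLd n z (closedStrip_mono (hN.trans (by exact_mod_cast hn)) hz)
  · obtain ⟨x, rfl⟩ := proj_surjective x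
    rw [tendsto_iff_dist_tendsto_zero]
    refine squeeze_zero (fun _ => dist_nonneg) (fun n => ?_) tendsto_two_div_pow
    rw [hTn, hT]
    exact (dist_proj_le _ _).trans ((dist_rePart_le _ _ x).trans
      (hLd n _ (incl_mem_closedStrip n x)))

/-- The flows of two consecutive stages agree at multiples of `1 / q_n` and are close nearby. -/
lemma dist_ST_le (h : Controlled q₀ c) (n : ℕ) (m : ℤ) {s : ℝ} (hs : |s| * (c n).k ≤ 1) (x : T2) :
    dist (ST q₀ c n (m / (q q₀ c n : ℝ)) x) (ST q₀ c (n + 1) (m / (q q₀ c n : ℝ) + s) x)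
      ≤ 1 / 2 ^ n := by
  obtain ⟨x, rfl⟩ := proj_surjective x
  have ht : ∀ i < n + 1, TameAt q₀ c i := fun i _ => h.tame i
  rw [← ST_succ ht, dist_comm, proj_rePart_SC h _ _ 0, proj_rePart_SC h _ _ 0]
  refine (dist_proj_le _ _).trans ((dist_rePart_le _ _ x).trans ?_)
  simpa using h.shift n (m / (q q₀ c n : ℝ)) s hs _ (incl_mem_closedStrip n x)

end Convergence

/-! ### Measure preservation -/

section Measure

variable {q₀ : ℕ} {c : ℕ → Choice} {n : ℕ}

lemma continuous_onReal {s : ℂ → ℂ} (h : Continuous s) : Continuous (onReal s) :=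
  Complex.continuous_re.comp (h.comp Complex.continuous_ofReal)

lemma continuous_onCircle {s : ℂ → ℂ} (h : Continuous s) (hp : ∀ z, s (z + 1) = s z) :
    Continuous (onCircle s) := by
  have hq : IsOpenQuotientMap ((↑) : ℝ → UnitAddCircle) := QuotientAddGroup.isOpenQuotientMap_mk
  refine hq.isQuotientMap.continuous_iff.2 ?_
  exact (hq.continuous.comp (continuous_onReal h)).congr fun x => (onCircle_coe hp x).symm

/-- A homeomorphism of the torus, given as a permutation, that preserves Lebesgue measure. -/
structure IsMeasureHomeo (F : Equiv.Perm T2) : Prop where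
  continuous : Continuous F
  continuous_symm : Continuous F.symm
  measurePreserving : MeasurePreserving F volume volume

lemma IsMeasureHomeo.measurePreserving_symm {F : Equiv.Perm T2} (h : IsMeasureHomeo F) :
    MeasurePreserving F.symm volume volume := by
  refine ⟨h.continuous_symm.measurable, ?_⟩
  conv_lhs => rw [← h.measurePreserving.map_eq]
  rw [Measure.map_map h.continuous_symm.measurable h.continuous.measurable]
  simp

lemma IsMeasureHomeo.symm {F : Equiv.Perm T2} (h : IsMeasureHomeo F) : IsMeasureHomeo F⁻¹ :=
  ⟨h.continuous_symm, h.continuous, h.measurePreserving_symm⟩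

lemma IsMeasureHomeo.mul {F G : Equiv.Perm T2} (hF : IsMeasureHomeo F) (hG : IsMeasureHomeo G) :
    IsMeasureHomeo (F * G) :=
  ⟨hF.continuous.comp hG.continuous, hG.continuous_symm.comp hF.continuous_symm,
    hF.measurePreserving.comp hG.measurePreserving⟩

lemma isMeasureHomeo_one : IsMeasureHomeo 1 :=
  ⟨continuous_id, continuous_id, MeasurePreserving.id _⟩

/-- Each vertical circle is rotated, so Fubini applies; the horizontal shear follows by exchanging
coordinates. -/
lemma isMeasureHomeo_shearSnd {f : UnitAddCircle → UnitAddCircle} (hf : Continuous f) :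
    IsMeasureHomeo (shearSnd f) := by
  refine ⟨?_, ?_, ?_⟩
  · show Continuous fun x : T2 => (x.1, x.2 + f x.1)
    fun_prop
  · show Continuous fun x : T2 => (x.1, x.2 - f x.1)
    fun_prop
  · refine MeasurePreserving.skew_product (g := fun a b => b + f a) (MeasurePreserving.id volume)
      ?_ (Eventually.of_forall fun a => map_add_right_eq_self volume (f a))
    exact (show Continuous fun x : T2 => x.2 + f x.1 by fun_prop).measurable

lemma isMeasureHomeo_shearFst {f : UnitAddCircle → UnitAddCircle} (hf : Continuous f) :
    IsMeasureHomeo (shearFst f) := by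
  refine ⟨?_, ?_, ?_⟩
  · show Continuous fun x : T2 => (x.1 + f x.2, x.2)
    fun_prop
  · show Continuous fun x : T2 => (x.1 - f x.2, x.2)
    fun_prop
  · have hs : MeasurePreserving (Prod.swap : T2 → T2) volume volume :=
      Measure.measurePreserving_swap
    exact (hs.comp ((isMeasureHomeo_shearSnd hf).measurePreserving)).comp hs

lemma isMeasureHomeo_HTorus (h : ∀ i < n, TameAt q₀ c i) : IsMeasureHomeo (HTorus q₀ c n) := by
  induction n with
  | zero => exact isMeasureHomeo_one
  | succ n ih =>
    have ht := h n (by omega)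
    have h1 := continuous_onCircle ht.entire₁.continuous ht.periodic₁
    have h2 := continuous_onCircle ht.entire₂.continuous ht.periodic₂
    have h3 := continuous_onCircle ht.entire₃.continuous ht.periodic₃
    refine IsMeasureHomeo.mul ?_ (ih fun i hi => h i (by omega))
    exact (((isMeasureHomeo_shearSnd (continuous_id.nsmul _)).mul
      (isMeasureHomeo_shearFst h3.neg)).mul (isMeasureHomeo_shearSnd h2)).mul
      (isMeasureHomeo_shearFst h1)

lemma isMeasureHomeo_ST (h : ∀ i < n, TameAt q₀ c i) (t : ℝ) : IsMeasureHomeo (ST q₀ c n t) :=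
  ((isMeasureHomeo_HTorus h).symm.mul (isMeasureHomeo_shearFst continuous_const)).mul
    (isMeasureHomeo_HTorus h)

open BoundedContinuousFunction in
/-- A continuous pointwise limit of measure preserving maps is measure preserving. -/
lemma measurePreserving_of_tendsto {X : Type*} [TopologicalSpace X] [MeasurableSpace X]
    [BorelSpace X] [HasOuterApproxClosed X] {μ : Measure X} [IsFiniteMeasure μ] {F : ℕ → X → X}
    {T : X → X} (hF : ∀ n, MeasurePreserving (F n) μ μ) (hT : Continuous T)
    (h : ∀ x, Tendsto (F · x) atTop (𝓝 (T x))) : MeasurePreserving T μ μ := by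
  refine ⟨hT.measurable, ext_of_forall_integral_eq_of_IsFiniteMeasure fun f => ?_⟩
  rw [integral_map hT.measurable.aemeasurable f.continuous.measurable.aestronglyMeasurable]
  have h1 : Tendsto (fun n => ∫ x, f (F n x) ∂μ) atTop (𝓝 (∫ x, f (T x) ∂μ)) := by
    refine tendsto_integral_of_dominated_convergence (fun _ => ‖f‖)
      (fun n => (f.continuous.measurable.comp (hF n).measurable).aestronglyMeasurable)
      (integrable_const _) (fun n => Eventually.of_forall fun x => f.norm_coe_le_norm _)
      (Eventually.of_forall fun x => (f.continuous.tendsto _).comp (h x))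
  have h2 : ∀ n, ∫ x, f (F n x) ∂μ = ∫ x, f x ∂μ := fun n => by
    rw [← integral_map (hF n).measurable.aemeasurable
      f.continuous.measurable.aestronglyMeasurable, (hF n).map_eq]
  simp only [h2] at h1
  exact tendsto_nhds_unique h1 tendsto_const_nhds

end Measure

/-! ### Step functions on the line -/

lemma stepFn_eq {k N : ℕ} (hk : 0 < k) (hN : 0 < N) (a : ℕ → ℝ) {x : ℝ}
    (hx : x ∈ Set.Ico (0 : ℝ) 1) : stepFn k N a x = a (⌊(k * N : ℝ) * x⌋₊ % k) := by
  have hkN : (0 : ℝ) < k * N := by positivity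
  have hy : 0 ≤ (k * N : ℝ) * x := mul_nonneg hkN.le hx.1
  have hmem : ∀ i : ℕ, x ∈ Set.Ico ((i : ℝ) / (k * N : ℝ)) (((i : ℝ) + 1) / (k * N : ℝ)) ↔
      ⌊(k * N : ℝ) * x⌋₊ = i := fun i => by
    rw [Nat.floor_eq_iff hy, Set.mem_Ico, div_le_iff₀ hkN, lt_div_iff₀ hkN, mul_comm x]
  rw [stepFn, Finset.sum_eq_single ⌊(k * N : ℝ) * x⌋₊]
  · rw [Set.indicator_of_mem ((hmem _).2 rfl)]
  · intro i _ hi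
    rw [Set.indicator_of_notMem fun h => hi ((hmem i).1 h).symm]
  · intro h
    exfalso
    apply h
    rw [Finset.mem_range, Nat.floor_lt hy]
    push_cast
    nlinarith [hx.2]

/-- Periodicity carries the estimate from `[0,1)` to the line. Scaled by `kN`, the exceptional set
becomes the points within `δ / 2` of an integer, and removing the integer part of `x` changes the
step index by a multiple of `k`. -/
lemma ApproxStep.abs_sub_lt {k N : ℕ} {a : ℕ → ℝ} {ε δ : ℝ} {s : ℂ → ℂ}
    (h : ApproxStep k N a ε δ s) (hk : 0 < k) (hN : 0 < N) {x : ℝ}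
    (hx : ∀ m : ℤ, δ / 2 < |(k * N : ℝ) * x - m|) :
    |onReal s x - a (⌊(k * N : ℝ) * x⌋ % k).toNat| < ε := by
  have hkN : (0 : ℝ) < k * N := by positivity
  have hper : ∀ z, s (z + 1) = s z := fun z => by
    simpa using periodic_one_of hN h.periodic (one_dvd _) z
  have hI : Int.fract x ∈ Set.Ico (0 : ℝ) 1 := ⟨Int.fract_nonneg x, Int.fract_lt_one x⟩
  have hs : onReal s (Int.fract x) = onReal s x := by
    have := (onReal_periodic hper).sub_int_mul_eq (x := x) ⌊x⌋
    rwa [mul_one] at this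
  have hfr : (k * N : ℝ) * Int.fract x = (k * N : ℝ) * x - ((k * N * ⌊x⌋ : ℤ) : ℝ) := by
    rw [Int.fract]; push_cast; ring
  have hex : Int.fract x ∉ exceptional k N δ := by
    rintro ⟨-, i, -, hi⟩
    have h1 : |(k * N : ℝ) * Int.fract x - i| ≤ δ / 2 := by
      have : (k * N : ℝ) * Int.fract x - i = (k * N : ℝ) * (Int.fract x - i / (k * N)) := by
        field_simp
      rw [this, abs_mul, abs_of_pos hkN]
      refine (mul_le_mul_of_nonneg_left hi hkN.le).trans (le_of_eq ?_)
      field_simp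
    have h2 := hx (k * N * ⌊x⌋ + i)
    rw [hfr] at h1
    push_cast at h1 h2
    rw [← sub_sub] at h2
    linarith
  obtain ⟨η, hη, hn⟩ := h.near
  have h3 := hn _ ⟨hI, hex⟩
  rw [stepFn_eq hk hN a hI] at h3
  have h4 : ⌊(k * N : ℝ) * Int.fract x⌋₊ % k = (⌊(k * N : ℝ) * x⌋ % k).toNat := by
    have h5 : (⌊(k * N : ℝ) * Int.fract x⌋₊ : ℤ) = ⌊(k * N : ℝ) * x⌋ - k * N * ⌊x⌋ := by
      rw [Int.natCast_floor_eq_floor (mul_nonneg hkN.le hI.1), hfr, Int.floor_sub_intCast]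
    have h6 : ((⌊(k * N : ℝ) * Int.fract x⌋₊ % k : ℕ) : ℤ) = ⌊(k * N : ℝ) * x⌋ % k := by
      push_cast
      rw [h5, mul_assoc (k : ℤ), Int.sub_mul_emod_self_left]
    omega
  rw [h4] at h3
  change |onReal s (Int.fract x) - _| ≤ η at h3
  rw [hs] at h3
  linarith

/-! ### Integrals over subdivisions of the unit interval -/

/-- The error `R` is a function and not a constant, so that the exceptional sets can later be
charged by their total measure. -/
lemma abs_integral_sub_average_le {F R : ℝ → ℝ} {M : ℕ} (hM : 0 < M) {C : ℕ → ℝ}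
    (hF : ∀ a b, IntervalIntegrable F volume a b) (hR : ∀ a b, IntervalIntegrable R volume a b)
    (h : ∀ i < M, |(∫ s in (i / M : ℝ)..((i + 1) / M : ℝ), F s) - C i / M|
      ≤ ∫ s in (i / M : ℝ)..((i + 1) / M : ℝ), R s) :
    |(∫ s in (0 : ℝ)..1, F s) - (∑ i ∈ Finset.range M, C i) / M| ≤ ∫ s in (0 : ℝ)..1, R s := by
  have hsum : ∀ G : ℝ → ℝ, (∀ a b, IntervalIntegrable G volume a b) →
      ∫ s in (0 : ℝ)..1, G s = ∑ i ∈ Finset.range M, ∫ s in (i / M : ℝ)..((i + 1) / M : ℝ), G s := by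
    intro G hG
    have := intervalIntegral.sum_integral_adjacent_intervals (a := fun i : ℕ => (i / M : ℝ))
      (n := M) (fun k _ => hG _ _)
    simp only [Nat.cast_zero, zero_div] at this
    rw [div_self (by positivity)] at this
    rw [← this]
    push_cast
    rfl
  rw [hsum F hF, hsum R hR, Finset.sum_div, ← Finset.sum_sub_distrib]
  exact (Finset.abs_sum_le_sum_abs _ _).trans
    (Finset.sum_le_sum fun i hi => h i (Finset.mem_range.1 hi))

lemma abs_integral_sub_average_le_const {F : ℝ → ℝ} {M : ℕ} (hM : 0 < M) {C : ℕ → ℝ} {ω : ℝ}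
    (hF : ∀ a b, IntervalIntegrable F volume a b)
    (h : ∀ i < M, ∀ s ∈ Set.Icc (i / M : ℝ) ((i + 1) / M : ℝ), |F s - C i| ≤ ω) :
    |(∫ s in (0 : ℝ)..1, F s) - (∑ i ∈ Finset.range M, C i) / M| ≤ ω := by
  have hM' : (0 : ℝ) < M := by positivity
  have := abs_integral_sub_average_le (R := fun _ => ω) hM hF (fun _ _ => by simp) (C := C)
    fun i hi => by
      have hle : (i / M : ℝ) ≤ (i + 1) / M := by gcongr; linarith
      have h1 : C i / M = ∫ _ in (i / M : ℝ)..((i + 1) / M : ℝ), C i := by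
        rw [intervalIntegral.integral_const, smul_eq_mul]; field_simp; ring
      rw [h1, ← intervalIntegral.integral_sub (hF _ _) (by simp)]
      refine (intervalIntegral.abs_integral_le_integral_abs hle).trans ?_
      exact intervalIntegral.integral_mono_on hle ((hF _ _).sub (by simp)).abs (by simp) (h i hi)
  simpa using this

/-- The set where `M s - b` is close to an integer. -/
def nearInt (M : ℕ) (b η : ℝ) : Set ℝ := {s | ‖((M * s - b : ℝ) : UnitAddCircle)‖ ≤ η}

lemma measurableSet_nearInt (M : ℕ) (b η : ℝ) : MeasurableSet (nearInt M b η) := by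
  have h : Continuous ((↑) : ℝ → UnitAddCircle) := AddCircle.continuous_mk' 1
  exact (isClosed_le (h.comp (by fun_prop : Continuous fun s : ℝ => M * s - b)).norm
    continuous_const).measurableSet

lemma lt_abs_sub_of_notMem_nearInt {M : ℕ} {b η s : ℝ} (h : s ∉ nearInt M b η) (m : ℤ) :
    η < |M * s - b - m| := by
  have h1 : η < ‖((M * s - b : ℝ) : UnitAddCircle)‖ := not_le.1 h
  have h2 : ((M * s - b : ℝ) : UnitAddCircle) = ((M * s - b - m : ℝ) : UnitAddCircle) :=
    coe_circle_eq_iff.2 ⟨m, by ring⟩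
  rw [h2] at h1
  exact h1.trans_le (norm_coe_circle_le _)

lemma intervalIntegrable_indicator_nearInt (M : ℕ) (b η u v : ℝ) :
    IntervalIntegrable ((nearInt M b η).indicator (1 : ℝ → ℝ)) volume u v := by
  have : IntervalIntegrable (1 : ℝ → ℝ) volume u v := by
    show IntervalIntegrable (fun _ => (1 : ℝ)) volume u v
    simp
  exact ⟨this.1.indicator (measurableSet_nearInt M b η),
    this.2.indicator (measurableSet_nearInt M b η)⟩

/-- Multiplication by `M` preserves the measure of the circle, so the set has the measure of a ball
of radius `η`, whatever `M` and `b` are. -/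
lemma integral_indicator_nearInt_le {M : ℕ} (hM : 0 < M) (b : ℝ) {η : ℝ} (hη : 0 ≤ η) :
    ∫ s in (0 : ℝ)..1, (nearInt M b η).indicator (1 : ℝ → ℝ) s ≤ 2 * η := by
  let E : Set UnitAddCircle := Metric.closedBall (b : UnitAddCircle) η
  have hE : MeasurableSet E := Metric.isClosed_closedBall.measurableSet
  have hmp := Measure.measurePreserving_zsmul (volume : Measure UnitAddCircle)
    (show (M : ℤ) ≠ 0 by exact_mod_cast hM.ne')
  have h1 : ∀ s : ℝ, (nearInt M b η).indicator (1 : ℝ → ℝ) s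
      = (((M : ℤ) • · : UnitAddCircle → UnitAddCircle) ⁻¹' E).indicator 1 (s : UnitAddCircle) := by
    intro s
    have hm : s ∈ nearInt M b η ↔
        (s : UnitAddCircle) ∈ ((M : ℤ) • · : UnitAddCircle → UnitAddCircle) ⁻¹' E := by
      have : ((M * s : ℝ) : UnitAddCircle) = (M : ℤ) • (s : UnitAddCircle) := by
        rw [← AddCircle.coe_zsmul]; simp
      rw [Set.mem_preimage, Metric.mem_closedBall, dist_eq_norm, ← this, ← AddCircle.coe_sub]
      rfl
    by_cases hs : s ∈ nearInt M b η
    · rw [Set.indicator_of_mem hs, Set.indicator_of_mem (hm.1 hs)]; rfl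
    · rw [Set.indicator_of_notMem hs, Set.indicator_of_notMem (mt hm.2 hs)]
  simp only [h1]
  have h2 := UnitAddCircle.intervalIntegral_preimage 0
    ((((M : ℤ) • · : UnitAddCircle → UnitAddCircle) ⁻¹' E).indicator (1 : UnitAddCircle → ℝ))
  rw [zero_add] at h2
  rw [h2, integral_indicator_one (hmp.measurable hE), Measure.real,
    hmp.measure_preimage hE.nullMeasurableSet, AddCircle.volume_closedBall]
  rw [ENNReal.toReal_ofReal (le_min zero_le_one (by positivity))]
  exact min_le_right _ _

/-- A function of `⌊b - l M s⌋` that is `l`-periodic is equidistributed over intervals of length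
`1 / M`. -/
lemma integral_floor_eq {l M : ℕ} (hl : 0 < l) (hM : 0 < M) (φ : ℤ → ℝ)
    (hφ : ∀ j, φ (j + l) = φ j) (b : ℝ) (i : ℕ) :
    ∫ s in (i / M : ℝ)..((i + 1) / M : ℝ), φ ⌊b - (l * M : ℝ) * s⌋
      = ((∑ j ∈ Finset.range l, φ j) / l) / M := by
  have hl' : (l : ℝ) ≠ 0 := by positivity
  have hM' : (M : ℝ) ≠ 0 := by positivity
  have hper : Function.Periodic (fun θ : ℝ => φ ⌊θ⌋) (l : ℝ) := fun θ => by
    have := hφ ⌊θ⌋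
    rw [← Int.floor_add_natCast] at this
    exact this
  rw [intervalIntegral.integral_comp_sub_mul (fun θ => φ ⌊θ⌋) (by positivity) b]
  -- While `s` runs over the interval, the argument of the floor runs through exactly one period
  -- `l`.
  have e1 : b - (l * M : ℝ) * (i / M) = (b - (l * M : ℝ) * ((i + 1) / M)) + l := by
    field_simp; ring
  rw [e1, hper.intervalIntegral_add_eq _ 0, zero_add]
  have hloc : ∀ j : ℕ, Set.EqOn (fun θ : ℝ => φ ⌊θ⌋) (fun _ => φ j) (Set.Ioo (j : ℝ) (j + 1 : ℕ)) :=
    fun j θ hθ => by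
      have : ⌊θ⌋ = j := by
        rw [Int.floor_eq_iff]
        refine ⟨by exact_mod_cast hθ.1.le, ?_⟩
        have := hθ.2
        push_cast at this ⊢
        exact this
      simp only [this]
  have hii : ∀ j : ℕ, IntervalIntegrable (fun θ : ℝ => φ ⌊θ⌋) volume j (j + 1 : ℕ) := fun j => by
    have h0 : IntervalIntegrable (fun _ : ℝ => φ j) volume j (j + 1 : ℕ) := by simp
    refine h0.congr_uIoo ?_
    rw [Set.uIoo_of_le (by push_cast; linarith)]
    exact (hloc j).symm
  have hsum := intervalIntegral.sum_integral_adjacent_intervals (a := fun i : ℕ => (i : ℝ))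
    (n := l) (fun k _ => hii k)
  rw [Nat.cast_zero] at hsum
  rw [← hsum]
  have : ∀ j : ℕ, ∫ θ in (j : ℝ)..(j + 1 : ℕ), φ ⌊θ⌋ = φ j := fun j => by
    rw [intervalIntegral.integral_congr_Ioo_of_le (by push_cast; linarith) (hloc j)]
    simp
  simp only [this, smul_eq_mul]
  field_simp

/-! ### Equidistribution of the curves `h⁻¹(· , y)` at scale `1 / l` -/

lemma emod_toNat_lt {l : ℕ} (hl : 0 < l) (i : ℤ) : (i % l).toNat < l := by
  have h1 := Int.emod_lt_of_pos i (show (0 : ℤ) < l by exact_mod_cast hl)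
  have h2 := Int.emod_nonneg i (show (l : ℤ) ≠ 0 by exact_mod_cast hl.ne')
  omega

lemma cast_emod_toNat {l : ℕ} (hl : 0 < l) (i : ℤ) :
    ((i % l).toNat : ℝ) = i - (l : ℝ) * ((i / l : ℤ) : ℝ) := by
  have h2 := Int.emod_nonneg i (show (l : ℤ) ≠ 0 by exact_mod_cast hl.ne')
  have h3 : (((i % l).toNat : ℤ) : ℝ) = ((i - l * (i / l) : ℤ) : ℝ) := by
    rw [Int.toNat_of_nonneg h2, Int.emod_def]
  push_cast at h3
  exact h3

set_option maxHeartbeats 2000000 in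
/-- Away from two small sets, `h⁻¹(y / q - s, y)` is close to a point of a grid of mesh `1 / l`. -/
lemma hMap_symm_near_grid {l q : ℕ} (hl : 0 < l) (hq : 0 < q) {ψ₁ ψ₂ ψ₃ : ℂ → ℂ}
    (h : StepAt l q ψ₁ ψ₂ ψ₃) {y s η : ℝ} (hη : η = 1 / 2 ^ (l ^ 2 * q))
    (h1 : ∀ m : ℤ, η < |(l * q : ℝ) * s - m|)
    (h2 : ∀ m : ℤ, η < |(l : ℝ) ^ 2 * q * s - (l : ℝ) ^ 2 * y - m|) {i : ℤ}
    (hi : i = ⌊(l * q : ℝ) * s⌋) :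
    ∃ m : ℤ, dist ((hMap (onReal ψ₁) (onReal ψ₂) (onReal ψ₃) q).symm (y / q - s, y))
      (y / q - i / (l * q), (i - ⌊(l : ℝ) ^ 2 * y + (i % l).toNat - (l : ℝ) ^ 2 * q * s⌋) / l + m)
      ≤ 5 / l := by
  have hl0 : (0 : ℝ) < l := by exact_mod_cast hl
  have hq0 : (0 : ℝ) < q := by exact_mod_cast hq
  have hl1 : (1 : ℝ) ≤ l := by exact_mod_cast hl
  have hq1 : (1 : ℝ) ≤ q := by exact_mod_cast hq
  have hl2 : (l : ℝ) ≤ (l : ℝ) ^ 2 * q := by nlinarith [mul_le_mul hl1 hq1 zero_le_one hl0.le]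
  have hA : (1 : ℝ) ≤ (l : ℝ) ^ 2 * q := hl1.trans hl2
  set δ := precision l q with hδ
  -- The index of the second step function is read off at scale `l²q`, so errors of size `δ` appear
  -- there as `η`.
  have hδη : (l : ℝ) ^ 2 * q * δ = η := by
    rw [hδ, hη, precision]; field_simp
  have hη0 : 0 < η := by rw [hη]; positivity
  have hη1 : η ≤ 1 := by
    rw [hη, div_le_one (by positivity)]; exact one_le_pow₀ one_le_two
  have hδ0 : 0 < δ := by rw [hδ, precision]; positivity
  have hδle : δ ≤ η := by nlinarith
  have hlδ : l * δ ≤ η := by nlinarith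
  have hδl : δ ≤ 1 / l := by rw [le_div_iff₀ hl0]; linarith
  set w := (q : ℝ) * s with hw
  set a : ℕ := (i % l).toNat with ha
  have hal : a < l := emod_toNat_lt hl i
  have hal' : (a : ℝ) ≤ l := by exact_mod_cast hal.le
  -- the value of the third shear
  have k3 : |onReal ψ₃ w - a / ((l : ℝ) ^ 2 * q)| < δ / 3 := by
    have := h.approx₃.abs_sub_lt hl one_pos (x := w) fun m => by
      have := h1 m
      rw [hw, Nat.cast_one, mul_one, ← mul_assoc]; linarith
    rwa [Nat.cast_one, mul_one, hw, ← mul_assoc, ← hi, ← hw] at this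
  set e₃ := onReal ψ₃ w - a / ((l : ℝ) ^ 2 * q) with he₃
  set u := y / q - s + onReal ψ₃ w with hu
  set θ := (l : ℝ) ^ 2 * y + a - (l : ℝ) ^ 2 * q * s with hθ
  -- The third shear is designed so that `l²q u` equals `θ` up to an error below `η / 3`. As `θ` is
  -- farther than `η` from the integers, the error changes neither its integer part nor the
  -- admissibility of `u`.
  have hθu : (l * (l * q : ℕ) : ℝ) * u = θ + (l : ℝ) ^ 2 * q * e₃ := by
    rw [hu, he₃, hθ]; push_cast; field_simp; ring
  have he₃' : |(l : ℝ) ^ 2 * q * e₃| < η / 3 := by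
    rw [abs_mul, abs_of_pos (by positivity)]
    have := mul_lt_mul_of_pos_left k3 (show 0 < (l : ℝ) ^ 2 * q by positivity)
    linarith
  have hθm : ∀ m : ℤ, η < |θ - m| := fun m => by
    have := h2 (a - m)
    rw [hθ, ← abs_neg]
    push_cast at this
    convert this using 2
    ring
  obtain ⟨hj1, hj2⟩ : ((⌊θ⌋ : ℤ) : ℝ) + η < θ ∧ θ < ⌊θ⌋ + 1 - η := by
    have b1 := Int.floor_le θ
    have b2 := Int.lt_floor_add_one θ
    have b3 := hθm ⌊θ⌋
    have b4 := hθm (⌊θ⌋ + 1)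
    push_cast at b4
    rw [abs_of_nonneg (by linarith)] at b3
    rw [abs_of_neg (by linarith)] at b4
    constructor <;> linarith
  have hj : ⌊(l * (l * q : ℕ) : ℝ) * u⌋ = ⌊θ⌋ := by
    rw [hθu, Int.floor_eq_iff]
    have := abs_lt.1 he₃'
    constructor <;> linarith
  -- the value of the second shear
  have k2 : |onReal ψ₂ u - ((⌊θ⌋ % l).toNat : ℕ) / (l : ℝ)| < δ / 3 := by
    have := h.approx₂.abs_sub_lt hl (Nat.mul_pos hl hq) (x := u) fun m => by
      have b1 := hθm m
      have b2 := abs_sub_abs_le_abs_sub (θ - m) (-((l : ℝ) ^ 2 * q * e₃))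
      rw [abs_neg] at b2
      rw [hθu, show θ + (l : ℝ) ^ 2 * q * e₃ - m = θ - m - -((l : ℝ) ^ 2 * q * e₃) by ring]
      linarith
    rwa [hj] at this
  set b : ℕ := (⌊θ⌋ % l).toNat with hb
  set e₂ := onReal ψ₂ u - b / (l : ℝ) with he₂
  set v := w - onReal ψ₂ u with hv
  -- the value of the first shear
  have k1 : |onReal ψ₁ v| ≤ 1 / l + δ / 3 := by
    have hlv : (l * (1 : ℕ) : ℝ) * v = l * q * s - b - l * e₂ := by
      rw [hv, he₂, hw]; push_cast; field_simp; ring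
    have hle₂ : |l * e₂| ≤ η / 3 := by
      rw [abs_mul, abs_of_pos hl0]
      have := mul_le_mul_of_nonneg_left k2.le hl0.le
      linarith
    have := h.approx₁.abs_sub_lt hl one_pos (x := v) fun m => by
      have b1 := h1 (b + m)
      push_cast at b1
      have b2 := abs_sub_abs_le_abs_sub ((l * q : ℝ) * s - (b + m)) (l * e₂)
      rw [hlv, show (l * q : ℝ) * s - b - l * e₂ - m = (l * q : ℝ) * s - (b + m) - l * e₂ by ring]
      linarith
    set d : ℕ := (⌊(l * (1 : ℕ) : ℝ) * v⌋ % l).toNat with hd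
    have hdl : (d : ℝ) ≤ l := by exact_mod_cast (emod_toNat_lt hl _).le
    -- Only the size of the first step function enters, whatever its index `d`.
    have hval : |if d = 0 then (0 : ℝ) else ((l : ℝ) - d) / ((l : ℝ) ^ 2 * q)| ≤ 1 / l := by
      split_ifs
      · rw [abs_zero]; positivity
      · rw [abs_of_nonneg (div_nonneg (by linarith) (by positivity)),
          div_le_div_iff₀ (by positivity) hl0]
        nlinarith [mul_nonneg (Nat.cast_nonneg d : (0 : ℝ) ≤ d) hl0.le,
          mul_le_mul_of_nonneg_left hq1 (show (0 : ℝ) ≤ l ^ 2 by positivity)]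
    have b3 := abs_sub_abs_le_abs_sub (onReal ψ₁ v)
      (if d = 0 then (0 : ℝ) else ((l : ℝ) - d) / ((l : ℝ) ^ 2 * q))
    linarith
  -- assembling
  have hpt : (hMap (onReal ψ₁) (onReal ψ₂) (onReal ψ₃) q).symm (y / q - s, y)
      = (u - onReal ψ₁ v, v) := by
    have : y - q * (y / q - s) = w := by rw [hw]; field_simp; ring
    simp only [hMap_symm_apply, shearFst_symm_apply, shearSnd_symm_apply, nsmul_eq_mul, this,
      sub_neg_eq_add, ← hu, ← hv]
  -- The second shear subtracts the remainder of `⌊θ⌋` modulo `l`, divided by `l`; the quotient is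
  -- the integer by which the second coordinate is displaced.
  refine ⟨⌊θ⌋ / l, ?_⟩
  rw [hpt, Prod.dist_eq, Real.dist_eq, Real.dist_eq]
  have f1 := Int.floor_le ((l * q : ℝ) * s)
  have f2 := Int.lt_floor_add_one ((l * q : ℝ) * s)
  rw [← hi] at f1 f2
  have g1 : |onReal ψ₃ w| ≤ 1 / l + δ / 3 := by
    have b3 := abs_sub_abs_le_abs_sub (onReal ψ₃ w) (a / ((l : ℝ) ^ 2 * q))
    have b4 : |(a : ℝ) / ((l : ℝ) ^ 2 * q)| ≤ 1 / l := by
      rw [abs_of_nonneg (by positivity), div_le_div_iff₀ (by positivity) hl0]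
      nlinarith [mul_le_mul_of_nonneg_left hq1 (show (0 : ℝ) ≤ l ^ 2 by positivity)]
    rw [he₃] at k3
    linarith
  have g2 : |s - i / (l * q)| ≤ 1 / l := by
    have b5 : s - i / (l * q) = (l * q * s - i) / (l * q) := by field_simp
    rw [b5, abs_of_nonneg (div_nonneg (by linarith) (by positivity)),
      div_le_div_iff₀ (by positivity) hl0]
    nlinarith [mul_le_mul_of_nonneg_left hq1 hl0.le]
  have h5 : (5 : ℝ) / l = 5 * (1 / l) := by ring
  rw [h5]
  -- The first coordinate collects three errors, of total at most `3 / l + 2δ / 3`, and the second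
  -- at most `1 / l + δ / 3`. Since `δ ≤ 1 / l`, both are below `5 / l`.
  refine max_le ?_ ?_
  · have b6 : u - onReal ψ₁ v - (y / q - i / (l * q))
        = -(s - i / (l * q)) + onReal ψ₃ w - onReal ψ₁ v := by rw [hu]; ring
    rw [b6]
    refine (abs_sub _ _).trans ?_
    have b7 := abs_add_le (-(s - i / (l * q))) (onReal ψ₃ w)
    rw [abs_neg] at b7
    linarith
  · have b8 : v - ((i - ⌊θ⌋) / l + ((⌊θ⌋ / l : ℤ) : ℝ)) = (w - i / l) - e₂ := by
      have := cast_emod_toNat hl ⌊θ⌋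
      rw [← hb] at this
      rw [hv, he₂, this]; field_simp; ring
    have b9 : |w - i / l| ≤ 1 / l := by
      have b5 : w - i / l = (l * q * s - i) / l := by rw [hw]; field_simp
      rw [b5, abs_of_nonneg (div_nonneg (by linarith) (by positivity)),
        div_le_div_iff₀ (by positivity) hl0]
      nlinarith
    rw [b8]
    refine (abs_sub _ _).trans ?_
    linarith

/-- The average of `g` over the grid of mesh `1 / l` on a vertical circle. -/
def gridAverage (l : ℕ) (g : ℝ × ℝ → ℝ) (a : ℝ) : ℝ :=
  (∑ j ∈ Finset.range l, g (a, -((j : ℤ) : ℝ) / l)) / l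

lemma continuous_hMap_symm {ψ₁ ψ₂ ψ₃ : ℝ → ℝ} (h1 : Continuous ψ₁) (h2 : Continuous ψ₂)
    (h3 : Continuous ψ₃) (q : ℕ) : Continuous (hMap ψ₁ ψ₂ ψ₃ q).symm := by
  show Continuous fun x => (hMap ψ₁ ψ₂ ψ₃ q).symm x
  simp only [hMap_symm_apply, shearFst_symm_apply, shearSnd_symm_apply, nsmul_eq_mul]
  fun_prop

section Equidistribution

variable {l q : ℕ} {ψ₁ ψ₂ ψ₃ : ℂ → ℂ} {g : ℝ × ℝ → ℝ} {B ω η : ℝ}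

/-- Near the jumps nothing is known about the curve and the trivial bound `2 * B` is paid there.
Elsewhere `hMap_symm_near_grid` applies, and the periodicity of `g` discards the integer `m`. -/
lemma abs_sub_grid_le (hl : 0 < l) (hq : 0 < q) (h : StepAt l q ψ₁ ψ₂ ψ₃)
    (hper : ∀ (x : ℝ × ℝ) (a b : ℤ), g (x.1 + a, x.2 + b) = g x) (hB : ∀ x, |g x| ≤ B)
    (hω : ∀ x x', dist x x' ≤ 5 / l → |g x - g x'| ≤ ω) (hω0 : 0 ≤ ω)
    (hη : η = 1 / 2 ^ (l ^ 2 * q)) (y s : ℝ) {i : ℤ} (hi : i = ⌊(l * q : ℝ) * s⌋) :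
    |g ((hMap (onReal ψ₁) (onReal ψ₂) (onReal ψ₃) q).symm (y / q - s, y)) -
      g (y / q - i / (l * q),
        (i - ⌊(l : ℝ) ^ 2 * y + (i % l).toNat - (l : ℝ) ^ 2 * q * s⌋) / l)|
      ≤ ω + 2 * B * ((nearInt (l * q) 0 η).indicator (1 : ℝ → ℝ) s
        + (nearInt (l ^ 2 * q) ((l : ℝ) ^ 2 * y) η).indicator (1 : ℝ → ℝ) s) := by
  have hB0 : 0 ≤ B := (abs_nonneg _).trans (hB 0)
  have htriv : ∀ x x', |g x - g x'| ≤ 2 * B := fun x x' =>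
    (abs_sub _ _).trans (by linarith [hB x, hB x'])
  have hind : ∀ D : Set ℝ, 0 ≤ D.indicator (1 : ℝ → ℝ) s := fun D =>
    Set.indicator_nonneg (fun _ _ => zero_le_one) s
  by_cases h1 : s ∈ nearInt (l * q) 0 η
  · rw [Set.indicator_of_mem h1, Pi.one_apply]
    have := hind (nearInt (l ^ 2 * q) ((l : ℝ) ^ 2 * y) η)
    exact (htriv _ _).trans (by nlinarith)
  by_cases h2 : s ∈ nearInt (l ^ 2 * q) ((l : ℝ) ^ 2 * y) η
  · rw [Set.indicator_of_mem h2, Pi.one_apply]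
    have := hind (nearInt (l * q) 0 η)
    exact (htriv _ _).trans (by nlinarith)
  rw [Set.indicator_of_notMem h1, Set.indicator_of_notMem h2]
  simp only [add_zero, mul_zero]
  obtain ⟨m, hm⟩ := hMap_symm_near_grid hl hq h (y := y) (s := s) hη
    (fun m => by simpa using lt_abs_sub_of_notMem_nearInt h1 m)
    (fun m => by simpa using lt_abs_sub_of_notMem_nearInt h2 m) hi
  have := hω _ _ hm
  have hp := hper (y / q - i / (l * q),
    (i - ⌊(l : ℝ) ^ 2 * y + (i % l).toNat - (l : ℝ) ^ 2 * q * s⌋) / l) 0 m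
  simp only [Int.cast_zero, add_zero] at hp
  rwa [hp] at this

/-- On each interval of length `1 / (l q)` the floor takes every residue modulo `l` for the same
time, which produces the grid average. The two exceptional sets contribute at most `2 * B * (2 * η +
2 * η)`. -/
lemma abs_integral_sub_sum_le (hl : 0 < l) (hq : 0 < q) (h : StepAt l q ψ₁ ψ₂ ψ₃)
    (hg : Continuous g)
    (hper : ∀ (x : ℝ × ℝ) (a b : ℤ), g (x.1 + a, x.2 + b) = g x) (hB : ∀ x, |g x| ≤ B)
    (hω : ∀ x x', dist x x' ≤ 5 / l → |g x - g x'| ≤ ω) (hω0 : 0 ≤ ω)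
    (hη : η = 1 / 2 ^ (l ^ 2 * q)) (y : ℝ) :
    |(∫ s in (0 : ℝ)..1,
        g ((hMap (onReal ψ₁) (onReal ψ₂) (onReal ψ₃) q).symm (y / q - s, y)))
      - (∑ i ∈ Finset.range (l * q), gridAverage l g (y / q - i / (l * q))) / (l * q : ℕ)|
      ≤ ω + 8 * B * η := by
  have hl0 : (0 : ℝ) < l := by exact_mod_cast hl
  have hq0 : (0 : ℝ) < q := by exact_mod_cast hq
  have hM : 0 < l * q := Nat.mul_pos hl hq
  have hM0 : (0 : ℝ) < (l * q : ℕ) := by exact_mod_cast hM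
  have hη0 : 0 ≤ η := by rw [hη]; positivity
  have hB0 : 0 ≤ B := (abs_nonneg _).trans (hB 0)
  have hGc : Continuous fun s : ℝ =>
      g ((hMap (onReal ψ₁) (onReal ψ₂) (onReal ψ₃) q).symm (y / q - s, y)) :=
    hg.comp ((continuous_hMap_symm (continuous_onReal h.approx₁.entire.continuous)
      (continuous_onReal h.approx₂.entire.continuous)
      (continuous_onReal h.approx₃.entire.continuous) q).comp (by fun_prop))
  let R : ℝ → ℝ := fun s => ω + 2 * B * ((nearInt (l * q) 0 η).indicator (1 : ℝ → ℝ) s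
    + (nearInt (l ^ 2 * q) ((l : ℝ) ^ 2 * y) η).indicator (1 : ℝ → ℝ) s)
  have i1 := intervalIntegrable_indicator_nearInt (l * q) 0 η
  have i2 := intervalIntegrable_indicator_nearInt (l ^ 2 * q) ((l : ℝ) ^ 2 * y) η
  have hRi : ∀ a b, IntervalIntegrable R volume a b := fun a b =>
    (by simp : IntervalIntegrable (fun _ => ω) volume a b).add
      (((i1 a b).add (i2 a b)).const_mul (2 * B))
  have hRle : ∫ s in (0 : ℝ)..1, R s ≤ ω + 8 * B * η := by
    have b1 := integral_indicator_nearInt_le hM 0 hη0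
    have b2 := integral_indicator_nearInt_le (show 0 < l ^ 2 * q by positivity)
      ((l : ℝ) ^ 2 * y) hη0
    rw [intervalIntegral.integral_add (by simp) (((i1 0 1).add (i2 0 1)).const_mul (2 * B)),
      intervalIntegral.integral_const_mul, intervalIntegral.integral_add (i1 0 1) (i2 0 1),
      intervalIntegral.integral_const]
    simp only [sub_zero, one_smul]
    nlinarith
  refine (abs_integral_sub_average_le hM (C := fun i => gridAverage l g (y / q - i / (l * q)))
    (fun a b => hGc.intervalIntegrable a b) hRi fun i hi => ?_).trans hRle
  let φ : ℤ → ℝ := fun j => g (y / q - i / (l * q), -(j : ℝ) / l)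
  -- The integer `i` is absorbed into the floor, so that the second grid coordinate takes the form
  -- `-⌊·⌋ / l`.
  let b : ℝ := (l : ℝ) ^ 2 * y + ((i : ℤ) % l).toNat - i
  have hφ : ∀ j, φ (j + l) = φ j := fun j => by
    have := hper (y / q - i / (l * q), -(j : ℝ) / l) 0 (-1)
    refine Eq.trans ?_ this
    simp only [φ, Int.cast_zero, add_zero]
    congr 2
    push_cast; field_simp; ring
  have hle : (i / (l * q : ℕ) : ℝ) ≤ (i + 1) / (l * q : ℕ) := by gcongr; linarith
  have hint := integral_floor_eq hl hM φ hφ b i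
  have hIi : IntervalIntegrable (fun s => φ ⌊b - (l * (l * q : ℕ) : ℝ) * s⌋) volume
      (i / (l * q : ℕ) : ℝ) ((i + 1) / (l * q : ℕ)) := by
    have hmeas : Measurable fun s : ℝ => φ ⌊b - (l * (l * q : ℕ) : ℝ) * s⌋ :=
      (measurable_of_countable φ).comp (Int.measurable_floor.comp (by fun_prop))
    refine (intervalIntegrable_const (c := B)).mono_fun hmeas.aestronglyMeasurable
      (Eventually.of_forall fun s => ?_)
    show |φ _| ≤ |B|
    rw [abs_of_nonneg hB0]
    exact hB _
  have hga : gridAverage l g (y / q - i / (l * q)) / (l * q : ℕ)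
      = ∫ s in (i / (l * q : ℕ) : ℝ)..((i + 1) / (l * q : ℕ) : ℝ),
        φ ⌊b - (l * (l * q : ℕ) : ℝ) * s⌋ := by
    rw [hint]; rfl
  rw [hga, ← intervalIntegral.integral_sub (hGc.intervalIntegrable _ _) hIi]
  refine (intervalIntegral.abs_integral_le_integral_abs hle).trans ?_
  refine intervalIntegral.integral_mono_on_of_le_Ioo hle
    ((hGc.intervalIntegrable _ _).sub hIi).abs (hRi _ _) fun s hs => ?_
  have hfl : ((i : ℕ) : ℤ) = ⌊(l * q : ℝ) * s⌋ := by
    symm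
    rw [Int.floor_eq_iff]
    have h1 := hs.1
    have h2 := hs.2
    rw [div_lt_iff₀ hM0] at h1
    rw [lt_div_iff₀ hM0] at h2
    push_cast at h1 h2 ⊢
    constructor <;> linarith
  have := abs_sub_grid_le hl hq h hper hB hω hω0 hη y s hfl
  convert this using 3
  simp only [φ, b]
  congr 2
  have e : (l : ℝ) ^ 2 * y + ((i : ℤ) % l).toNat - i - (l * (l * q : ℕ) : ℝ) * s
      = (l : ℝ) ^ 2 * y + ((i : ℤ) % l).toNat - (l : ℝ) ^ 2 * q * s - (i : ℤ) := by
    push_cast; ring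
  rw [e, Int.floor_sub_intCast]
  push_cast
  ring

/-- The integral of `g` over the curve `h⁻¹(· , y)` almost does not depend on `y`. -/
lemma abs_integral_curve_sub_le (hl : 0 < l) (hq : 0 < q) (h : StepAt l q ψ₁ ψ₂ ψ₃)
    (hg : Continuous g)
    (hper : ∀ (x : ℝ × ℝ) (a b : ℤ), g (x.1 + a, x.2 + b) = g x) (hB : ∀ x, |g x| ≤ B)
    (hω : ∀ x x', dist x x' ≤ 5 / l → |g x - g x'| ≤ ω) (hω0 : 0 ≤ ω) (y : ℝ)
    (hcurve : ∀ t, g ((hMap (onReal ψ₁) (onReal ψ₂) (onReal ψ₃) q).symm (t + 1, y))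
      = g ((hMap (onReal ψ₁) (onReal ψ₂) (onReal ψ₃) q).symm (t, y))) :
    |(∫ t in (0 : ℝ)..1, g ((hMap (onReal ψ₁) (onReal ψ₂) (onReal ψ₃) q).symm (t, y)))
      - ∫ t in (0 : ℝ)..1, gridAverage l g t| ≤ 2 * ω + 8 * B * (1 / 2 ^ (l ^ 2 * q)) := by
  have hl0 : (0 : ℝ) < l := by exact_mod_cast hl
  have hq1 : (1 : ℝ) ≤ q := by exact_mod_cast hq
  have hM : 0 < l * q := Nat.mul_pos hl hq
  have hM0 : (0 : ℝ) < (l * q : ℕ) := by exact_mod_cast hM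
  have hsub : ∀ F : ℝ → ℝ, Function.Periodic F 1 →
      ∫ s in (0 : ℝ)..1, F (y / q - s) = ∫ t in (0 : ℝ)..1, F t := fun F hF => by
    rw [intervalIntegral.integral_comp_sub_left F,
      show y / q - 0 = y / q - 1 + 1 by ring, hF.intervalIntegral_add_eq _ 0, zero_add]
  have hSc : Continuous (gridAverage l g) := by unfold gridAverage; fun_prop
  have hSp : Function.Periodic (gridAverage l g) 1 := fun a => by
    simp only [gridAverage]
    congr 1
    refine Finset.sum_congr rfl fun j _ => ?_
    simpa using hper (a, -((j : ℤ) : ℝ) / l) 1 0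
  have h1 := abs_integral_sub_sum_le hl hq h hg hper hB hω hω0 rfl y
  rw [hsub (fun t => g ((hMap (onReal ψ₁) (onReal ψ₂) (onReal ψ₃) q).symm (t, y))) hcurve] at h1
  -- The sum over `i` is a Riemann sum of the grid average, whose oscillation over a step costs the
  -- second `ω`. Integration over a full period then removes `y`.
  have h2 := abs_integral_sub_average_le_const (F := fun s => gridAverage l g (y / q - s)) hM
    (C := fun i => gridAverage l g (y / q - i / (l * q))) (ω := ω)
    (fun a b => (hSc.comp (by fun_prop)).intervalIntegrable a b) fun i _ s hs => by
      simp only [gridAverage]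
      rw [← sub_div, ← Finset.sum_sub_distrib, abs_div, abs_of_pos hl0, div_le_iff₀ hl0]
      refine (Finset.abs_sum_le_sum_abs _ _).trans ((Finset.sum_le_card_nsmul _ _ ω
        fun j _ => hω _ _ ?_).trans (by simp [mul_comm]))
      rw [Prod.dist_eq, dist_self, Real.dist_eq]
      refine max_le ?_ (by positivity)
      have e1 : y / q - s - (y / q - i / (l * q)) = -(s - i / (l * q : ℕ)) := by push_cast; ring
      rw [e1, abs_neg, abs_of_nonneg (by linarith [hs.1])]
      have e2 : ((i : ℝ) + 1) / (l * q : ℕ) = i / (l * q : ℕ) + 1 / (l * q : ℕ) := by ring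
      have e3 : 1 / ((l * q : ℕ) : ℝ) ≤ 5 / l := by
        push_cast
        rw [div_le_div_iff₀ (by positivity) hl0]; nlinarith
      linarith [hs.2]
  rw [hsub _ hSp] at h2
  have := abs_sub_le
    (∫ t in (0 : ℝ)..1, g ((hMap (onReal ψ₁) (onReal ψ₂) (onReal ψ₃) q).symm (t, y)))
    ((∑ i ∈ Finset.range (l * q), gridAverage l g (y / q - i / (l * q))) / (l * q : ℕ))
    (∫ t in (0 : ℝ)..1, gridAverage l g t)
  rw [abs_sub_comm ((∑ i ∈ Finset.range (l * q), _) / _)] at this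
  linarith

end Equidistribution

/-! ### Derivatives of the lifts to the plane -/

/-- The linear map of `ℝ²` with the given matrix entries. -/
def matCLM (a b c d : ℝ) : ℝ × ℝ →L[ℝ] ℝ × ℝ :=
  (a • ContinuousLinearMap.fst ℝ ℝ ℝ + b • ContinuousLinearMap.snd ℝ ℝ ℝ).prod
    (c • ContinuousLinearMap.fst ℝ ℝ ℝ + d • ContinuousLinearMap.snd ℝ ℝ ℝ)

lemma matCLM_apply (a b c d : ℝ) (x : ℝ × ℝ) :
    matCLM a b c d x = (a * x.1 + b * x.2, c * x.1 + d * x.2) := rfl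

lemma matCLM_comp (a b c d a' b' c' d' : ℝ) :
    (matCLM a' b' c' d').comp (matCLM a b c d)
      = matCLM (a' * a + b' * c) (a' * b + b' * d) (c' * a + d' * c) (c' * b + d' * d) := by
  refine ContinuousLinearMap.ext fun x => ?_
  simp only [ContinuousLinearMap.comp_apply, matCLM_apply, Prod.mk.injEq]
  constructor <;> ring

lemma norm_matCLM_le {a b c d D : ℝ} (ha : |a| ≤ D) (hb : |b| ≤ D) (hc : |c| ≤ D) (hd : |d| ≤ D) :
    ‖matCLM a b c d‖ ≤ 2 * D := by
  have hD : 0 ≤ D := (abs_nonneg a).trans ha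
  have key : ∀ u v : ℝ, |u| ≤ D → |v| ≤ D → ∀ x : ℝ × ℝ, ‖u * x.1 + v * x.2‖ ≤ 2 * D * ‖x‖ := by
    intro u v hu hv x
    refine (norm_add_le _ _).trans ?_
    rw [norm_mul, norm_mul, Real.norm_eq_abs u, Real.norm_eq_abs v]
    have h1 := mul_le_mul hu (norm_fst_le x) (norm_nonneg _) hD
    have h2 := mul_le_mul hv (norm_snd_le x) (norm_nonneg _) hD
    linarith
  refine ContinuousLinearMap.opNorm_le_bound _ (by positivity) fun x => ?_
  rw [matCLM_apply]
  exact max_le (key a b ha hb x) (key c d hc hd x)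

/-- `F` is everywhere differentiable with derivative of determinant one, and so is its inverse. -/
def IsUnimodular (F : Equiv.Perm (ℝ × ℝ)) : Prop :=
  ∀ x, ∃ a b c d : ℝ, HasFDerivAt F (matCLM a b c d) x ∧
    HasFDerivAt F.symm (matCLM d (-b) (-c) a) (F x)

lemma IsUnimodular.mul {F G : Equiv.Perm (ℝ × ℝ)} (hF : IsUnimodular F) (hG : IsUnimodular G) :
    IsUnimodular (F * G) := by
  intro x
  obtain ⟨a, b, c, d, h1, h2⟩ := hG x
  obtain ⟨a', b', c', d', h3, h4⟩ := hF (G x)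
  refine ⟨a' * a + b' * c, a' * b + b' * d, c' * a + d' * c, c' * b + d' * d, ?_, ?_⟩
  · rw [← matCLM_comp]; exact h3.comp x h1
  · have h5 : F.symm (F (G x)) = G x := F.symm_apply_apply _
    rw [← h5] at h2
    have h6 := h2.comp (F (G x)) h4
    rw [matCLM_comp] at h6
    exact h6.congr_fderiv (by congr 1 <;> ring)

lemma isUnimodular_one : IsUnimodular 1 := fun x => by
  have : matCLM 1 0 0 1 = ContinuousLinearMap.id ℝ (ℝ × ℝ) := by
    refine ContinuousLinearMap.ext fun x => ?_
    simp [matCLM_apply]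
  refine ⟨1, 0, 0, 1, ?_, ?_⟩
  · rw [this]; exact hasFDerivAt_id x
  · rw [neg_zero, this]; exact hasFDerivAt_id x

lemma isUnimodular_shearFst {f f' : ℝ → ℝ} (hf : ∀ x, HasDerivAt f (f' x) x) :
    IsUnimodular (shearFst f) := by
  have key : ∀ {g g' : ℝ → ℝ}, (∀ x, HasDerivAt g (g' x) x) → ∀ x : ℝ × ℝ,
      HasFDerivAt (fun y : ℝ × ℝ => (y.1 + g y.2, y.2)) (matCLM 1 (g' x.2) 0 1) x := by
    intro g g' hg x
    have h1 := (hg x.2).hasFDerivAt.comp x (hasFDerivAt_snd (𝕜 := ℝ) (p := x))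
    have h2 := (hasFDerivAt_fst.add h1).prodMk (hasFDerivAt_snd (𝕜 := ℝ) (p := x))
    refine h2.congr_fderiv (ContinuousLinearMap.ext fun y => ?_)
    simp [matCLM_apply, mul_comm]
  intro x
  refine ⟨1, f' x.2, 0, 1, key hf x, ?_⟩
  have e : ⇑(shearFst f).symm = fun y => (y.1 + -f y.2, y.2) :=
    funext fun y => by simp [sub_eq_add_neg]
  rw [neg_zero, e]
  exact key (fun y => (hf y).neg) (shearFst f x)

lemma isUnimodular_shearSnd {f f' : ℝ → ℝ} (hf : ∀ x, HasDerivAt f (f' x) x) :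
    IsUnimodular (shearSnd f) := by
  have key : ∀ {g g' : ℝ → ℝ}, (∀ x, HasDerivAt g (g' x) x) → ∀ x : ℝ × ℝ,
      HasFDerivAt (fun y : ℝ × ℝ => (y.1, y.2 + g y.1)) (matCLM 1 0 (g' x.1) 1) x := by
    intro g g' hg x
    have h1 := (hg x.1).hasFDerivAt.comp x (hasFDerivAt_fst (𝕜 := ℝ) (p := x))
    have h2 := (hasFDerivAt_fst (𝕜 := ℝ) (p := x)).prodMk (hasFDerivAt_snd.add h1)
    refine h2.congr_fderiv (ContinuousLinearMap.ext fun y => ?_)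
    simp [matCLM_apply, mul_comm, add_comm]
  intro x
  refine ⟨1, 0, f' x.1, 1, key hf x, ?_⟩
  have e : ⇑(shearSnd f).symm = fun y => (y.1, y.2 + -f y.1) :=
    funext fun y => by simp [sub_eq_add_neg]
  rw [neg_zero, e]
  exact key (fun y => (hf y).neg) (shearSnd f x)

section Derivative

variable {q₀ : ℕ} {c : ℕ → Choice} {n : ℕ}

lemma hasDerivAt_onReal {s : ℂ → ℂ} (h : Differentiable ℂ s) (x : ℝ) :
    HasDerivAt (onReal s) (deriv s x).re x :=
  (h x).hasDerivAt.real_of_complex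

lemma isUnimodular_HPlane (h : ∀ i < n, TameAt q₀ c i) : IsUnimodular (HPlane q₀ c n) := by
  induction n with
  | zero => exact isUnimodular_one
  | succ n ih =>
    have ht := h n (by omega)
    refine IsUnimodular.mul ?_ (ih fun i hi => h i (by omega))
    have h4 : ∀ x : ℝ, HasDerivAt (fun x => q q₀ c n • x) (q q₀ c n : ℝ) x := fun x => by
      simpa using (hasDerivAt_id x).const_mul (q q₀ c n : ℝ)
    exact (((isUnimodular_shearSnd h4).mul
      (isUnimodular_shearFst fun x => (hasDerivAt_onReal ht.entire₃ x).neg)).mul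
      (isUnimodular_shearSnd (hasDerivAt_onReal ht.entire₂))).mul
      (isUnimodular_shearFst (hasDerivAt_onReal ht.entire₁))

/-- A two by two matrix of determinant one and its inverse have the same entries up to sign and
position, so bounds on the derivative pass to the inverse. The factor 2 compares entries with the
operator norm. -/
lemma IsUnimodular.dist_symm_le {F : Equiv.Perm (ℝ × ℝ)} (hF : IsUnimodular F)
    (hfin : derivNorm F ≠ ⊤) (x y : ℝ × ℝ) :
    dist (F.symm x) (F.symm y) ≤ 2 * (derivNorm F).toReal * dist x y := by
  have hd : ∀ y, DifferentiableAt ℝ F.symm y ∧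
      ‖fderiv ℝ F.symm y‖ ≤ 2 * (derivNorm F).toReal := fun y => by
    obtain ⟨a, b, c, d, h1, h2⟩ := hF (F.symm y)
    rw [F.apply_symm_apply] at h2
    refine ⟨h2.differentiableAt, ?_⟩
    rw [h2.fderiv]
    have h3 : max ‖fderiv ℝ F (F.symm y) (1, 0)‖ₑ ‖fderiv ℝ F (F.symm y) (0, 1)‖ₑ
        ≤ derivNorm F :=
      le_iSup (fun x => max ‖fderiv ℝ F x (1, 0)‖ₑ ‖fderiv ℝ F x (0, 1)‖ₑ) _
    have key : ∀ v : ℝ × ℝ, ‖v‖ₑ ≤ derivNorm F →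
        |v.1| ≤ (derivNorm F).toReal ∧ |v.2| ≤ (derivNorm F).toReal := fun v hv => by
      have h4 := ENNReal.toReal_mono hfin hv
      rw [toReal_enorm] at h4
      exact ⟨(norm_fst_le v).trans h4, (norm_snd_le v).trans h4⟩
    rw [h1.fderiv, max_le_iff] at h3
    have h5 := key _ h3.1
    have h6 := key _ h3.2
    simp only [matCLM_apply, mul_one, mul_zero, add_zero, zero_add] at h5 h6
    exact norm_matCLM_le h6.2 (by rw [abs_neg]; exact h6.1) (by rw [abs_neg]; exact h5.2) h5.1
  rw [dist_comm, dist_eq_norm, dist_comm, dist_eq_norm]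
  exact convex_univ.norm_image_sub_le_of_norm_fderiv_le (fun z _ => (hd z).1)
    (fun z _ => (hd z).2) (Set.mem_univ _) (Set.mem_univ _)

lemma exists_lipschitz_onReal {s : ℂ → ℂ} (h : Differentiable ℂ s) (hp : ∀ z, s (z + 1) = s z) :
    ∃ K, LipschitzWith K (onReal s) := by
  have hc : Continuous fun x : ℝ => ‖deriv (onReal s) x‖₊ := by
    have : deriv (onReal s) = fun x : ℝ => (deriv s x).re :=
      funext fun x => (hasDerivAt_onReal h x).deriv
    rw [this]
    have h1 : Continuous (deriv s) := h.contDiff.continuous_deriv le_rfl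
    exact (Complex.continuous_re.comp (h1.comp Complex.continuous_ofReal)).nnnorm
  have hper : Function.Periodic (fun x : ℝ => ‖deriv (onReal s) x‖₊) 1 := fun x => by
    have : (fun y => onReal s (y + 1)) = onReal s := funext (onReal_periodic hp)
    simp only
    rw [← deriv_comp_add_const, this]
  obtain ⟨K, hK⟩ := (isCompact_Icc (a := (0 : ℝ)) (b := 1)).bddAbove_image hc.continuousOn
  refine ⟨K, lipschitzWith_of_nnnorm_deriv_le
    (fun x => (hasDerivAt_onReal h x).differentiableAt) fun x => ?_⟩
  obtain ⟨y, hy, hxy⟩ := hper.exists_mem_Ico₀ one_pos x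
  exact hxy.le.trans (hK ⟨y, ⟨hy.1, hy.2.le⟩, rfl⟩)

lemma exists_lipschitz_shearFst {f : ℝ → ℝ} (hf : ∃ K, LipschitzWith K f) :
    ∃ K, LipschitzWith K (shearFst f) := by
  obtain ⟨K, hK⟩ := hf
  exact ⟨_, (LipschitzWith.prod_fst.add (hK.comp LipschitzWith.prod_snd)).prodMk
    LipschitzWith.prod_snd⟩

lemma exists_lipschitz_shearSnd {f : ℝ → ℝ} (hf : ∃ K, LipschitzWith K f) :
    ∃ K, LipschitzWith K (shearSnd f) := by
  obtain ⟨K, hK⟩ := hf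
  exact ⟨_, LipschitzWith.prod_fst.prodMk
    (LipschitzWith.prod_snd.add (hK.comp LipschitzWith.prod_fst))⟩

lemma exists_lipschitz_HPlane (h : ∀ i < n, TameAt q₀ c i) :
    ∃ K, LipschitzWith K (HPlane q₀ c n) := by
  induction n with
  | zero => exact ⟨1, LipschitzWith.id⟩
  | succ n ih =>
    have ht := h n (by omega)
    obtain ⟨K, hK⟩ := ih fun i hi => h i (by omega)
    obtain ⟨K₁, hK₁⟩ := exists_lipschitz_shearFst
      (exists_lipschitz_onReal ht.entire₁ ht.periodic₁)
    obtain ⟨K₂, hK₂⟩ := exists_lipschitz_shearSnd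
      (exists_lipschitz_onReal ht.entire₂ ht.periodic₂)
    obtain ⟨K', hK'⟩ := exists_lipschitz_onReal ht.entire₃ ht.periodic₃
    obtain ⟨K₃, hK₃⟩ := exists_lipschitz_shearFst ⟨K', hK'.neg⟩
    have h4 : LipschitzWith (q q₀ c n : NNReal) fun x : ℝ => q q₀ c n • x :=
      LipschitzWith.of_dist_le_mul fun x y => by
        rw [Real.dist_eq, Real.dist_eq, nsmul_eq_mul, nsmul_eq_mul, ← mul_sub, abs_mul]
        simp
    obtain ⟨K₄, hK₄⟩ := exists_lipschitz_shearSnd ⟨_, h4⟩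
    exact ⟨_, (((hK₄.comp hK₃).comp hK₂).comp hK₁).comp hK⟩

/-- Finiteness is needed twice: for a suitable `l_n` to exist, and for `toReal` in the Lipschitz
bound to be meaningful. -/
lemma derivNorm_HPlane_ne_top (h : ∀ i < n, TameAt q₀ c i) : derivNorm (HPlane q₀ c n) ≠ ⊤ := by
  obtain ⟨K, hK⟩ := exists_lipschitz_HPlane h
  have hv : ∀ x v, ‖v‖ ≤ 1 → ‖fderiv ℝ (HPlane q₀ c n) x v‖ₑ ≤ ENNReal.ofReal K := by
    intro x v hv
    rw [← ofReal_norm]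
    refine ENNReal.ofReal_le_ofReal ((ContinuousLinearMap.le_opNorm _ _).trans ?_)
    have := norm_fderiv_le_of_lipschitz ℝ hK (x₀ := x)
    nlinarith [norm_nonneg v, K.coe_nonneg]
  refine ne_top_of_le_ne_top (ENNReal.ofReal_ne_top (r := K)) (iSup_le fun x => max_le ?_ ?_)
  · exact hv _ _ (by simp [Prod.norm_def])
  · exact hv _ _ (by simp [Prod.norm_def])

/-- The requirement on `l_n` makes `H_n⁻¹` contract the grid of mesh `1 / l_n`. -/
lemma Admissible.dist_HPlane_symm_le (h : Admissible q₀ c) (ht : ∀ n, TameAt q₀ c n) (n : ℕ)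
    {x y : ℝ × ℝ} (hxy : dist x y ≤ 5 / (c n).l) :
    dist ((HPlane q₀ c n).symm x) ((HPlane q₀ c n).symm y) ≤ 10 / 2 ^ n := by
  have hfin := derivNorm_HPlane_ne_top (n := n) fun i _ => ht i
  have h1 := (isUnimodular_HPlane (n := n) fun i _ => ht i).dist_symm_le hfin x y
  have hl : (0 : ℝ) < (c n).l := by exact_mod_cast h.l_pos n
  have h2 := ENNReal.toReal_mono (ENNReal.natCast_ne_top _) (h.l_large n).le
  rw [ENNReal.toReal_mul] at h2
  simp only [ENNReal.toReal_pow, ENNReal.toReal_ofNat, ENNReal.toReal_natCast] at h2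
  rw [le_div_iff₀ hl] at hxy
  rw [le_div_iff₀ (by positivity)]
  set D := (derivNorm (HPlane q₀ c n)).toReal
  have hD : 0 ≤ D := ENNReal.toReal_nonneg
  calc _ ≤ 2 * D * dist x y * 2 ^ n := by gcongr
    _ = 2 * (2 ^ n * D) * dist x y := by ring
    _ ≤ 2 * (c n).l * dist x y := by gcongr
    _ ≤ 10 := by linarith

end Derivative

/-! ### Unique ergodicity of the limit -/

section Ergodic

variable {q₀ : ℕ} {c : ℕ → Choice}

lemma Controlled.q_succ_ge (h : Controlled q₀ c) (n : ℕ) : 2 * q q₀ c n ≤ q q₀ c (n + 1) := by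
  have h1 := h.k_two n
  have h2 : 1 ≤ (c n).l ^ 2 := Nat.one_le_pow _ _ (h.l_pos n)
  simp only [q]
  exact Nat.mul_le_mul_right _ (by nlinarith)

lemma Controlled.q_mono (h : Controlled q₀ c) : Monotone (q q₀ c) :=
  monotone_nat_of_le_succ fun n => by have := h.q_succ_ge n; omega

lemma Controlled.le_q (h : Controlled q₀ c) (n : ℕ) : n ≤ q q₀ c n := by
  induction n with
  | zero => exact Nat.zero_le _
  | succ n ih =>
    have h1 := h.q_succ_ge n
    have h2 := (h.tame n).q_pos
    omega

lemma Controlled.le_precision_exponent (h : Controlled q₀ c) (n : ℕ) :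
    n ≤ (c n).l ^ 2 * q q₀ c n :=
  (h.le_q n).trans (Nat.le_mul_of_pos_left _ (pow_pos (h.l_pos n) 2))

lemma ST_add_int (n : ℕ) (t : ℝ) (m : ℤ) : ST q₀ c n (t + m) = ST q₀ c n t := by
  have : ((t + m : ℝ) : UnitAddCircle) = t := coe_circle_eq_iff.2 ⟨m, rfl⟩
  simp only [ST, this]

lemma dist_ST_add_le (h : Controlled q₀ c) (n : ℕ) (t : ℝ) {s : ℝ} (hs : |s| * (c n).k ≤ 1)
    (x : T2) : dist (ST q₀ c (n + 1) (t + s) x) (ST q₀ c (n + 1) t x) ≤ 1 / 2 ^ n := by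
  obtain ⟨x, rfl⟩ := proj_surjective x
  rw [proj_rePart_SC h _ _ 0, proj_rePart_SC h _ _ 0]
  refine (dist_proj_le _ _).trans ((dist_rePart_le _ _ x).trans ?_)
  simpa using h.shift n t s hs _ (incl_mem_closedStrip n x)

lemma continuous_ST_time (h : Controlled q₀ c) (n : ℕ) (x : T2) :
    Continuous fun t => ST q₀ c n t x := by
  have h1 := (isMeasureHomeo_HTorus (n := n) fun i _ => h.tame i).continuous_symm
  have h2 : Continuous ((↑) : ℝ → UnitAddCircle) := AddCircle.continuous_mk' 1
  simp only [ST_apply]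
  fun_prop

instance : IsProbabilityMeasure (volume : Measure UnitAddCircle) :=
  ⟨UnitAddCircle.measure_univ⟩

instance : IsProbabilityMeasure (volume : Measure T2) :=
  inferInstanceAs (IsProbabilityMeasure ((volume : Measure UnitAddCircle).prod volume))

/-- The horizontal circles are equidistributed after conjugation, with an explicit error. -/
lemma abs_integral_HTorus_symm_sub_le (h : Admissible q₀ c) (hc : Controlled q₀ c) {f : T2 → ℝ}
    (hf : Continuous f) {B ω : ℝ} (hB : ∀ x, |f x| ≤ B) (hω0 : 0 ≤ ω) {n : ℕ}
    (hω : ∀ x y, dist x y ≤ 10 / 2 ^ n → |f x - f y| ≤ ω) (y : UnitAddCircle) :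
    |(∫ x : UnitAddCircle, f ((HTorus q₀ c (n + 1)).symm (x, y))) - ∫ z, f z|
      ≤ 4 * ω + 16 * B / 2 ^ n := by
  have ht : ∀ i < n, TameAt q₀ c i := fun i _ => hc.tame i
  have ht' : ∀ i < n + 1, TameAt q₀ c i := fun i _ => hc.tame i
  have hB0 : 0 ≤ B := (abs_nonneg _).trans (hB 0)
  let g : ℝ × ℝ → ℝ := fun x => f ((HTorus q₀ c n).symm (proj x))
  have hH := isMeasureHomeo_HTorus ht
  have hH' := isMeasureHomeo_HTorus ht'
  have hgc : Continuous g := hf.comp (hH.continuous_symm.comp continuous_proj)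
  have hcomp : ∀ x : ℝ × ℝ, g ((hMap (onReal (c n).ψ₁) (onReal (c n).ψ₂) (onReal (c n).ψ₃)
      (q q₀ c n)).symm x) = f ((HTorus q₀ c (n + 1)).symm (proj x)) := fun x => by
    simp only [g]
    rw [HTorus_symm_proj ht, HTorus_symm_proj ht']
    rfl
  have hη : 8 * B * (1 / 2 ^ ((c n).l ^ 2 * q q₀ c n)) ≤ 8 * B / 2 ^ n := by
    rw [mul_one_div]
    gcongr
    · exact one_le_two
    · exact hc.le_precision_exponent n
  have key : ∀ y : UnitAddCircle,
      |(∫ x : UnitAddCircle, f ((HTorus q₀ c (n + 1)).symm (x, y)))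
        - ∫ t in (0 : ℝ)..1, gridAverage (c n).l g t| ≤ 2 * ω + 8 * B / 2 ^ n := by
    intro y
    obtain ⟨y, rfl⟩ := QuotientAddGroup.mk_surjective y
    have h1 := abs_integral_curve_sub_le (h.l_pos n) (hc.tame n).q_pos (h.stepAt n) hgc
      (fun x a b => by simp only [g, proj_add_int]) (fun x => hB _)
      (fun x x' hxx => by
        simp only [g]
        rw [HTorus_symm_proj ht, HTorus_symm_proj ht]
        exact hω _ _ ((dist_proj_le _ _).trans (h.dist_HPlane_symm_le hc.tame n hxx)))
      hω0 y (fun t => by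
        rw [hcomp, hcomp]
        have := proj_add_int (t, y) 1 0
        simp only [Int.cast_one, Int.cast_zero, add_zero] at this
        rw [this])
    have h2 := UnitAddCircle.intervalIntegral_preimage 0
      fun x => f ((HTorus q₀ c (n + 1)).symm (x, (y : UnitAddCircle)))
    rw [zero_add] at h2
    simp only [hcomp, proj] at h1
    rw [h2] at h1
    exact h1.trans (by linarith)
  have hint : ∫ z, f z
      = ∫ y : UnitAddCircle, ∫ x : UnitAddCircle, f ((HTorus q₀ c (n + 1)).symm (x, y)) := by
    have hc2 : Continuous fun z => f ((HTorus q₀ c (n + 1)).symm z) :=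
      hf.comp hH'.continuous_symm
    have h3 := integral_map (μ := volume) hH'.continuous_symm.measurable.aemeasurable
      (f := f) hf.measurable.aestronglyMeasurable
    rw [hH'.measurePreserving_symm.map_eq] at h3
    rw [h3]
    exact integral_prod_symm _
      (hc2.integrable_of_hasCompactSupport (HasCompactSupport.of_compactSpace _))
  -- Since `H_{n+1}` preserves the measure, `∫ f` is the mean over `y` of the curve integrals. It is
  -- therefore as close to the constant as each of them, and the errors double.
  have hmean : |(∫ z, f z) - ∫ t in (0 : ℝ)..1, gridAverage (c n).l g t|
      ≤ 2 * ω + 8 * B / 2 ^ n := by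
    set C := ∫ t in (0 : ℝ)..1, gridAverage (c n).l g t
    have hc2 : Continuous fun z => f ((HTorus q₀ c (n + 1)).symm z) :=
      hf.comp hH'.continuous_symm
    have hi : Integrable
        (fun y : UnitAddCircle => ∫ x : UnitAddCircle, f ((HTorus q₀ c (n + 1)).symm (x, y))) :=
      (show Integrable (fun z => f ((HTorus q₀ c (n + 1)).symm z))
          ((volume : Measure UnitAddCircle).prod volume) from
        hc2.integrable_of_hasCompactSupport (HasCompactSupport.of_compactSpace _)).integral_prod_right
    have h4 : (∫ z, f z) - C = ∫ y : UnitAddCircle,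
        ((∫ x : UnitAddCircle, f ((HTorus q₀ c (n + 1)).symm (x, y))) - C) := by
      rw [integral_sub hi (integrable_const _), hint]
      simp
    rw [h4, ← Real.norm_eq_abs]
    refine (norm_integral_le_of_norm_le_const (Eventually.of_forall key)).trans ?_
    simp
  have := abs_sub_le (∫ x : UnitAddCircle, f ((HTorus q₀ c (n + 1)).symm (x, y)))
    (∫ t in (0 : ℝ)..1, gridAverage (c n).l g t) (∫ z, f z)
  rw [abs_sub_comm (∫ t in (0 : ℝ)..1, gridAverage (c n).l g t)] at this
  have := key y
  have e : 16 * B / 2 ^ n = 8 * B / 2 ^ n + 8 * B / 2 ^ n := by ring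
  linarith

/-- Averages of `f` along `q_{n+1} / q_n` equidistant points of an orbit of the conjugated flow. -/
lemma abs_average_ST_sub_le (h : Admissible q₀ c) (hc : Controlled q₀ c) {f : T2 → ℝ}
    (hf : Continuous f) {B ω : ℝ} (hB : ∀ x, |f x| ≤ B) (hω0 : 0 ≤ ω) {n : ℕ}
    (hω : ∀ x y, dist x y ≤ 10 / 2 ^ n → |f x - f y| ≤ ω) (x : T2) {M : ℕ}
    (hM : M = (c n).k * (c n).l ^ 2) :
    |(∑ j ∈ Finset.range M, f (ST q₀ c (n + 1) (j / M) x)) / M - ∫ z, f z|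
      ≤ 5 * ω + 16 * B / 2 ^ n := by
  have hk : 0 < (c n).k := by have := hc.k_two n; omega
  have hM0 : 0 < M := by rw [hM]; exact Nat.mul_pos hk (pow_pos (hc.l_pos n) 2)
  have hM0' : (0 : ℝ) < M := by exact_mod_cast hM0
  have hkM : (c n).k ≤ M := by rw [hM]; exact Nat.le_mul_of_pos_right _ (pow_pos (hc.l_pos n) 2)
  have hkM' : ((c n).k : ℝ) ≤ M := by exact_mod_cast hkM
  -- The average is a Riemann sum over one period of the flow. Its mesh `1 / M` is at most `1 /
  -- k_n`, so the shift bound keeps the error below one `ω`.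
  have h1 := abs_integral_sub_average_le_const (F := fun t => f (ST q₀ c (n + 1) t x)) hM0
    (C := fun j => f (ST q₀ c (n + 1) (j / M) x)) (ω := ω)
    (fun a b => (hf.comp (continuous_ST_time hc _ x)).intervalIntegrable a b) fun j _ s hs => by
      have e1 : s = j / M + (s - j / M) := by ring
      have e2 : ((j : ℝ) + 1) / M = j / M + 1 / M := by ring
      refine hω _ _ ?_
      nth_rewrite 1 [e1]
      refine (dist_ST_add_le hc n _ ?_ x).trans (by gcongr; norm_num)
      rw [abs_of_nonneg (by linarith [hs.1])]
      have h3 : s - j / M ≤ 1 / M := by linarith [hs.2]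
      have h4 : 0 ≤ s - j / M := by linarith [hs.1]
      calc (s - j / M) * (c n).k ≤ 1 / M * M := by gcongr
        _ = 1 := by field_simp
  -- The flow orbit is the conjugated horizontal circle through `H_{n+1} x`; its starting point is
  -- irrelevant by invariance under rotation.
  have h2 : ∫ t in (0 : ℝ)..1, f (ST q₀ c (n + 1) t x)
      = ∫ u : UnitAddCircle, f ((HTorus q₀ c (n + 1)).symm (u, (HTorus q₀ c (n + 1) x).2)) := by
    rw [← integral_add_left_eq_self _ (HTorus q₀ c (n + 1) x).1]
    have h5 := UnitAddCircle.intervalIntegral_preimage 0 fun u => f ((HTorus q₀ c (n + 1)).symm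
      ((HTorus q₀ c (n + 1) x).1 + u, (HTorus q₀ c (n + 1) x).2))
    rw [zero_add] at h5
    exact h5
  rw [h2] at h1
  have h3 := abs_integral_HTorus_symm_sub_le h hc hf hB hω0 hω (HTorus q₀ c (n + 1) x).2
  rw [abs_sub_comm] at h1
  have := abs_sub_le ((∑ j ∈ Finset.range M, f (ST q₀ c (n + 1) (j / M) x)) / M)
    (∫ u : UnitAddCircle, f ((HTorus q₀ c (n + 1)).symm (u, (HTorus q₀ c (n + 1) x).2)))
    (∫ z, f z)
  linarith

/-- The time discrepancy `i / q_{n+1}` of the `i`-th iterates is still at most `1 / k_n` for `i ≤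
q_n`, so one shift bound controls a whole period without accumulation of errors. -/
lemma dist_ST_iterate_le (hc : Controlled q₀ c) (p₀ : ℕ) {i m : ℕ} (hi : i ≤ q q₀ c m) (x : T2) :
    dist (ST q₀ c m (i * alpha p₀ q₀ c m) x) (ST q₀ c (m + 1) (i * alpha p₀ q₀ c (m + 1)) x)
      ≤ 1 / 2 ^ m := by
  have h1 := dist_ST_le hc m ((i : ℤ) * (p p₀ c m : ℤ)) (time_le hc m hi) x
  have e1 : (i : ℝ) * alpha p₀ q₀ c m
      = (((i : ℤ) * (p p₀ c m : ℤ) : ℤ) : ℝ) / (q q₀ c m : ℝ) := by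
    simp only [alpha]; push_cast; ring
  have e2 : (i : ℝ) * alpha p₀ q₀ c (m + 1)
      = (((i : ℤ) * (p p₀ c m : ℤ) : ℤ) : ℝ) / (q q₀ c m : ℝ) + i / (q q₀ c (m + 1) : ℝ) := by
    rw [alpha_succ hc]; push_cast; ring
  rwa [e1, e2]

variable {T : T2 → T2} {p₀ : ℕ}

/-- Iterates need uniform convergence of `T_n`, which is recovered from pointwise convergence by the
geometric bounds between consecutive stages. -/
lemma tendsto_Tn_iterate (hc : Controlled q₀ c) (hT : Continuous T)
    (h : ∀ x, Tendsto (fun n => Tn p₀ q₀ c n x) atTop (𝓝 (T x))) (i : ℕ) (x : T2) :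
    Tendsto (fun n => (Tn p₀ q₀ c n ^ i) x) atTop (𝓝 (T^[i] x)) := by
  have hu : ∀ n y, dist (Tn p₀ q₀ c n y) (T y) ≤ 2 / 2 ^ n := fun n y => by
    refine dist_lim_of_geometric (u := fun n => Tn p₀ q₀ c n y) (fun m _ => ?_) (h y)
    simpa [Tn_eq] using dist_ST_iterate_le hc p₀ (i := 1) (hc.tame m).q_pos y
  induction i with
  | zero => simp
  | succ i ih =>
    rw [Function.iterate_succ_apply', tendsto_iff_dist_tendsto_zero]
    have h1 := (tendsto_iff_dist_tendsto_zero.1 ((hT.tendsto _).comp ih))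
    have h2 := tendsto_two_div_pow.add h1
    rw [add_zero] at h2
    refine squeeze_zero (fun _ => dist_nonneg) (fun n => ?_) h2
    rw [pow_succ', Equiv.Perm.mul_apply]
    exact (dist_triangle _ (T ((Tn p₀ q₀ c n ^ i) x)) _).trans (add_le_add (hu n _) le_rfl)

lemma dist_iterate_le (hc : Controlled q₀ c) (hT : Continuous T)
    (h : ∀ x, Tendsto (fun n => Tn p₀ q₀ c n x) atTop (𝓝 (T x))) {i n : ℕ}
    (hi : i ≤ q q₀ c n) (x : T2) :
    dist (ST q₀ c n (i * alpha p₀ q₀ c n) x) (T^[i] x) ≤ 2 / 2 ^ n := by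
  refine dist_lim_of_geometric (u := fun m => ST q₀ c m (i * alpha p₀ q₀ c m) x)
    (fun m hm => dist_ST_iterate_le hc p₀ (hi.trans (hc.q_mono hm)) x) ?_
  refine (tendsto_Tn_iterate hc hT h i x).congr fun m => ?_
  rw [Tn_eq, ST_pow]

/-- As `q_n α_{n+1}` is `1 / M` modulo 1, the iterate `q_n j` of `T_{n+1}` is the flow at time `j /
M`. These exponents stay below `q_{n+1}`, so `T` follows `T_{n+1}` at the cost of one more `ω`. -/
lemma abs_average_iterate_sub_le (h : Admissible q₀ c) (hc : Controlled q₀ c) (hT : Continuous T)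
    (hlim : ∀ x, Tendsto (fun n => Tn p₀ q₀ c n x) atTop (𝓝 (T x))) {f : T2 → ℝ}
    (hf : Continuous f) {B ω : ℝ} (hB : ∀ x, |f x| ≤ B) (hω0 : 0 ≤ ω) {n : ℕ}
    (hω : ∀ x y, dist x y ≤ 10 / 2 ^ n → |f x - f y| ≤ ω) (x : T2) {M : ℕ}
    (hM : M = (c n).k * (c n).l ^ 2) :
    |(∑ j ∈ Finset.range M, f (T^[q q₀ c n * j] x)) / M - ∫ z, f z|
      ≤ 6 * ω + 16 * B / 2 ^ n := by
  have hk : 0 < (c n).k := by have := hc.k_two n; omega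
  have hM0 : 0 < M := by rw [hM]; exact Nat.mul_pos hk (pow_pos (hc.l_pos n) 2)
  have hM0' : (0 : ℝ) < M := by exact_mod_cast hM0
  have hq : q q₀ c (n + 1) = M * q q₀ c n := by rw [hM]; rfl
  have hq0 : (0 : ℝ) < q q₀ c n := by exact_mod_cast (hc.tame n).q_pos
  have h1 : ∀ j ∈ Finset.range M,
      |f (T^[q q₀ c n * j] x) - f (ST q₀ c (n + 1) (j / M) x)| ≤ ω := by
    intro j hj
    have hj' := Finset.mem_range.1 hj
    have h2 := dist_iterate_le hc hT hlim (i := q q₀ c n * j) (n := n + 1)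
      (by rw [hq, mul_comm]; exact Nat.mul_le_mul_right _ hj'.le) x
    have e1 : ((q q₀ c n * j : ℕ) : ℝ) * alpha p₀ q₀ c (n + 1)
        = j / M + ((j * p p₀ c n : ℤ) : ℝ) := by
      rw [alpha_succ hc, hq]; push_cast; field_simp; ring
    rw [e1, ST_add_int, dist_comm] at h2
    refine hω _ _ (h2.trans ?_)
    rw [pow_succ, div_le_div_iff₀ (by positivity) (by positivity)]
    nlinarith [show (0 : ℝ) < 2 ^ n by positivity]
  have h3 : |(∑ j ∈ Finset.range M, f (T^[q q₀ c n * j] x)) / M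
      - (∑ j ∈ Finset.range M, f (ST q₀ c (n + 1) (j / M) x)) / M| ≤ ω := by
    rw [← sub_div, ← Finset.sum_sub_distrib, abs_div, abs_of_pos hM0', div_le_iff₀ hM0']
    refine (Finset.abs_sum_le_sum_abs _ _).trans ((Finset.sum_le_card_nsmul _ _ ω h1).trans ?_)
    simp [mul_comm]
  have h4 := abs_average_ST_sub_le h hc hf hB hω0 hω x hM
  have := abs_sub_le ((∑ j ∈ Finset.range M, f (T^[q q₀ c n * j] x)) / M)
    ((∑ j ∈ Finset.range M, f (ST q₀ c (n + 1) (j / M) x)) / M) (∫ z, f z)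
  linarith

open BoundedContinuousFunction in
-- For invariant `ν` every iterate of `f` has the same integral, so `∫ f dν` is also the integral of
-- averages along the sparse times `q_n j`, which are uniformly near the Lebesgue integral.
-- Convergence of full Birkhoff averages is not needed.
lemma uniquelyErgodic_of_tendsto (h : Admissible q₀ c) (hc : Controlled q₀ c) (hT : Continuous T)
    (hlim : ∀ x, Tendsto (fun n => Tn p₀ q₀ c n x) atTop (𝓝 (T x)))
    (hvol : MeasurePreserving T volume volume) : UniquelyErgodic T := by
  refine ⟨volume, ⟨inferInstance, hvol⟩, ?_⟩
  rintro ν ⟨hν, hinv⟩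
  refine ext_of_forall_integral_eq_of_IsFiniteMeasure fun f => ?_
  have hi : ∀ i, ∫ x, f (T^[i] x) ∂ν = ∫ x, f x ∂ν := fun i => by
    have := hinv.iterate i
    rw [← integral_map this.measurable.aemeasurable
      f.continuous.measurable.aestronglyMeasurable, this.map_eq]
  have hint : ∀ i, Integrable (fun x => f (T^[i] x)) ν := fun i =>
    (f.continuous.comp (hT.iterate i)).integrable_of_hasCompactSupport
      (HasCompactSupport.of_compactSpace _)
  have hB : ∀ x, |f x| ≤ ‖f‖ := fun x => f.norm_coe_le_norm x
  have key : ∀ ω > 0, |∫ x, f x ∂ν - ∫ x, f x| ≤ 7 * ω := by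
    intro ω hω
    have hu := CompactSpace.uniformContinuous_of_continuous f.continuous
    obtain ⟨δ, hδ, hfδ⟩ := Metric.uniformContinuous_iff.1 hu ω hω
    have t1 : Tendsto (fun n : ℕ => (10 : ℝ) / 2 ^ n) atTop (𝓝 0) :=
      tendsto_const_nhds.div_atTop (tendsto_pow_atTop_atTop_of_one_lt one_lt_two)
    have t2 : Tendsto (fun n : ℕ => 16 * ‖f‖ / 2 ^ n) atTop (𝓝 0) :=
      tendsto_const_nhds.div_atTop (tendsto_pow_atTop_atTop_of_one_lt one_lt_two)
    -- With `16 * ‖f‖ / 2 ^ n` below `ω`, the total error is `7 * ω`.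
    obtain ⟨n, hn1, hn2⟩ := ((t1.eventually (gt_mem_nhds hδ)).and
      (t2.eventually (gt_mem_nhds hω))).exists
    set M := (c n).k * (c n).l ^ 2 with hM
    have hk : 0 < (c n).k := by have := hc.k_two n; omega
    have hM0 : 0 < M := Nat.mul_pos hk (pow_pos (hc.l_pos n) 2)
    have hM0' : (M : ℝ) ≠ 0 := by positivity
    have h1 := fun x => abs_average_iterate_sub_le h hc hT hlim f.continuous hB hω.le
      (fun x y hxy => (hfδ (hxy.trans_lt hn1)).le) x hM
    have h2 : ∫ x, f x ∂ν - ∫ x, f x = ∫ x,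
        ((∑ j ∈ Finset.range M, f (T^[q q₀ c n * j] x)) / M - ∫ z, f z) ∂ν := by
      rw [integral_sub ((integrable_finsetSum _ fun j _ => hint _).div_const _)
        (integrable_const _), integral_div, integral_finsetSum _ fun j _ => hint _]
      simp only [hi]
      rw [Finset.sum_const, Finset.card_range, nsmul_eq_mul, mul_div_cancel_left₀ _ hM0']
      simp
    rw [h2, ← Real.norm_eq_abs]
    refine (norm_integral_le_of_norm_le_const (Eventually.of_forall h1)).trans ?_
    simp only [probReal_univ, mul_one]
    linarith
  have h0 : |∫ x, f x ∂ν - ∫ x, f x| ≤ 0 := le_of_forall_pos_le_add fun ε hε => by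
    have := key (ε / 7) (by positivity)
    linarith
  exact sub_eq_zero.1 (abs_nonpos_iff.1 h0)

end Ergodic

/-! ### Existence of the approximating entire functions -/

/-- A continuous function on the circle that takes the values of a step function away from its
jumps. -/
lemma exists_continuous_step {k : ℕ} (hk : 0 < k) (a : ℕ → ℝ) {δ : ℝ} (hδ : 0 < δ) :
    ∃ F : C(UnitAddCircle, ℝ), ∀ i < k, ∀ y : ℝ, i + δ / 2 ≤ k * y → k * y ≤ i + 1 - δ / 2 →
      F (y : UnitAddCircle) = a i := by
  have hk0 : (0 : ℝ) < k := by exact_mod_cast hk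
  have hcoe : Continuous ((↑) : ℝ → UnitAddCircle) := AddCircle.continuous_mk' 1
  -- `A i` is the `i`-th step shortened at both ends and `E i` is the closed arc complementary to
  -- the open `i`-th step. Urysohn functions for these pairs are weighted by `a` and added.
  let A : ℕ → Set UnitAddCircle := fun i =>
    (↑) '' Set.Icc ((i + δ / 2) / k : ℝ) ((i + 1 - δ / 2) / k)
  let E : ℕ → Set UnitAddCircle := fun i => (↑) '' Set.Icc ((i + 1) / k : ℝ) (i / k + 1)
  have hdisj : ∀ i, Disjoint (E i) (A i) := by
    intro i
    rw [Set.disjoint_left]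
    rintro _ ⟨x, hx, rfl⟩ ⟨y, hy, hxy⟩
    obtain ⟨m, hm⟩ := coe_circle_eq_iff.1 hxy
    have h1 := (div_le_iff₀ hk0).1 hy.1
    have h2 := (le_div_iff₀ hk0).1 hy.2
    have h3 := (div_le_iff₀ hk0).1 hx.1
    have h4 : x * k ≤ i + k := by
      have := mul_le_mul_of_nonneg_right hx.2 hk0.le
      rwa [add_mul, div_mul_cancel₀ _ hk0.ne', one_mul] at this
    have h5 : (m : ℝ) < 0 := by nlinarith
    have h6 : (-1 : ℝ) < m := by nlinarith
    have h7 : m < 0 := by exact_mod_cast h5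
    have h8 : -1 < m := by exact_mod_cast h6
    omega
  have hU : ∀ i, ∃ f : C(UnitAddCircle, ℝ), Set.EqOn f 0 (E i) ∧ Set.EqOn f 1 (A i) := fun i => by
    obtain ⟨f, h0, h1, -⟩ := exists_continuous_zero_one_of_isClosed
      (isCompact_Icc.image hcoe).isClosed (isCompact_Icc.image hcoe).isClosed (hdisj i)
    exact ⟨f, h0, h1⟩
  choose f hf0 hf1 using hU
  refine ⟨∑ j ∈ Finset.range k, a j • f j, fun i hi y h1 h2 => ?_⟩
  have hfi : f i (y : UnitAddCircle) = 1 := hf1 i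
    ⟨y, ⟨(div_le_iff₀ hk0).2 (by linarith), (le_div_iff₀ hk0).2 (by linarith)⟩, rfl⟩
  have hfj : ∀ j ∈ Finset.range k, j ≠ i → (a j • f j) (y : UnitAddCircle) = 0 := by
    intro j hj hji
    have hjk : (j : ℝ) + 1 ≤ k := by exact_mod_cast Finset.mem_range.1 hj
    have hik : (i : ℝ) + 1 ≤ k := by exact_mod_cast hi
    have : f j (y : UnitAddCircle) = 0 := by
      rcases lt_or_gt_of_ne hji with hlt | hgt
      · have h3 : (j : ℝ) + 1 ≤ i := by exact_mod_cast hlt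
        refine hf0 j ⟨y, ⟨(div_le_iff₀ hk0).2 (by linarith), ?_⟩, rfl⟩
        have h4 : (0 : ℝ) ≤ j := Nat.cast_nonneg j
        have : y ≤ 1 := by by_contra! h; nlinarith
        have : (0 : ℝ) ≤ j / k := by positivity
        linarith
      · have h3 : (i : ℝ) + 1 ≤ j := by exact_mod_cast hgt
        have h4 : (0 : ℝ) ≤ i := Nat.cast_nonneg i
        have hy0 : 0 ≤ y := by by_contra! h; nlinarith
        refine hf0 j ⟨y + 1, ⟨(div_le_iff₀ hk0).2 (by nlinarith), ?_⟩,
          coe_circle_eq_iff.2 ⟨1, by simp⟩⟩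
        have : y ≤ j / k := (le_div_iff₀ hk0).2 (by linarith)
        linarith
    simp [this]
  rw [ContinuousMap.sum_apply, Finset.sum_eq_single i hfj
    fun h => absurd (Finset.mem_range.2 hi) h]
  simp [hfi]

/-- Trigonometric polynomials and their complex conjugates extend to entire functions. -/
lemma exists_entire_of_mem_span {P : C(UnitAddCircle, ℂ)}
    (hP : P ∈ Submodule.span ℂ (Set.range (fourier (T := (1 : ℝ))))) :
    ∃ S S' : ℂ → ℂ, Differentiable ℂ S ∧ Differentiable ℂ S' ∧ (∀ z, S (z + 1) = S z) ∧
      (∀ z, S' (z + 1) = S' z) ∧ ∀ x : ℝ, S x = P (x : UnitAddCircle) ∧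
        S' x = (starRingEnd ℂ) (P (x : UnitAddCircle)) := by
  induction hP using Submodule.span_induction with
  | mem P h =>
    obtain ⟨n, rfl⟩ := h
    have hper : ∀ (n : ℤ) (z : ℂ), Complex.exp (2 * Real.pi * Complex.I * n * (z + 1))
        = Complex.exp (2 * Real.pi * Complex.I * n * z) := fun n z => by
      rw [show 2 * Real.pi * Complex.I * n * (z + 1) = 2 * Real.pi * Complex.I * n * z
        + n * (2 * Real.pi * Complex.I) by ring, Complex.exp_add,
        Complex.exp_int_mul_two_pi_mul_I, mul_one]
    refine ⟨fun z => Complex.exp (2 * Real.pi * Complex.I * n * z),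
      fun z => Complex.exp (2 * Real.pi * Complex.I * (-n : ℤ) * z), by fun_prop, by fun_prop,
      hper n, hper (-n), fun x => ?_⟩
    rw [← fourier_neg, fourier_coe_apply, fourier_coe_apply]
    simp
  | zero => exact ⟨0, 0, differentiable_const 0, differentiable_const 0, fun _ => rfl,
      fun _ => rfl, fun x => by simp⟩
  | add P Q _ _ hP hQ =>
    obtain ⟨S, S', h1, h2, h3, h4, h5⟩ := hP
    obtain ⟨R, R', g1, g2, g3, g4, g5⟩ := hQ
    exact ⟨S + R, S' + R', h1.add g1, h2.add g2, fun z => by simp [h3, g3],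
      fun z => by simp [h4, g4], fun x => by simp [h5, g5]⟩
  | smul r P _ hP =>
    obtain ⟨S, S', h1, h2, h3, h4, h5⟩ := hP
    exact ⟨r • S, (starRingEnd ℂ r) • S', h1.const_smul r, h2.const_smul _,
      fun z => by simp [h3], fun z => by simp [h4], fun x => by simp [h5]⟩

/-- Continuous functions on the circle are uniform limits of entire functions. -/
lemma exists_entire_near (F : C(UnitAddCircle, ℝ)) {ε : ℝ} (hε : 0 < ε) :
    ∃ s : ℂ → ℂ, Differentiable ℂ s ∧ (∀ z, s (z + 1) = s z) ∧ (∀ x : ℝ, (s x).im = 0) ∧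
      ∀ x : ℝ, |(s x).re - F (x : UnitAddCircle)| ≤ ε := by
  let G : C(UnitAddCircle, ℂ) := ⟨fun x => (F x : ℂ), by fun_prop⟩
  have hG : G ∈ (Submodule.span ℂ (Set.range (fourier (T := (1 : ℝ))))).topologicalClosure := by
    rw [span_fourier_closure_eq_top]; trivial
  rw [← SetLike.mem_coe, Submodule.topologicalClosure_coe] at hG
  obtain ⟨P, hP, hd⟩ := Metric.mem_closure_iff.1 hG ε hε
  obtain ⟨S, S', h1, h2, h3, h4, h5⟩ := exists_entire_of_mem_span hP
  -- `S'` extends the complex conjugate of `P`, so the half sum is an entire extension of its real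
  -- part.
  have hs : ∀ x : ℝ, (S x + S' x) / 2 = ((P (x : UnitAddCircle)).re : ℂ) := fun x => by
    rw [(h5 x).1, (h5 x).2, Complex.add_conj]; push_cast; ring
  refine ⟨fun z => (S z + S' z) / 2, (h1.add h2).div_const 2, fun z => by simp only [h3, h4],
    fun x => by simp only [hs, Complex.ofReal_im], fun x => ?_⟩
  simp only [hs, Complex.ofReal_re]
  have h6 : ‖(P - G) (x : UnitAddCircle)‖ ≤ ‖P - G‖ := ContinuousMap.norm_coe_le_norm _ _
  rw [dist_comm, dist_eq_norm] at hd
  have h7 := Complex.abs_re_le_norm ((P - G) (x : UnitAddCircle))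
  have h8 : ((P - G) (x : UnitAddCircle)).re
      = (P (x : UnitAddCircle)).re - F (x : UnitAddCircle) := by
    simp [G]
  rw [h8] at h7
  linarith

/-- An approximation on the circle of the step function with `N = 1` is composed with `z ↦ N z`. The
accuracy `ε / 2` leaves room for the strict inequality in `ApproxStep.near`. -/
lemma exists_approxStep {k N : ℕ} (hk : 0 < k) (hN : 0 < N) (a : ℕ → ℝ) {ε δ : ℝ} (hε : 0 < ε)
    (hδ : 0 < δ) : ∃ s, ApproxStep k N a ε δ s := by
  obtain ⟨F, hF⟩ := exists_continuous_step hk a hδ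
  obtain ⟨s, h1, h2, h3, h4⟩ := exists_entire_near F (half_pos hε)
  have hN0 : (N : ℂ) ≠ 0 := by exact_mod_cast hN.ne'
  have hkN : (0 : ℝ) < k * N := by positivity
  refine ⟨fun z => s (N * z), h1.comp (differentiable_id.const_mul _), fun x => ?_, fun z => ?_,
    ε / 2, half_lt_self hε, ?_⟩
  · simpa using h3 (N * x)
  · simp only [mul_add, mul_one_div_cancel hN0, h2]
  · rintro x ⟨hx, hex⟩
    set n := ⌊(k * N : ℝ) * x⌋₊ with hn
    have hx0 : 0 ≤ (k * N : ℝ) * x := mul_nonneg hkN.le hx.1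
    have hfar : ∀ i : ℕ, i ≤ k * N → δ / 2 < |(k * N : ℝ) * x - i| := fun i hi => by
      by_contra! hle
      refine hex ⟨hx, i, hi, ?_⟩
      have e : x - i / (k * N : ℝ) = ((k * N : ℝ) * x - i) / (k * N) := by field_simp
      rw [e, abs_div, abs_of_pos hkN, div_le_div_iff₀ hkN (by positivity)]
      nlinarith
    have f1 := Nat.floor_le hx0
    have f2 := Nat.lt_floor_add_one ((k * N : ℝ) * x)
    rw [← hn] at f1 f2
    have hnlt : n < k * N := by
      have : (n : ℝ) < (k * N : ℕ) := by push_cast; nlinarith [hx.2]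
      exact_mod_cast this
    have g1 := hfar n hnlt.le
    have g2 := hfar (n + 1) hnlt
    push_cast at g2
    rw [abs_of_nonneg (by linarith)] at g1
    rw [abs_of_neg (by linarith)] at g2
    have hdm : ((n % k : ℕ) : ℝ) = n - k * ((n / k : ℕ) : ℝ) := by
      have : ((k * (n / k) + n % k : ℕ) : ℝ) = n := by rw [Nat.div_add_mod]
      push_cast at this
      linarith
    have hval := hF (n % k) (Nat.mod_lt _ hk) (N * x - ((n / k : ℕ) : ℝ))
      (by rw [hdm]; nlinarith) (by rw [hdm]; nlinarith)
    have hcirc : ((N * x - ((n / k : ℕ) : ℝ) : ℝ) : UnitAddCircle) = ((N * x : ℝ) : UnitAddCircle) :=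
      coe_circle_eq_iff.2 ⟨-((n / k : ℕ) : ℤ), by rw [Int.cast_neg, Int.cast_natCast]; ring⟩
    rw [hcirc] at hval
    have := h4 (N * x)
    rw [hval] at this
    rw [stepFn_eq hk hN a hx]
    simpa using this

/-! ### Existence of the construction -/

instance : Inhabited Choice := ⟨⟨0, 0, 0, 0, 0⟩⟩

/-- A sequence given by a rule for continuing finite sequences. -/
def seqOfStep {α : Type*} (step : (n : ℕ) → (Fin n → α) → α) (n : ℕ) : α :=
  step n fun i => seqOfStep step i
termination_by n
decreasing_by exact i.2

lemma exists_stepAt {l q : ℕ} (hl : 0 < l) (hq : 0 < q) : ∃ ψ₁ ψ₂ ψ₃, StepAt l q ψ₁ ψ₂ ψ₃ := by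
  have hδ : 0 < precision l q := by
    have : (0 : ℝ) < l := by exact_mod_cast hl
    have : (0 : ℝ) < q := by exact_mod_cast hq
    rw [precision]; positivity
  have hε : 0 < precision l q / 3 := by positivity
  obtain ⟨ψ₁, h1⟩ := exists_approxStep hl one_pos
    (fun i => if i = 0 then 0 else ((l : ℝ) - i) / ((l : ℝ) ^ 2 * (q : ℝ))) hε hδ
  obtain ⟨ψ₂, h2⟩ := exists_approxStep hl (Nat.mul_pos hl hq) (fun i => (i : ℝ) / (l : ℝ)) hε hδ
  obtain ⟨ψ₃, h3⟩ := exists_approxStep hl one_pos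
    (fun i => (i : ℝ) / ((l : ℝ) ^ 2 * (q : ℝ))) hε hδ
  exact ⟨ψ₁, ψ₂, ψ₃, h1, h2, h3⟩

/-- The choice `d` at stage `n` is allowed after the choices `prior`. -/
structure IsAllowed (κ : Threshold) (p₀ q₀ n : ℕ) (prior : Fin n → Choice) (d : Choice) :
    Prop where
  l_large : 2 ^ n * derivNorm (HPlane q₀ (extend n prior default) n) < (d.l : ℝ≥0∞)
  stepAt : StepAt d.l (q q₀ (extend n prior default) n) d.ψ₁ d.ψ₂ d.ψ₃
  large_k : κ p₀ q₀ n prior d.l d.ψ₁ d.ψ₂ d.ψ₃ ≤ d.k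
  k_pos : 0 < d.k

lemma IsAllowed.l_pos {κ : Threshold} {p₀ q₀ n : ℕ} {prior : Fin n → Choice} {d : Choice}
    (h : IsAllowed κ p₀ q₀ n prior d) : 0 < d.l := by
  have := h.l_large
  rcases Nat.eq_zero_or_pos d.l with h0 | h0
  · simp [h0] at this
  · exact h0

/-- An allowed continuation always exists, since earlier allowed stages are tame and hence
`‖DH_n‖_0` is finite. The strong induction shows that the recursion never falls into its default
branch. -/
lemma exists_construction (κ : Threshold) (p₀ : ℕ) {q₀ : ℕ} (hq : 0 < q₀) :
    ∃ c : ℕ → Choice, Admissible q₀ c ∧ LargeK κ p₀ q₀ c := by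
  classical
  let step : (n : ℕ) → (Fin n → Choice) → Choice := fun n prior =>
    if h : ∃ d, IsAllowed κ p₀ q₀ n prior d then h.choose else default
  let c : ℕ → Choice := seqOfStep step
  have hc : ∀ n, c n = step n fun i => c i := fun n => by
    show seqOfStep step n = _
    rw [seqOfStep]
  have hext : ∀ n, ∀ i < n, extend n (fun i => c i) default i = c i := fun n i hi => by
    simp [extend, hi]
  have hall : ∀ n, IsAllowed κ p₀ q₀ n (fun i => c i) (c n) := by
    intro n
    induction n using Nat.strong_induction_on with
    | _ n ih =>
      have hqi : ∀ i ≤ n, 0 < q q₀ c i := fun i hi => q_pos_of hq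
        (fun j hj => (ih j (by omega)).l_pos) fun j hj => (ih j (by omega)).k_pos
      have ht : ∀ i < n, TameAt q₀ c i := fun i hi => by
        have := (ih i hi).stepAt
        rw [q_congr (hext i)] at this
        exact this.tameAt (ih i hi).l_pos (hqi i hi.le)
      have hex : ∃ d, IsAllowed κ p₀ q₀ n (fun i => c i) d := by
        have hfin : 2 ^ n * derivNorm (HPlane q₀ c n) ≠ ⊤ :=
          ENNReal.mul_ne_top (by simp) (derivNorm_HPlane_ne_top ht)
        obtain ⟨l, hl⟩ := ENNReal.exists_nat_gt hfin
        have hl0 : 0 < l := by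
          rcases Nat.eq_zero_or_pos l with h0 | h0
          · simp [h0] at hl
          · exact h0
        obtain ⟨ψ₁, ψ₂, ψ₃, hψ⟩ := exists_stepAt hl0 (hqi n le_rfl)
        -- The threshold is arbitrary here and may vanish; the value 1 keeps all `q_n` positive.
        refine ⟨⟨l, ψ₁, ψ₂, ψ₃, max 1 (κ p₀ q₀ n (fun i => c i) l ψ₁ ψ₂ ψ₃)⟩, ?_, ?_,
          le_max_right _ _, lt_of_lt_of_le one_pos (le_max_left _ _)⟩
        · rwa [HPlane_congr (hext n)]
        · rwa [q_congr (hext n)]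
      have h1 : c n = hex.choose := by
        rw [hc n]; exact dif_pos hex
      rw [h1]
      exact hex.choose_spec
  have hstep : ∀ n, StepAt (c n).l (q q₀ c n) (c n).ψ₁ (c n).ψ₂ (c n).ψ₃ := fun n => by
    have := (hall n).stepAt
    rwa [q_congr (hext n)] at this
  refine ⟨c, ⟨fun n => ?_, fun n => (hstep n).approx₁, fun n => (hstep n).approx₂,
    fun n => (hstep n).approx₃⟩, fun n => (hall n).large_k⟩
  have := (hall n).l_large
  rwa [HPlane_congr (hext n)] at this

end AbC

end

theorem mainTheorem3 :
    ∃ κ : AbC.Threshold, ∀ p₀ q₀ : ℕ, p₀ < q₀ →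
      (∃ c : ℕ → AbC.Choice, AbC.Admissible q₀ c ∧ AbC.LargeK κ p₀ q₀ c) ∧
      ∀ c : ℕ → AbC.Choice, AbC.Admissible q₀ c → AbC.LargeK κ p₀ q₀ c →
        ∃ T : AbC.T2 ≃ₜ AbC.T2,
          (∀ ρ : ℝ, 0 < ρ → AbC.IsDiffRho ρ T ∧
            Tendsto (fun n => AbC.distRho ρ (AbC.Tn p₀ q₀ c n) T) atTop (𝓝 0)) ∧
          AbC.UniquelyErgodic T := by
  refine ⟨AbC.kappa, fun p₀ q₀ h0 => ⟨AbC.exists_construction _ p₀ (by omega), fun c hA hk => ?_⟩⟩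
  have hc := hA.controlled (by omega) hk
  obtain ⟨T, hlift, hsymm, hdist, hlim⟩ := AbC.exists_limit hc p₀
  have hmp : MeasurePreserving T volume volume :=
    AbC.measurePreserving_of_tendsto (fun n =>
      (AbC.isMeasureHomeo_ST (n := n) (fun i _ => hc.tame i) _).measurePreserving)
      T.continuous hlim
  exact ⟨T, fun ρ _ => ⟨⟨hmp, hlift ρ, hsymm⟩, hdist ρ⟩,
    AbC.uniquelyErgodic_of_tendsto hA hc T.continuous hlim hmp⟩
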